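/- Let $p>3$ be a prime, $f\ge 1$, $\Gamma=\mathrm{GL}_2(\mathbb F_{p^f})$, and let $\overline{\mathbb F}_p$ be an algebraic closure of $\mathbb F_{p^f}$. All representations are over $\overline{\mathbb F}_p$. Let $U\subset B\subset\Gamma$ be the upper triangular unipotent and the upper triangular matrices. A weight is an irreducible representation of $\Gamma$. For $\mathbf r=(r_0,\dots,r_{f-1})$ with $0\le r_j\le p-1$ and $m\in\mathbb Z$ write $\mathbf r\otimes\det^m=\bigl(\bigotimes_{j=0}^{f-1}\mathrm{Sym}^{r_j}\overline{\mathbb F}_p^2\circ\Phi^j\bigr)\otimes\det^m$, where $\Phi$ is induced by $\alpha\mapsto\alpha^p$. A weight is generic if it is not isomorphic to $(0,\dots,0)\otimes\det^m$ or $(p-1,\dots,p-1)\otimes\det^m$ for any $m$. For a weight $\sigma$, $\chi(\sigma)$ is the character by which $B$ acts on the line $\sigma^U$; for a character $\chi$ of $B$, $\chi^s$ is the character $\left(\begin{smallmatrix}a&b\\0&d\end{smallmatrix}\right)\mapsto\chi\left(\begin{smallmatrix}d&0\\0&a\end{smallmatrix}\right)$; for generic $\sigma$, $\sigma^{[s]}$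 is the generic weight with $\chi(\sigma^{[s]})=\chi(\sigma)^s$. $E(\sigma,\tau)$ denotes a non-split extension $0\to\sigma\to E(\sigma,\tau)\to\tau\to0$ (which is unique up to isomorphism if it exists). A finite-dimensional representation $D_0$ of $\Gamma$ is a cyclic module on $(\sigma_1,\dots,\sigma_n)$, $n\ge1$, if $\sigma_1,\dots,\sigma_n$ are pairwise non-isomorphic generic weights, $D_0\cong\bigoplus_{i=1}^nE(\sigma_i,\sigma_{i-1}^{[s]})$ with non-split extensions as above, and $E(\sigma_i,\sigma_{i-1}^{[s]})^U\cong\chi(\sigma_i)\oplus\chi(\sigma_{i-1})^s$ as $B$-representations for all $i$, where $\sigma_0:=\sigma_n$. A finite-dimensional representation is multiplicity-free if its Jordan–Hölder factors are pairwise non-isomorphic. **Theorem.** $\Gamma$ admits a multiplicity-free cyclic module. Moreover, for $f>1$ such modules are given explicitly as follows. Let $\mu_0(x)=x-1$, $\mu_1(x)=p-2-x$ and $\mu_j(x)=p-1-x$ for $2\le j\le f-1$. For $i\ge0$ let $g^i\boldsymbol\mu$ be the $f$-tuple with $j$-th entry $\mu_{(i+j)\bmod f}$, let $\boldsymbol\mu^{(0)}=(x,\dots,x)$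 and $\boldsymbol\mu^{(i+1)}=g^{i}\boldsymbol\mu\circ\boldsymbol\mu^{(i)}$ (entrywise composition). For an $f$-tuple $\boldsymbol\lambda$ of polynomials let $e(\boldsymbol\lambda)(x_0,\dots,x_{f-1})=\frac12\bigl(\epsilon+\sum_{j=0}^{f-1}p^j(x_j-\lambda_j(x_j))\bigr)$, where $\epsilon=0$ if $\lambda_{f-1}(x)\in\{x,x-1\}$ and $\epsilon=p^f-1$ otherwise, and let $e_i(\mathbf r)=\sum_{a=0}^{i-1}e(g^a\boldsymbol\mu)(\boldsymbol\mu^{(a)}(\mathbf r))$. Let $l=f$ if $f$ is odd and $l=2f$ if $f$ is even. Then for all $\mathbf r$ with $1\le r_j\le p-3$ for all $j$ and all $m\in\mathbb Z$ there is a multiplicity-free cyclic module on $(\sigma_1,\dots,\sigma_l)$, where $\sigma_i=\boldsymbol\mu^{(i)}(\mathbf r)\otimes\det^{e_i(\mathbf r)+m}$, and its socle has length $l$. -/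

import Mathlib

open scoped MatrixGroups TensorProduct MonoidAlgebra DirectSum

noncomputable section

namespace CyclicModule

universe u v

/-! ### The subgroups `U ≤ B` of `Γ = GL₂(F)` and the characters of `B` -/

section Group

variable (F : Type u) [Field F]

/-- The subgroup `B` of upper triangular matrices. -/
def borel : Subgroup (GL (Fin 2) F) where
  carrier := {g | g.val 1 0 = 0}
  one_mem' := by simp
  mul_mem' := by
    intro a b ha hb
    simp only [Set.mem_ofPred_eq] at ha hb ⊢
    simp [Matrix.mul_apply, Fin.sum_univ_two, ha, hb]
  inv_mem' := by
    intro a ha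
    simp only [Set.mem_ofPred_eq] at ha ⊢
    simp [Matrix.inv_def, Matrix.adjugate_fin_two, ha]

/-- The subgroup `U` of upper triangular unipotent matrices, as a subgroup of `B`. -/
def unip : Subgroup (borel F) where
  carrier := {b | b.val.val 0 0 = 1 ∧ b.val.val 1 1 = 1}
  one_mem' := by simp
  mul_mem' := by
    rintro ⟨a, ha⟩ ⟨b, hb⟩ ⟨h1, h2⟩ ⟨h3, h4⟩
    change a.val 1 0 = 0 at ha
    change b.val 1 0 = 0 at hb
    simp only [Set.mem_ofPred_eq] at h1 h2 h3 h4 ⊢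
    simp [Matrix.mul_apply, Fin.sum_univ_two, ha, hb, h1, h2, h3, h4]
  inv_mem' := by
    rintro ⟨a, ha⟩ ⟨h1, h2⟩
    change a.val 1 0 = 0 at ha
    simp only [Set.mem_ofPred_eq] at h1 h2 ⊢
    simp [Matrix.inv_def, Matrix.adjugate_fin_two, Matrix.det_fin_two, ha, h1, h2]

variable {F}

lemma borel_mul_diag (a b : borel F) (i : Fin 2) :
    (a * b).val.val i i = a.val.val i i * b.val.val i i := by
  have ha : a.val.val 1 0 = 0 := a.2
  have hb : b.val.val 1 0 = 0 := b.2
  fin_cases i <;> simp [Matrix.mul_apply, Fin.sum_univ_two, ha, hb]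

lemma borel_one_diag (i : Fin 2) : (1 : borel F).val.val i i = 1 := by simp

instance : (unip F).Normal where
  conj_mem := by
    rintro n ⟨h1, h2⟩ g
    have key : ∀ i : Fin 2, n.val.val i i = 1 → (g * n * g⁻¹).val.val i i = 1 := by
      intro i hi
      rw [borel_mul_diag, borel_mul_diag, hi, mul_one, ← borel_mul_diag, mul_inv_cancel,
        borel_one_diag]
    exact ⟨key 0 h1, key 1 h2⟩

variable (F) in
/-- The homomorphism `B → B` sending `(a b; 0 d)` to `s (a 0; 0 d) s⁻¹ = (d 0; 0 a)`,
where `s = (0 1; 1 0)`. -/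
def borelSwap : borel F →* borel F where
  toFun b := ⟨Matrix.GeneralLinearGroup.mkOfDetNeZero !![b.val.val 1 1, 0; 0, b.val.val 0 0] (by
      have hb : b.val.val 1 0 = 0 := b.2
      have hd : b.val.val.det ≠ 0 := b.val.isUnit.map Matrix.detMonoidHom |>.ne_zero
      rw [Matrix.det_fin_two, hb] at hd
      rw [Matrix.det_fin_two_of]
      intro h
      apply hd
      linear_combination h), by
      change Matrix.of _ 1 0 = _
      simp⟩
  map_one' := by
    ext i j
    fin_cases i <;> fin_cases j <;> simp [Matrix.GeneralLinearGroup.mkOfDetNeZero]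
  map_mul' a b := by
    have h0 := borel_mul_diag a b 0
    have h1 := borel_mul_diag a b 1
    ext i j
    fin_cases i <;> fin_cases j <;>
      simp_all [Matrix.GeneralLinearGroup.mkOfDetNeZero, Matrix.mul_apply, Fin.sum_univ_two]

/-- The character `χˢ` of `B`: the inflation to `B` of `t ↦ χ (s t s⁻¹)` on the diagonal torus. -/
def conjChar {k : Type v} [Field k] (χ : borel F →* kˣ) : borel F →* kˣ := χ.comp (borelSwap F)

end Group

/-! ### General representation theory -/

section Rep

variable {G : Type u} [Group G] {k : Type v} [Field k]

/-- The twist of a representation by a character. -/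
def twist {V : Type*} [AddCommMonoid V] [Module k V] (ρ : Representation k G V) (χ : G →* kˣ) :
    Representation k G V where
  toFun g := ((χ g : kˣ) : k) • ρ g
  map_one' := by simp
  map_mul' g h := by
    ext v
    simp only [map_mul, Units.val_mul, LinearMap.smul_apply, Module.End.mul_apply, map_smul,
      mul_smul]
    exact smul_comm _ _ _

/-- The one-dimensional representation on `k` given by a character. -/
def charRep (χ : G →* kˣ) : Representation k G k := twist (Representation.trivial k G k) χ

/-- `E` is a non-split extension `0 → σ → E → τ → 0`. -/
def IsNonsplitExtension (σ E τ : Rep.{v} k G) : Prop :=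
  ∃ (i : σ.ρ.IntertwiningMap E.ρ) (q : E.ρ.IntertwiningMap τ.ρ),
    Function.Injective i ∧ Function.Surjective q ∧ Function.Exact i q ∧
      ¬ ∃ s : τ.ρ.IntertwiningMap E.ρ, ∀ x, q (s x) = x

/-- A representation is multiplicity-free if it has a composition series whose factors are pairwise
non-isomorphic (by the Jordan–Hölder theorem, every composition series then has this property). -/
def IsMultiplicityFree (D : Rep.{v} k G) : Prop :=
  ∃ s : CompositionSeries (Submodule k[G] D.ρ.asModule), s.head = ⊥ ∧ s.last = ⊤ ∧
    ∀ i j : Fin s.length,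
      Nonempty ((s i.succ ⧸ (s i.castSucc).comap (s i.succ).subtype) ≃ₗ[k[G]]
        (s j.succ ⧸ (s j.castSucc).comap (s j.succ).subtype)) → i = j

/-- The socle of a module: the sum of its simple submodules. -/
def socle (R M : Type*) [Ring R] [AddCommGroup M] [Module R M] : Submodule R M :=
  sSup {N | IsSimpleModule R N}

/-- The length of the socle of a representation. -/
def socleLength (D : Rep.{v} k G) : ℕ∞ := Module.length k[G] (socle k[G] D.ρ.asModule)

end Rep

/-! ### Weights of `Γ = GL₂(F)` -/

section Weights

variable (k : Type v) [Field k]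

/-- The algebra endomorphism of `k[X₀, X₁] = Sym (k²)` induced by the standard action of a matrix
on `k²`, where `X₀, X₁` is the standard basis of `k²`. -/
def symAlg (g : Matrix (Fin 2) (Fin 2) k) :
    MvPolynomial (Fin 2) k →ₐ[k] MvPolynomial (Fin 2) k :=
  MvPolynomial.aeval fun j => ∑ i, MvPolynomial.C (g i j) * MvPolynomial.X i

lemma symAlg_one : symAlg k 1 = AlgHom.id k _ := by
  apply MvPolynomial.algHom_ext
  intro i
  fin_cases i <;> simp [symAlg, Fin.sum_univ_two]

lemma symAlg_mul (g h : Matrix (Fin 2) (Fin 2) k) :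
    symAlg k (g * h) = (symAlg k g).comp (symAlg k h) := by
  apply MvPolynomial.algHom_ext
  intro i
  simp [symAlg, Fin.sum_univ_two, Matrix.mul_apply, MvPolynomial.algHom_C]
  ring

lemma symAlg_mem (g : Matrix (Fin 2) (Fin 2) k) (n : ℕ) (P : MvPolynomial (Fin 2) k)
    (hP : P ∈ MvPolynomial.homogeneousSubmodule (Fin 2) k n) :
    symAlg k g P ∈ MvPolynomial.homogeneousSubmodule (Fin 2) k n := by
  rw [MvPolynomial.mem_homogeneousSubmodule] at hP ⊢
  have := hP.aeval (fun j => ∑ i, MvPolynomial.C (g i j) * MvPolynomial.X i) (n := 1) (by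
    intro j
    apply MvPolynomial.IsHomogeneous.sum
    intro i _
    simpa using (MvPolynomial.isHomogeneous_C (Fin 2) (g i j)).mul
      (MvPolynomial.isHomogeneous_X k i))
  rw [one_mul] at this
  exact this

/-- The representation `Symⁿ k²` of `GL₂(k)`, on homogeneous polynomials of degree `n`. -/
def symPow (n : ℕ) :
    Representation k (GL (Fin 2) k) (MvPolynomial.homogeneousSubmodule (Fin 2) k n) where
  toFun g := (symAlg k g.val).toLinearMap.restrict fun P hP => symAlg_mem k g.val n P hP
  map_one' := by
    ext P
    simp [symAlg_one]
  map_mul' g h := by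
    refine LinearMap.ext fun P => Subtype.ext ?_
    change symAlg k (g * h).val P.1 = symAlg k g.val (symAlg k h.val P.1)
    rw [Units.val_mul, symAlg_mul]
    rfl

variable (p : ℕ) [Fact p.Prime] {f : ℕ} (F : Type u) [Field F] [CharP F p] [Algebra F k]

/-- The automorphism `Φʲ` of `Γ = GL₂(F)`, followed by the embedding of `Γ` in `GL₂(k)`. -/
def frobEmb (j : ℕ) : GL (Fin 2) F →* GL (Fin 2) k :=
  Matrix.GeneralLinearGroup.map ((algebraMap F k).comp (iterateFrobenius F p j))

/-- The character `det : Γ → kˣ`. -/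
def detChar : GL (Fin 2) F →* kˣ :=
  (Units.map (algebraMap F k).toMonoidHom).comp Matrix.GeneralLinearGroup.det

/-- The representation `⨂_{j < f} Sym^{r_j} k² ∘ Φʲ` of `Γ`. -/
def symTensor (r : Fin f → ℕ) : Representation k (GL (Fin 2) F)
    (⨂[k] j, MvPolynomial.homogeneousSubmodule (Fin 2) k (r j)) where
  toFun g := PiTensorProduct.map fun j => symPow k (r j) (frobEmb k p F j g)
  map_one' := by
    simp only [map_one]
    exact PiTensorProduct.map_one
  map_mul' g h := by
    simp only [map_mul]
    exact PiTensorProduct.map_mul _ _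

/-- The representation `𝐫 ⊗ detᵐ = (⨂_{j < f} Sym^{r_j} k² ∘ Φʲ) ⊗ detᵐ` of `Γ`. -/
def weight (r : Fin f → ℕ) (m : ℤ) : Rep.{v} k (GL (Fin 2) F) :=
  Rep.of (X := ⨂[k] j, MvPolynomial.homogeneousSubmodule (Fin 2) k (r j))
    (twist (symTensor k p F r) (detChar k F ^ m))

variable {k F}

/-- A generic weight: an irreducible representation of `Γ` that is not isomorphic to
`(0, …, 0) ⊗ detᵐ` or `(p - 1, …, p - 1) ⊗ detᵐ` for any `m`. -/
def IsGenericWeight (f : ℕ) (σ : Rep.{v} k (GL (Fin 2) F)) : Prop :=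
  σ.ρ.IsIrreducible ∧
    ∀ m : ℤ, IsEmpty (σ.ρ.Equiv (weight k p F (fun _ : Fin f => 0) m).ρ) ∧
      IsEmpty (σ.ρ.Equiv (weight k p F (fun _ : Fin f => p - 1) m).ρ)

/-- The representation of `B` on the space of `U`-invariants of a representation of `Γ`. -/
def unipInvariants (σ : Rep.{v} k (GL (Fin 2) F)) :
    Representation k (borel F)
      (Representation.invariants ((σ.ρ.comp (borel F).subtype).comp (unip F).subtype)) :=
  Representation.toInvariants (σ.ρ.comp (borel F).subtype) (unip F)

/-- `χ = χ(σ)`: the `U`-invariants of `σ` are one-dimensional and `B` acts on them by `χ`. -/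
def HasChar (σ : Rep.{v} k (GL (Fin 2) F)) (χ : borel F →* kˣ) : Prop :=
  Nonempty ((unipInvariants σ).Equiv (charRep χ))

/-- `D` is a cyclic module for the cyclically ordered weights `σ`: the `σ i` are distinct generic
weights, and `D` is the direct sum of non-split extensions `E i = E(σ i, σ (i - 1)^[s])` such that
`(E i)ᵁ = χ(σ i) ⊕ χ(σ (i - 1))ˢ` as representations of `B`. Here `τ i` is `(σ i)^[s]`, the generic
weight with character `χ(σ i)ˢ`, and `i - 1` is taken modulo `n`,
as `(finRotate n).symm i`. -/
def IsCyclicModuleOn (f : ℕ) {n : ℕ} (σ : Fin n → Rep.{v} k (GL (Fin 2) F))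
    (D : Rep.{v} k (GL (Fin 2) F)) : Prop :=
  FiniteDimensional k D ∧
  (∀ i, IsGenericWeight p f (σ i)) ∧
  (∀ i j, Nonempty ((σ i).ρ.Equiv (σ j).ρ) → i = j) ∧
  ∃ (χ : Fin n → borel F →* kˣ) (τ E : Fin n → Rep.{v} k (GL (Fin 2) F)),
    (∀ i, HasChar (σ i) (χ i)) ∧
    (∀ i, IsGenericWeight p f (τ i) ∧ HasChar (τ i) (conjChar (χ i))) ∧
    (∀ i, IsNonsplitExtension (σ i) (E i) (τ ((finRotate n).symm i))) ∧
    (∀ i, Nonempty ((unipInvariants (E i)).Equiv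
      ((charRep (χ i)).prod (charRep (conjChar (χ ((finRotate n).symm i))))))) ∧
    Nonempty (D.ρ.Equiv (Representation.directSum fun i => (E i).ρ))

/-- `D` is a cyclic module of `Γ`. -/
def IsCyclicModule (f : ℕ) (D : Rep.{v} k (GL (Fin 2) F)) : Prop :=
  ∃ (n : ℕ) (σ : Fin n → Rep.{v} k (GL (Fin 2) F)), n ≠ 0 ∧ IsCyclicModuleOn p f σ D

end Weights

/-! ### The explicit cycle of weights -/

section Cycle

variable (p f : ℕ)

/-- The polynomials `μ₀ = x - 1`, `μ₁ = p - 2 - x` and `μ_j = p - 1 - x` for `2 ≤ j`. -/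
def mu : ℕ → ℤ → ℤ
  | 0, x => x - 1
  | 1, x => p - 2 - x
  | _ + 2, x => p - 1 - x

/-- The `f`-tuple `gⁱ μ`, where `(g λ)_j = λ_{j+1}` with indices modulo `f`. -/
def muShift (i : ℕ) (j : Fin f) : ℤ → ℤ := mu p ((i + j) % f)

/-- The `f`-tuple `μ⁽ᵏ⁾ = gᵏ⁻¹μ ∘ ⋯ ∘ gμ ∘ μ`. -/
def muIter : ℕ → Fin f → ℤ → ℤ
  | 0, _, x => x
  | i + 1, j, x => muShift p f i j (muIter i j x)

open Classical in
/-- The value `e(λ)(x₀, …, x_{f-1})`; for `λ = gⁱ μ`, `f ≥ 2` and `p` odd the number that is halved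
is always even. -/
def expo (lam : Fin f → ℤ → ℤ) (x : Fin f → ℤ) : ℤ :=
  ((if ∀ j : Fin f, j.val + 1 = f → (lam j = fun y => y) ∨ (lam j = fun y => y - 1)
      then 0 else (p : ℤ) ^ f - 1)
    + ∑ j : Fin f, (p : ℤ) ^ j.val * (x j - lam j (x j))) / 2

/-- The integer `e_k(𝐫) = ∑_{i < k} e(gⁱ μ)(μ⁽ⁱ⁾(𝐫))`. -/
def expoSum (i : ℕ) (r : Fin f → ℤ) : ℤ :=
  ∑ a ∈ Finset.range i, expo p f (muShift p f a) fun j => muIter p f a j (r j)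

/-- The length `l` of the cycle: `f` if `f` is odd and `2f` if `f` is even. -/
def cycleLength : ℕ := if Odd f then f else 2 * f

variable [Fact p.Prime] (k : Type v) [Field k] (F : Type u) [Field F] [CharP F p] [Algebra F k]

/-- The weight `σ_i = μ⁽ⁱ⁾(𝐫) ⊗ det^{e_i(𝐫) + m}`. (All the entries of `μ⁽ⁱ⁾(𝐫)` are
nonnegative when `1 ≤ r_j ≤ p - 3` and `i ≤ l`.) -/
def cycleWeight (r : Fin f → ℕ) (m : ℤ) (i : ℕ) : Rep.{v} k (GL (Fin 2) F) :=
  weight k p F (fun j => (muIter p f i j (r j)).toNat) (expoSum p f i (fun j => r j) + m)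

end Cycle

end CyclicModule

end

/-! The extensions are realised as duals of spaces of functions on `F²`. Put `q = p^f`. For a tuple
`d`, let `evalSub d` be the space of functions spanned by the monomials with exponents `val A`, `val
B` (base `p` values of digit tuples) where `A + B = d`; it is the image of `⨂ Sym^{d_j} ∘ Φʲ`. As
`t^q = t` on `F`, the digits are cyclic: `p` units at position `j₀` give the same function as one
unit at the next position `j₁`. Hence if `y` has a unit to spare at `j₁` and `dh = y - e_{j₁} + p
e_{j₀}`, then `evalSub y` lies in `evalSub dh`. The quotient has as basis the monomials in which
both digits at `j₀` stay below `p`; these form a box `lo ≤ A ≤ hi`, and the quotient is irreducible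
with torus exponents `(val hi, val lo)` (`isHW_evalQuot`).

In the dual, evaluation at `(0,1)` is fixed by `U`, is a torus eigenvector, and generates, because
`GL₂(F)` is transitive on non-zero row vectors and the functions vanish at `0`. An extension of two
irreducibles with distinct highest weights that is generated by such a vector is non-split, and its
`U`-invariants are the sum of the two characters (`extension_of_generator`, `exists_extension`).
With `y = p - 1 - x`, so that the quotient weight is `(x ⊗ det^m)^[s]`, the socle weight has digits
`x - 1` at `j₀`, `p - 2 - x` at `j₁` and `p - 1 - x` elsewhere: this is one application of a shift
of `μ`.

Weights are identified without a classification of irreducibles. By the Bruhat decomposition, the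
matrix coefficient of a highest weight vector against a `U`-invariant functional is determined up to
a scalar by the torus character, so the character determines the representation
(`IsHW.nonempty_equiv`). Irreducibility is checked on monomial bases by extracting coefficients of
polynomials of degree less than `q` (`isHW_of_box`).

The rest is combinatorics. Raising an entry by one just before `μ₁` is applied turns every step into
the identity or the reflection `x ↦ p - 1 - x` (`muLift_succ`). In `f` steps each entry is reflected
`f - 1` times, so the tuple returns after `f` steps for odd `f` and after `2f` for even `f`; the
exponents of `det` telescope and return modulo `q - 1`. As `p` is odd, reflections preserve parity,
so the parities of the entries reveal the step modulo `f`. The only remaining possible coincidences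
are between steps `f` apart with `f` even, where `det` separates the `σ`'s, and between some `σ` and
some `σ^[s]`, excluded by the exponent of `det` or by the entries. For `f = 1` a cycle of length one
on `Sym¹` suffices. -/

noncomputable section

namespace CyclicModule

universe u v

/-! ### The Bruhat decomposition and the characters of the torus -/

section Bruhat

variable {F : Type u} [Field F]

/-- The unipotent matrix `(1 t; 0 1)`. -/
def upperUnip (t : F) : GL (Fin 2) F :=
  Matrix.GeneralLinearGroup.mkOfDetNeZero !![1, t; 0, 1] (by simp)

/-- The Weyl element `(0 1; 1 0)`. -/
def weyl : GL (Fin 2) F :=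
  Matrix.GeneralLinearGroup.mkOfDetNeZero !![0, 1; 1, 0] (by simp)

/-- The diagonal matrix `(a 0; 0 d)`. -/
def diag (a d : Fˣ) : GL (Fin 2) F :=
  Matrix.GeneralLinearGroup.mkOfDetNeZero !![(a : F), 0; 0, d] (by simp)

@[simp] lemma upperUnip_val (t : F) : (upperUnip t).val = !![1, t; 0, 1] := rfl
@[simp] lemma weyl_val : (weyl : GL (Fin 2) F).val = !![0, 1; 1, 0] := rfl
@[simp] lemma diag_val (a d : Fˣ) : (diag a d).val = !![(a : F), 0; 0, d] := rfl

lemma weyl_mul_weyl : (weyl : GL (Fin 2) F) * weyl = 1 := by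
  apply Units.ext
  ext i j
  fin_cases i <;> fin_cases j <;> simp [Matrix.mul_apply, Fin.sum_univ_two]

lemma diag_mul_weyl (a d : Fˣ) : diag a d * weyl = weyl * diag d a := by
  apply Units.ext
  ext i j
  fin_cases i <;> fin_cases j <;> simp [Matrix.mul_apply, Fin.sum_univ_two]

lemma diag_mul_diag (a d a' d' : Fˣ) : diag a d * diag a' d' = diag (a * a') (d * d') := by
  apply Units.ext
  ext i j
  fin_cases i <;> fin_cases j <;> simp [Matrix.mul_apply, Fin.sum_univ_two]

lemma diag_one : diag (1 : Fˣ) 1 = 1 := by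
  apply Units.ext
  ext i j
  fin_cases i <;> fin_cases j <;> simp

lemma diag_inv (a d : Fˣ) : (diag a d)⁻¹ = diag a⁻¹ d⁻¹ := by
  rw [inv_eq_iff_mul_eq_one, diag_mul_diag, mul_inv_cancel, mul_inv_cancel, diag_one]

lemma upperUnip_zero : upperUnip (0 : F) = 1 := by
  apply Units.ext
  ext i j
  fin_cases i <;> fin_cases j <;> simp

lemma upperUnip_mul (s t : F) : upperUnip s * upperUnip t = upperUnip (s + t) := by
  apply Units.ext
  ext i j
  fin_cases i <;> fin_cases j <;> simp [Matrix.mul_apply, Fin.sum_univ_two, add_comm]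

lemma upperUnip_inv (t : F) : (upperUnip t)⁻¹ = upperUnip (-t) := by
  rw [inv_eq_iff_mul_eq_one, upperUnip_mul, add_neg_cancel, upperUnip_zero]

lemma upperUnip_mul_diag (t : F) (a d : Fˣ) :
    upperUnip t * diag a d = diag a d * upperUnip ((a⁻¹ : Fˣ) * t * d) := by
  apply Units.ext
  ext i j
  fin_cases i <;> fin_cases j <;> simp [Matrix.mul_apply, Fin.sum_univ_two, mul_assoc]

lemma exists_borel_eq (g : GL (Fin 2) F) (hg : g.val 1 0 = 0) :
    ∃ (a d : Fˣ) (t : F), g = diag a d * upperUnip t ∧ g.val 0 0 = a ∧ g.val 1 1 = d := by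
  have hd : g.val.det ≠ 0 := (g.isUnit.map Matrix.detMonoidHom).ne_zero
  rw [Matrix.det_fin_two, hg, mul_zero, sub_zero] at hd
  refine ⟨Units.mk0 _ (left_ne_zero_of_mul hd), Units.mk0 _ (right_ne_zero_of_mul hd),
    (g.val 0 0)⁻¹ * g.val 0 1, ?_, rfl, rfl⟩
  have h0 := left_ne_zero_of_mul hd
  apply Units.ext
  ext i j
  fin_cases i <;> fin_cases j <;> simp [Matrix.mul_apply, Fin.sum_univ_two, hg, h0]

lemma bruhat (g : GL (Fin 2) F) :
    (∃ (a d : Fˣ) (t : F), g = diag a d * upperUnip t) ∨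
      ∃ (s : F) (a d : Fˣ) (t : F), g = upperUnip s * (weyl * (diag a d * upperUnip t)) := by
  by_cases hg : g.val 1 0 = 0
  · obtain ⟨a, d, t, h, -⟩ := exists_borel_eq g hg
    exact Or.inl ⟨a, d, t, h⟩
  · right
    -- This `s` clears the upper left entry of `g`; the Weyl element then moves the zero to the
    -- lower left.
    set s := g.val 0 0 / g.val 1 0 with hs
    obtain ⟨a, d, t, h, -⟩ := exists_borel_eq (weyl * (upperUnip (-s) * g)) (by
      change ((!![0, 1; 1, 0] : Matrix (Fin 2) (Fin 2) F) * (!![1, -s; 0, 1] * g.val)) 1 0 = 0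
      simp only [Matrix.mul_apply, Fin.sum_univ_two, Matrix.of_apply, Matrix.cons_val',
        Matrix.cons_val_zero,
        Matrix.cons_val_one, Matrix.cons_val_fin_one, hs]
      field_simp
      ring)
    refine ⟨s, a, d, t, ?_⟩
    rw [← h, ← mul_assoc weyl, weyl_mul_weyl, one_mul, ← mul_assoc, upperUnip_mul, add_neg_cancel,
      upperUnip_zero, one_mul]

variable (k : Type v) [Field k] [Algebra F k]

/-- The character `(a b; 0 d) ↦ aᵐ dⁿ` of `B`. -/
def torusChar (m n : ℤ) : borel F →* kˣ where
  toFun b := by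
    have hd : b.val.val 0 0 * b.val.val 1 1 ≠ 0 := by
      have hb : b.val.val 1 0 = 0 := b.2
      have hd : b.val.val.det ≠ 0 := (b.val.isUnit.map Matrix.detMonoidHom).ne_zero
      rwa [Matrix.det_fin_two, hb, mul_zero, sub_zero] at hd
    exact Units.map (algebraMap F k).toMonoidHom (Units.mk0 _ (left_ne_zero_of_mul hd)) ^ m *
      Units.map (algebraMap F k).toMonoidHom (Units.mk0 _ (right_ne_zero_of_mul hd)) ^ n
  map_one' := by
    ext
    simp
  map_mul' b c := by
    ext
    have h0 := borel_mul_diag b c 0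
    have h1 := borel_mul_diag b c 1
    simp only [Units.val_mul, Units.val_zpow_eq_zpow_val, Units.coe_map, Units.val_mk0, h0, h1]
    simp [mul_zpow]
    ring

variable {k}

lemma torusChar_apply (m n : ℤ) (b : borel F) : ((torusChar k m n b : kˣ) : k) =
    algebraMap F k (b.val.val 0 0) ^ m * algebraMap F k (b.val.val 1 1) ^ n := by
  simp [torusChar]

lemma conjChar_torusChar (m n : ℤ) :
    conjChar (torusChar (F := F) k m n) = torusChar k n m := by
  ext b
  simp only [conjChar, MonoidHom.comp_apply, torusChar_apply]
  simp [borelSwap, Matrix.GeneralLinearGroup.mkOfDetNeZero, mul_comm]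

end Bruhat

/-! ### Irreducible representations with a highest weight -/

section Orbit

variable {k : Type v} [Field k] {G : Type*} [Group G] {V W : Type*} [AddCommGroup V] [Module k V]
  [AddCommGroup W] [Module k W]

lemma equiv_apply_rho {ρ : Representation k G V} {σ : Representation k G W} (e : ρ.Equiv σ) (g : G)
    (x : V) : e (ρ g x) = σ g (e x) :=
  e.toIntertwiningMap.isIntertwining _ _ g x

lemma twist_apply (ρ : Representation k G V) (χ : G →* kˣ) (g : G) (x : V) :
    twist ρ χ g x = ((χ g : kˣ) : k) • ρ g x := rfl

lemma exists_span_orbit (ρ : Representation k G V)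
    (irr : ∀ N : Submodule k V, (∀ g, ∀ x ∈ N, ρ g x ∈ N) → N = ⊥ ∨ N = ⊤) {v : V} (hv : v ≠ 0) :
    Submodule.span k (Set.range fun g => ρ g v) = ⊤ := by
  refine (irr _ ?_).resolve_left ?_
  · intro g x hx
    induction hx using Submodule.span_induction with
    | mem x hx =>
      obtain ⟨h, rfl⟩ := hx
      refine Submodule.subset_span ⟨g * h, ?_⟩
      simp
    | zero => simp
    | add x y _ _ hx hy => rw [map_add]; exact add_mem hx hy
    | smul c x _ hx => rw [map_smul]; exact Submodule.smul_mem _ _ hx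
  · intro h
    apply hv
    have : v ∈ Submodule.span k (Set.range fun g => ρ g v) :=
      Submodule.subset_span ⟨1, by simp⟩
    rwa [h, Submodule.mem_bot] at this

end Orbit

section HighestWeight

variable {F : Type u} [Field F] {k : Type v} [Field k] [Algebra F k]
variable {V W : Type*} [AddCommGroup V] [Module k V] [AddCommGroup W] [Module k W]

/-- The representation `ρ` is irreducible, its `U`-invariants form a line on which the torus acts by
`aᵐ dⁿ`, its `U`-invariant functionals form a line, and the latter vanish on the former. -/
structure IsHW (ρ : Representation k (GL (Fin 2) F) V) (m n : ℤ) : Prop where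
  irr : ∀ N : Submodule k V, (∀ g, ∀ x ∈ N, ρ g x ∈ N) → N = ⊥ ∨ N = ⊤
  vec : ∃ v : V, v ≠ 0 ∧ (∀ t, ρ (upperUnip t) v = v) ∧
    (∀ a d : Fˣ, ρ (diag a d) v = (algebraMap F k a ^ m * algebraMap F k d ^ n) • v) ∧
    ∀ x, (∀ t, ρ (upperUnip t) x = x) → ∃ c : k, x = c • v
  cov : ∃ l : Module.Dual k V, l ≠ 0 ∧ (∀ t x, l (ρ (upperUnip t) x) = l x) ∧
    (∀ x, (∀ t, ρ (upperUnip t) x = x) → l x = 0) ∧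
    ∀ l' : Module.Dual k V, (∀ t x, l' (ρ (upperUnip t) x) = l' x) → ∃ c : k, l' = c • l

/-- By the Bruhat decomposition, the values of `l` on the orbit of `v` are multiples of `l v = 0` or
of `l (ρ weyl v)`, and the orbit spans. -/
lemma functional_weyl_ne_zero {ρ : Representation k (GL (Fin 2) F) V} {m n : ℤ}
    (irr : ∀ N : Submodule k V, (∀ g, ∀ x ∈ N, ρ g x ∈ N) → N = ⊥ ∨ N = ⊤)
    {v : V} (hv : v ≠ 0) (hvu : ∀ t, ρ (upperUnip t) v = v)
    (hvt : ∀ a d : Fˣ, ρ (diag a d) v = (algebraMap F k a ^ m * algebraMap F k d ^ n) • v)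
    {l : Module.Dual k V} (hl : l ≠ 0) (hlu : ∀ t x, l (ρ (upperUnip t) x) = l x)
    (hlv : l v = 0) : l (ρ weyl v) ≠ 0 := by
  intro h
  apply hl
  apply LinearMap.ext_on_range (exists_span_orbit ρ irr hv)
  intro g
  rcases bruhat g with ⟨a, d, t, rfl⟩ | ⟨s, a, d, t, rfl⟩
  · simp [hvu, hvt, hlv]
  · simp [hvu, hvt, hlu, h]

/-- Two representations with a highest weight are isomorphic if they have the same weight. -/
lemma IsHW.nonempty_equiv {ρ : Representation k (GL (Fin 2) F) V}
    {σ : Representation k (GL (Fin 2) F) W} {m n : ℤ} (h : IsHW ρ m n) (h' : IsHW σ m n) :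
    Nonempty (ρ.Equiv σ) := by
  obtain ⟨v, hv, hvu, hvt, -⟩ := h.vec
  obtain ⟨v', hv', hvu', hvt', -⟩ := h'.vec
  obtain ⟨l, hl, hlu, hl0, -⟩ := h.cov
  obtain ⟨l', hl', hlu', hl0', -⟩ := h'.cov
  have hw := functional_weyl_ne_zero h.irr hv hvu hvt hl hlu (hl0 v hvu)
  have hw' := functional_weyl_ne_zero h'.irr hv' hvu' hvt' hl' hlu' (hl0' v' hvu')
  -- Both representations are cyclic quotients of the group ring via `v` and `v'`; it suffices to
  -- show that the two kernels agree.
  let A : k[GL (Fin 2) F] →ₗ[k] V := (LinearMap.applyₗ v).comp ρ.asAlgebraHom.toLinearMap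
  let A' : k[GL (Fin 2) F] →ₗ[k] W := (LinearMap.applyₗ v').comp σ.asAlgebraHom.toLinearMap
  have hAs : ∀ g, A (MonoidAlgebra.single g 1) = ρ g v := fun g => by simp [A]
  have hAs' : ∀ g, A' (MonoidAlgebra.single g 1) = σ g v' := fun g => by simp [A']
  have hAg : ∀ g a, A (MonoidAlgebra.single g 1 * a) = ρ g (A a) := fun g a => by simp [A]
  have hAg' : ∀ g a, A' (MonoidAlgebra.single g 1 * a) = σ g (A' a) := fun g a => by simp [A']
  have surj : Function.Surjective A := by
    rw [← LinearMap.range_eq_top, eq_top_iff, ← exists_span_orbit ρ h.irr hv, Submodule.span_le]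
    rintro _ ⟨g, rfl⟩
    exact ⟨_, hAs g⟩
  have surj' : Function.Surjective A' := by
    rw [← LinearMap.range_eq_top, eq_top_iff, ← exists_span_orbit σ h'.irr hv', Submodule.span_le]
    rintro _ ⟨g, rfl⟩
    exact ⟨_, hAs' g⟩
  -- The two matrix coefficients are proportional: both vanish on `B`, and on the big cell both are
  -- given by the same torus character.
  have key : l' (σ weyl v') • l.comp A = l (ρ weyl v) • l'.comp A' := by
    apply MonoidAlgebra.lhom_ext'
    intro g
    ext
    simp only [LinearMap.coe_comp, Function.comp_apply, LinearMap.smul_apply,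
      MonoidAlgebra.lsingle_apply, hAs, hAs']
    rcases bruhat g with ⟨a, d, t, rfl⟩ | ⟨s, a, d, t, rfl⟩
    · simp [hvu, hvt, hl0 v hvu, hvu', hvt', hl0' v' hvu']
    · simp [hvu, hvt, hlu, hvu', hvt', hlu']
      ring
  -- The translates of `l` separate points, so the kernel of `A` can be read off from the matrix
  -- coefficient.
  have cogen : ∀ x : V, (∀ g, l (ρ g x) = 0) → x = 0 := by
    intro x hx
    by_contra hx0
    exact hl (LinearMap.ext_on_range (exists_span_orbit ρ h.irr hx0) (by simpa using hx))
  have cogen' : ∀ x : W, (∀ g, l' (σ g x) = 0) → x = 0 := by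
    intro x hx
    by_contra hx0
    exact hl' (LinearMap.ext_on_range (exists_span_orbit σ h'.irr hx0) (by simpa using hx))
  have key2 : ∀ a g, l' (σ weyl v') * l (ρ g (A a)) = l (ρ weyl v) * l' (σ g (A' a)) := by
    intro a g
    have := LinearMap.congr_fun key (MonoidAlgebra.single g 1 * a)
    simpa [hAg, hAg'] using this
  have hker : LinearMap.ker A = LinearMap.ker A' := by
    ext a
    rw [LinearMap.mem_ker, LinearMap.mem_ker]
    constructor
    · intro ha
      refine cogen' _ fun g => ?_
      have := key2 a g
      rw [ha, map_zero, map_zero, mul_zero] at this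
      exact (mul_eq_zero.mp this.symm).resolve_left hw
    · intro ha
      refine cogen _ fun g => ?_
      have := key2 a g
      rw [ha, map_zero, map_zero, mul_zero] at this
      exact (mul_eq_zero.mp this).resolve_left hw'
  let e : V ≃ₗ[k] W := (A.quotKerEquivOfSurjective surj).symm.trans
    ((Submodule.quotEquivOfEq _ _ hker).trans (A'.quotKerEquivOfSurjective surj'))
  have he : ∀ a, e (A a) = A' a := by
    intro a
    have : (A.quotKerEquivOfSurjective surj).symm (A a) = Submodule.Quotient.mk a := by
      rw [LinearEquiv.symm_apply_eq]
      rfl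
    simp only [e, LinearEquiv.trans_apply, this]
    rfl
  refine ⟨Representation.Equiv.mk e fun g => ?_⟩
  ext x
  obtain ⟨a, rfl⟩ := surj x
  simp only [LinearMap.coe_comp, LinearEquiv.coe_coe, Function.comp_apply]
  rw [he, ← hAg, ← hAg', he]

lemma IsHW.isIrreducible {ρ : Representation k (GL (Fin 2) F) V} {m n : ℤ} (h : IsHW ρ m n) :
    ρ.IsIrreducible where
  exists_pair_ne := by
    obtain ⟨v, hv, -⟩ := h.vec
    refine ⟨⊥, ⊤, fun hbt => hv ?_⟩
    have : v ∈ (⊤ : Subrepresentation ρ) := Submodule.mem_top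
    rw [← hbt] at this
    exact this
  eq_bot_or_eq_top N := by
    rcases h.irr N.toSubmodule (fun g x hx => N.apply_mem_toSubmodule g hx) with h | h
    · exact Or.inl (Subrepresentation.toSubmodule_injective h)
    · exact Or.inr (Subrepresentation.toSubmodule_injective h)

lemma IsHW.twist_det {ρ : Representation k (GL (Fin 2) F) V} {m n : ℤ} (h : IsHW ρ m n) (M : ℤ) :
    IsHW (twist ρ (detChar k F ^ M)) (m + M) (n + M) := by
  have hu : ∀ t x, twist ρ (detChar k F ^ M) (upperUnip t) x = ρ (upperUnip t) x := by
    intro t x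
    have : (detChar k F) (upperUnip t) = 1 := by
      ext
      simp [detChar, Matrix.det_fin_two]
    simp [twist, this]
  have hd : ∀ a d x, twist ρ (detChar k F ^ M) (diag a d) x =
      (algebraMap F k a ^ M * algebraMap F k d ^ M) • ρ (diag a d) x := by
    intro a d x
    have : ((detChar k F (diag a d) : kˣ) : k) = algebraMap F k a * algebraMap F k d := by
      simp [detChar, Matrix.det_fin_two]
    simp [twist, this, mul_zpow]
  refine ⟨fun N hN => h.irr N fun g x hx => ?_, ?_, ?_⟩
  · have := N.smul_mem (((detChar k F ^ M) g)⁻¹ : kˣ) (hN g x hx)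
    rwa [twist_apply, smul_smul, Units.inv_mul, one_smul] at this
  · simp only [hu, hd]
    obtain ⟨v, hv, hvu, hvt, huniq⟩ := h.vec
    refine ⟨v, hv, hvu, fun a d => ?_, huniq⟩
    rw [hvt, smul_smul, zpow_add₀, zpow_add₀]
    · congr 1
      ring
    · simp
    · simp
  · simp only [hu]
    exact h.cov

/-- The dual of a representation with a highest weight. -/
lemma IsHW.dual [FiniteDimensional k V] {ρ : Representation k (GL (Fin 2) F) V} {m n : ℤ}
    (h : IsHW ρ m n) : IsHW ρ.dual (-n) (-m) := by
  have hdual : ∀ g (l : Module.Dual k V) x, ρ.dual g l x = l (ρ g⁻¹ x) := fun g l x => rfl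
  obtain ⟨v, hv, hvu, hvt, hvuniq⟩ := h.vec
  obtain ⟨l, hl, hlu, hl0, hluniq⟩ := h.cov
  have hw := functional_weyl_ne_zero h.irr hv hvu hvt hl hlu (hl0 v hvu)
  have hinv : ∀ l' : Module.Dual k V, (∀ t, ρ.dual (upperUnip t) l' = l') →
      ∀ t x, l' (ρ (upperUnip t) x) = l' x := by
    intro l' hl' t x
    have := LinearMap.congr_fun (hl' (-t)) x
    rwa [hdual, upperUnip_inv, neg_neg] at this
  -- Duality exchanges the roles: `l` becomes the highest weight vector, evaluation at `v` the
  -- invariant functional.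
  refine ⟨fun N hN => ?_, ⟨l, hl, fun t => ?_, fun a d => ?_, fun l' hl' => ?_⟩,
    ⟨Module.Dual.eval k V v, ?_, fun t l' => ?_, fun l' hl' => ?_, fun L hL => ?_⟩⟩
  · have hco : ∀ g, ∀ x ∈ N.dualCoannihilator, ρ g x ∈ N.dualCoannihilator := by
      intro g x hx
      rw [Submodule.mem_dualCoannihilator] at hx ⊢
      intro φ hφ
      have := hx _ (hN g⁻¹ φ hφ)
      rwa [hdual, inv_inv] at this
    rcases h.irr _ hco with h1 | h1
    · right
      rw [← Subspace.dualCoannihilator_dualAnnihilator_eq (W := N), h1,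
        Submodule.dualAnnihilator_bot]
    · left
      rw [← Subspace.dualCoannihilator_dualAnnihilator_eq (W := N), h1,
        Submodule.dualAnnihilator_top]
  · ext x
    rw [hdual, upperUnip_inv, hlu]
  -- The torus normalises `U`, so it acts on the line of `l`; its scalar is computed at `ρ weyl v`,
  -- where `l` does not vanish.
  · obtain ⟨c, hc⟩ := hluniq (ρ.dual (diag a d) l) (fun t x => by
      rw [hdual, hdual, diag_inv, ← Module.End.mul_apply, ← map_mul]
      have := upperUnip_mul_diag ((a : F)⁻¹ * t * d) a⁻¹ d⁻¹
      have h2 : (((a⁻¹)⁻¹ : Fˣ) : F) * ((a : F)⁻¹ * t * d) * ((d⁻¹ : Fˣ) : F) = t := by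
        simp [mul_assoc]
      rw [h2] at this
      rw [← this, map_mul, Module.End.mul_apply, hlu])
    rw [hc]
    congr 1
    have := LinearMap.congr_fun hc (ρ weyl v)
    rw [hdual, diag_inv, ← Module.End.mul_apply, ← map_mul, diag_mul_weyl, map_mul,
      Module.End.mul_apply, hvt, map_smul, map_smul, LinearMap.smul_apply, smul_eq_mul,
      smul_eq_mul] at this
    have h3 := mul_right_cancel₀ hw this
    rw [← h3]
    simp [mul_comm]
  · exact hluniq l' (hinv l' hl')
  · intro h0
    apply hv
    rw [← Module.forall_dual_apply_eq_zero_iff k]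
    intro φ
    exact LinearMap.congr_fun h0 φ
  · change l' (ρ _ v) = l' v
    rw [upperUnip_inv, hvu]
  · obtain ⟨c, hc⟩ := hluniq l' (hinv l' hl')
    change l' v = 0
    rw [hc, LinearMap.smul_apply, hl0 v hvu, smul_zero]
  · obtain ⟨x, rfl⟩ := (Module.evalEquiv k V).surjective L
    obtain ⟨c, rfl⟩ := hvuniq x (fun t => by
      rw [← sub_eq_zero, ← Module.forall_dual_apply_eq_zero_iff k]
      intro φ
      have := hL (-t) φ
      change φ (ρ _ x) = φ x at this
      rw [upperUnip_inv, neg_neg] at this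
      rw [map_sub, this, sub_self])
    refine ⟨c, ?_⟩
    ext φ
    simp

end HighestWeight

/-! ### `U`-invariants and extensions -/

section Extension

variable {F : Type u} [Field F] {k : Type v} [Field k]

lemma mem_unipInvariants (σ : Rep.{v} k (GL (Fin 2) F)) (x : σ) :
    x ∈ Representation.invariants ((σ.ρ.comp (borel F).subtype).comp (unip F).subtype) ↔
      ∀ t, σ.ρ (upperUnip t) x = x := by
  rw [Representation.mem_invariants]
  constructor
  · intro h t
    exact h ⟨⟨upperUnip t, by change (upperUnip t).val 1 0 = 0; simp⟩,
      ⟨by simp, by simp⟩⟩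
  · rintro h ⟨⟨g, hg⟩, h0, h1⟩
    have : g = upperUnip (g.val 0 1) := by
      apply Units.ext
      ext i j
      change g.val 1 0 = 0 at hg
      simp only at h0 h1
      fin_cases i <;> fin_cases j <;> simp [hg, h0, h1]
    change σ.ρ g x = x
    rw [this, h]

lemma charRep_apply {G : Type*} [Group G] (χ : G →* kˣ) (g : G) (x : k) :
    charRep χ g x = ((χ g : kˣ) : k) * x := rfl

variable [Algebra F k]

lemma borel_apply_eq {V : Type*} [AddCommGroup V] [Module k V]
    {ρ : Representation k (GL (Fin 2) F) V} {m n : ℤ} {v : V}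
    (hvu : ∀ t, ρ (upperUnip t) v = v)
    (hvt : ∀ a d : Fˣ, ρ (diag a d) v = (algebraMap F k a ^ m * algebraMap F k d ^ n) • v)
    (b : borel F) : ρ b.val v = ((torusChar k m n b : kˣ) : k) • v := by
  obtain ⟨a, d, t, h, h0, h1⟩ := exists_borel_eq b.val b.2
  rw [torusChar_apply, h0, h1, ← hvt, h, map_mul, Module.End.mul_apply, hvu]

lemma IsHW.hasChar {σ : Rep.{v} k (GL (Fin 2) F)} {m n : ℤ} (h : IsHW σ.ρ m n) :
    HasChar σ (torusChar k m n) := by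
  obtain ⟨v, hv, hvu, hvt, huniq⟩ := h.vec
  let A : k →ₗ[k] Representation.invariants
      ((σ.ρ.comp (borel F).subtype).comp (unip F).subtype) :=
    LinearMap.toSpanSingleton k _ ⟨v, (mem_unipInvariants σ v).2 hvu⟩
  have hA : ∀ c, (A c).val = c • v := fun c => rfl
  have hbij : Function.Bijective A := by
    constructor
    · rw [← LinearMap.ker_eq_bot, LinearMap.ker_eq_bot']
      intro c hc
      have := congrArg Subtype.val hc
      rw [hA] at this
      exact (smul_eq_zero.mp this).resolve_right hv
    · rintro ⟨x, hx⟩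
      obtain ⟨c, hc⟩ := huniq x ((mem_unipInvariants σ x).1 hx)
      exact ⟨c, Subtype.ext hc.symm⟩
  refine ⟨(Representation.Equiv.mk (LinearEquiv.ofBijective A hbij) fun b => ?_).symm⟩
  ext
  change (A (charRep _ b 1)).val = σ.ρ b.val (A 1).val
  rw [hA, hA, one_smul, charRep_apply, mul_one, borel_apply_eq hvu hvt]

lemma IsHW.char_eq {σ τ : Rep.{v} k (GL (Fin 2) F)} {m n m' n' : ℤ} (h : IsHW σ.ρ m n)
    (h' : IsHW τ.ρ m' n') (e : Nonempty (σ.ρ.Equiv τ.ρ)) (a d : Fˣ) :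
    (algebraMap F k a ^ m * algebraMap F k d ^ n) =
      algebraMap F k a ^ m' * algebraMap F k d ^ n' := by
  obtain ⟨e⟩ := e
  obtain ⟨v, hv, hvu, hvt, -⟩ := h.vec
  obtain ⟨v', hv', -, hvt', huniq'⟩ := h'.vec
  obtain ⟨c, hc⟩ := huniq' (e v) (fun t => by rw [← equiv_apply_rho, hvu])
  have h0 : e v ≠ 0 := by
    intro h0
    apply hv
    rw [← e.symm_apply_apply v, h0, map_zero]
  have h1 : (algebraMap F k a ^ m * algebraMap F k d ^ n) • e v =
      (algebraMap F k a ^ m' * algebraMap F k d ^ n') • e v := by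
    rw [← map_smul, ← hvt, equiv_apply_rho, hc, map_smul, hvt', smul_comm]
  exact smul_left_injective k h0 h1

/-- An extension `E` of representations with distinct highest weights is non-split and has
two-dimensional `U`-invariants if it is generated by a `U`-invariant eigenvector of the torus. -/
lemma extension_of_generator {σ E τ : Rep.{v} k (GL (Fin 2) F)} {m n m' n' : ℤ}
    (hσ : IsHW σ.ρ m n) (hτ : IsHW τ.ρ m' n')
    (hne : torusChar (F := F) k m n ≠ torusChar k m' n')
    (i : σ.ρ.IntertwiningMap E.ρ) (q : E.ρ.IntertwiningMap τ.ρ)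
    (hi : Function.Injective i) (hq : Function.Surjective q) (hiq : Function.Exact i q)
    (v : E) (hvu : ∀ t, E.ρ (upperUnip t) v = v)
    (hvt : ∀ a d : Fˣ, E.ρ (diag a d) v = (algebraMap F k a ^ m' * algebraMap F k d ^ n') • v)
    (hgen : Submodule.span k (Set.range fun g => E.ρ g v) = ⊤) :
    IsNonsplitExtension σ E τ ∧ Nonempty ((unipInvariants E).Equiv
      ((charRep (torusChar k m n)).prod (charRep (torusChar k m' n')))) := by
  obtain ⟨x, hx, hxu, hxt, hxuniq⟩ := hσ.vec
  obtain ⟨y, hy, hyu, hyt, hyuniq⟩ := hτ.vec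
  have hir : ∀ g z, i (σ.ρ g z) = E.ρ g (i z) := fun g z => i.isIntertwining _ _ g z
  have hqr : ∀ g z, q (E.ρ g z) = τ.ρ g (q z) := fun g z => q.isIntertwining _ _ g z
  have hqv : q v ≠ 0 := by
    intro h0
    have hq0 : q.toLinearMap = 0 := by
      apply LinearMap.ext_on_range hgen
      intro g
      change q (E.ρ g v) = 0
      rw [hqr, h0, map_zero]
    obtain ⟨z, hz⟩ := hq y
    apply hy
    rw [← hz]
    exact LinearMap.congr_fun hq0 z
  -- The image of `z` is a multiple of `q v`; subtracting that multiple of `v` leaves a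
  -- `U`-invariant of `σ`.
  have hinv : ∀ z : E, (∀ t, E.ρ (upperUnip t) z = z) → ∃ a b : k, z = a • i x + b • v := by
    intro z hz
    obtain ⟨c, hc⟩ := hyuniq (q z) (fun t => by rw [← hqr, hz])
    obtain ⟨c', hc'⟩ := hyuniq (q v) (fun t => by rw [← hqr, hvu])
    have hc0 : c' ≠ 0 := by
      rintro rfl
      exact hqv (by rw [hc', zero_smul])
    have hd : q (z - (c / c') • v) = 0 := by
      rw [map_sub, map_smul, hc, hc', smul_smul, div_mul_cancel₀ _ hc0, sub_self]
    obtain ⟨s, hs⟩ := (hiq _).1 hd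
    obtain ⟨a, ha⟩ := hxuniq s (fun t => hi (by
      rw [hir, hs, map_sub, map_smul, hz, hvu]))
    refine ⟨a, c / c', ?_⟩
    rw [← map_smul, ← ha, hs, sub_add_cancel]
  have hqi : ∀ z, q (i z) = 0 := fun z => (hiq _).2 ⟨z, rfl⟩
  refine ⟨⟨i, q, hi, hq, hiq, ?_⟩, ?_⟩
  · rintro ⟨s, hs⟩
    have hsr : ∀ g z, s (τ.ρ g z) = E.ρ g (s z) := fun g z => s.isIntertwining _ _ g z
    obtain ⟨a, b, hab⟩ := hinv (s y) (fun t => by rw [← hsr, hyu])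
    have hb : b ≠ 0 := by
      rintro rfl
      apply hy
      rw [← hs y, hab, zero_smul, add_zero, map_smul, hqi, smul_zero]
    -- The section sends `y` to a torus eigenvector; the two characters being distinct, it has no
    -- component along `i x`.
    have ha : a = 0 := by
      by_contra ha
      apply hne
      ext g
      have h1 : E.ρ g.val (s y) = ((torusChar k m' n' g : kˣ) : k) • s y := by
        rw [← hsr, borel_apply_eq hyu hyt, map_smul]
      rw [hab, map_add, map_smul, map_smul, borel_apply_eq hvu hvt, ← hir,
        borel_apply_eq hxu hxt, map_smul, smul_add, smul_comm b, add_left_inj, smul_comm a] at h1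
      have h2 : a • i x ≠ 0 := by
        refine smul_ne_zero ha fun h0 => hx (hi ?_)
        rw [h0, map_zero]
      exact smul_left_injective k h2 h1
    rw [ha, zero_smul, zero_add] at hab
    -- Now `v` is in the image of the section, so the section is onto, which leaves no room for the
    -- non-zero image of `σ`.
    have htop : ∀ z : E, z ∈ LinearMap.range s.toLinearMap := by
      intro z
      have : (⊤ : Submodule k E) ≤ LinearMap.range s.toLinearMap := by
        rw [← hgen, Submodule.span_le]
        rintro _ ⟨g, rfl⟩
        refine ⟨τ.ρ g (b⁻¹ • y), ?_⟩
        change s _ = E.ρ g v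
        rw [hsr, map_smul, hab, smul_smul, inv_mul_cancel₀ hb, one_smul]
      exact this trivial
    obtain ⟨z, hz⟩ := htop (i x)
    have hz' : s z = i x := hz
    have : z = 0 := by rw [← hs z, hz', hqi]
    rw [this, map_zero] at hz'
    exact hx (hi (by rw [← hz', map_zero]))
  · have hixu : ∀ t, E.ρ (upperUnip t) (i x) = i x := fun t => by rw [← hir, hxu]
    let A : (k × k) →ₗ[k] Representation.invariants
        ((E.ρ.comp (borel F).subtype).comp (unip F).subtype) :=
      LinearMap.coprod
        (LinearMap.toSpanSingleton k _ ⟨i x, (mem_unipInvariants E _).2 hixu⟩)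
        (LinearMap.toSpanSingleton k _ ⟨v, (mem_unipInvariants E v).2 hvu⟩)
    have hA : ∀ c, (A c).val = c.1 • i x + c.2 • v := fun c => rfl
    have hbij : Function.Bijective A := by
      constructor
      · rw [← LinearMap.ker_eq_bot, LinearMap.ker_eq_bot']
        rintro ⟨a, b⟩ hc
        have h1 : a • i x + b • v = 0 := by
          rw [← hA (a, b), hc]
          rfl
        have hb : b = 0 := by
          have := congrArg q h1
          rw [map_add, map_smul, hqi, smul_zero, zero_add, map_smul, map_zero] at this
          exact (smul_eq_zero.mp this).resolve_right hqv
        rw [hb, zero_smul, add_zero, ← map_smul] at h1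
        have h2 : a • x = 0 := hi (by rw [h1, map_zero])
        rw [hb, (smul_eq_zero.mp h2).resolve_right hx]
        rfl
      · rintro ⟨z, hz⟩
        obtain ⟨a, b, hab⟩ := hinv z ((mem_unipInvariants E z).1 hz)
        exact ⟨(a, b), Subtype.ext hab.symm⟩
    refine ⟨(Representation.Equiv.mk (LinearEquiv.ofBijective A hbij) fun b => ?_).symm⟩
    refine LinearMap.ext fun c => ?_
    apply Subtype.ext
    change (A ((charRep _).prod (charRep _) b c)).val = E.ρ b.val (A c).val
    rw [hA, hA, map_add, map_smul, map_smul, borel_apply_eq hvu hvt, ← hir,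
      borel_apply_eq hxu hxt, map_smul, Representation.prod_apply_apply]
    simp only [charRep_apply, smul_smul, mul_comm]

end Extension

/-! ### Composition series and socle of a direct sum of non-split extensions -/

section DirectSumOfExtensions

variable {R : Type*} [Ring R] {n : ℕ} {A M C : Fin n → Type*}
  [∀ i, AddCommGroup (A i)] [∀ i, Module R (A i)] [∀ i, AddCommGroup (M i)] [∀ i, Module R (M i)]
  [∀ i, AddCommGroup (C i)] [∀ i, Module R (C i)]
  {D : Type*} [AddCommGroup D] [Module R D]

lemma nonempty_quotient_equiv {X : Type*} [AddCommGroup X] [Module R X] (N N' : Submodule R D)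
    (φ : N' →ₗ[R] X) (hφ : Function.Surjective φ) (hker : ∀ x, φ x = 0 ↔ x.val ∈ N) :
    Nonempty ((N' ⧸ N.comap N'.subtype) ≃ₗ[R] X) := by
  have : N.comap N'.subtype = LinearMap.ker φ := by
    ext x
    rw [LinearMap.mem_ker, hker]
    rfl
  exact ⟨(Submodule.quotEquivOfEq _ _ this).trans (φ.quotKerEquivOfSurjective hφ)⟩

/-- The `m`-th step of the filtration of `M i` that jumps from `0` to the range of `a` at `2i` and
from there to everything at `2i + 1`. -/
def localStep (a : ∀ i, A i →ₗ[R] M i) (m : ℕ) (i : Fin n) : Submodule R (M i) :=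
  if m ≤ 2 * i.val then ⊥ else if m = 2 * i.val + 1 then LinearMap.range (a i) else ⊤

/-- The `m`-th step of the filtration of `D`. -/
def globalStep (a : ∀ i, A i →ₗ[R] M i) (e : D ≃ₗ[R] ∀ i, M i) (m : ℕ) : Submodule R D where
  carrier := {x | ∀ i, e x i ∈ localStep a m i}
  add_mem' hx hy i := by
    rw [map_add]
    exact add_mem (hx i) (hy i)
  zero_mem' i := by
    rw [map_zero]
    exact zero_mem _
  smul_mem' c x hx i := by
    rw [map_smul]
    exact Submodule.smul_mem _ c (hx i)

lemma localStep_mono (a : ∀ i, A i →ₗ[R] M i) (m : ℕ) (i : Fin n) :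
    localStep a m i ≤ localStep a (m + 1) i := by
  unfold localStep
  split_ifs <;> first | omega | simp

lemma localStep_succ_of_ne (a : ∀ i, A i →ₗ[R] M i) {m : ℕ} {i : Fin n} (h1 : m ≠ 2 * i.val)
    (h2 : m ≠ 2 * i.val + 1) : localStep a (m + 1) i = localStep a m i := by
  unfold localStep
  split_ifs <;> first | omega | simp

lemma single_mem_globalStep {a : ∀ i, A i →ₗ[R] M i} {e : D ≃ₗ[R] ∀ i, M i} {m : ℕ} {i : Fin n}
    {x : M i} (hx : x ∈ localStep a m i) : e.symm (Pi.single i x) ∈ globalStep a e m := by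
  intro j
  rw [LinearEquiv.apply_symm_apply]
  by_cases h : j = i
  · subst h
    simpa using hx
  · rw [Pi.single_eq_of_ne h]
    exact zero_mem _

/-- Only the `i`-th coordinate changes between steps `2i` and `2i + 1`, from `0` to the range of `a
i`; `quotient_odd` is the companion jump from there to all of `M i`. -/
lemma quotient_even (a : ∀ i, A i →ₗ[R] M i) (ha : ∀ i, Function.Injective (a i))
    (e : D ≃ₗ[R] ∀ i, M i) (i : Fin n) :
    Nonempty ((globalStep a e (2 * i.val + 1) ⧸ (globalStep a e (2 * i.val)).comap
      (globalStep a e (2 * i.val + 1)).subtype) ≃ₗ[R] A i) := by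
  have hloc : localStep a (2 * i.val + 1) i = LinearMap.range (a i) := by
    simp [localStep]
  have hloc0 : localStep a (2 * i.val) i = ⊥ := by
    simp [localStep]
  let φ : globalStep a e (2 * i.val + 1) →ₗ[R] LinearMap.range (a i) :=
    (((LinearMap.proj i).comp e.toLinearMap).domRestrict _).codRestrict _ fun x => by
      rw [← hloc]
      exact x.2 i
  have hφ : ∀ x, (φ x).val = e x.val i := fun x => rfl
  obtain ⟨E⟩ := nonempty_quotient_equiv (globalStep a e (2 * i.val)) _ φ (by
    rintro ⟨y, hy⟩
    refine ⟨⟨_, single_mem_globalStep (i := i) (x := y) (by rwa [hloc])⟩, ?_⟩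
    apply Subtype.ext
    rw [hφ]
    simp) (fun x => by
      constructor
      · intro h j
        by_cases hj : j = i
        · subst hj
          rw [← hφ, h, hloc0]
          exact zero_mem _
        · have : j.val ≠ i.val := fun h => hj (Fin.ext h)
          rw [← localStep_succ_of_ne a (by omega) (by omega)]
          exact x.2 j
      · intro h
        have := h i
        rw [hloc0, ← hφ, Submodule.mem_bot] at this
        exact Subtype.ext this)
  exact ⟨E.trans (LinearEquiv.ofInjective (a i) (ha i)).symm⟩

lemma quotient_odd (a : ∀ i, A i →ₗ[R] M i) (c : ∀ i, M i →ₗ[R] C i)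
    (hc : ∀ i, Function.Surjective (c i)) (hac : ∀ i, Function.Exact (a i) (c i))
    (e : D ≃ₗ[R] ∀ i, M i) (i : Fin n) :
    Nonempty ((globalStep a e (2 * i.val + 2) ⧸ (globalStep a e (2 * i.val + 1)).comap
      (globalStep a e (2 * i.val + 2)).subtype) ≃ₗ[R] C i) := by
  have hloc : localStep a (2 * i.val + 2) i = ⊤ := by
    simp [localStep]
  have hloc0 : localStep a (2 * i.val + 1) i = LinearMap.range (a i) := by
    simp [localStep]
  let φ : globalStep a e (2 * i.val + 2) →ₗ[R] C i :=
    ((c i).comp ((LinearMap.proj i).comp e.toLinearMap)).domRestrict _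
  have hφ : ∀ x, φ x = c i (e x.val i) := fun x => rfl
  refine nonempty_quotient_equiv (globalStep a e (2 * i.val + 1)) _ φ ?_ (fun x => ?_)
  · intro y
    obtain ⟨z, rfl⟩ := hc i y
    refine ⟨⟨_, single_mem_globalStep (i := i) (x := z) (by rw [hloc]; trivial)⟩, ?_⟩
    rw [hφ]
    simp
  · rw [hφ, hac i]
    constructor
    · intro h j
      by_cases hj : j = i
      · subst hj
        rw [hloc0]
        exact h
      · have : j.val ≠ i.val := fun h => hj (Fin.ext h)
        rw [← localStep_succ_of_ne a (by omega) (by omega)]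
        exact x.2 j
    · intro h
      have := h i
      rwa [hloc0] at this

lemma globalStep_le (a : ∀ i, A i →ₗ[R] M i) (e : D ≃ₗ[R] ∀ i, M i) (m : ℕ) :
    globalStep a e m ≤ globalStep a e (m + 1) :=
  fun _ hx i => localStep_mono a m i (hx i)

/-- A direct sum of extensions of pairwise non-isomorphic simple modules has a composition series
with pairwise non-isomorphic factors. -/
lemma exists_compositionSeries [∀ i, IsSimpleModule R (A i)] [∀ i, IsSimpleModule R (C i)]
    (a : ∀ i, A i →ₗ[R] M i) (ha : ∀ i, Function.Injective (a i))
    (c : ∀ i, M i →ₗ[R] C i) (hc : ∀ i, Function.Surjective (c i))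
    (hac : ∀ i, Function.Exact (a i) (c i)) (e : D ≃ₗ[R] ∀ i, M i)
    (hAA : ∀ i j, Nonempty (A i ≃ₗ[R] A j) → i = j)
    (hCC : ∀ i j, Nonempty (C i ≃ₗ[R] C j) → i = j)
    (hAC : ∀ i j, IsEmpty (A i ≃ₗ[R] C j)) :
    ∃ s : CompositionSeries (Submodule R D), s.head = ⊥ ∧ s.last = ⊤ ∧
      ∀ i j : Fin s.length,
        Nonempty ((s i.succ ⧸ (s i.castSucc).comap (s i.succ).subtype) ≃ₗ[R]
          (s j.succ ⧸ (s j.castSucc).comap (s j.succ).subtype)) → i = j := by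
  have hcases : ∀ m, m < 2 * n → ∃ i : Fin n, m = 2 * i.val ∨ m = 2 * i.val + 1 := by
    intro m hm
    exact ⟨⟨m / 2, by omega⟩, by simp only; omega⟩
  have hcov : ∀ m, m < 2 * n → globalStep a e m ⋖ globalStep a e (m + 1) := by
    intro m hm
    rw [covBy_iff_quot_is_simple (globalStep_le a e m)]
    obtain ⟨i, rfl | rfl⟩ := hcases m hm
    · obtain ⟨E⟩ := quotient_even a ha e i
      exact IsSimpleModule.congr E
    · obtain ⟨E⟩ := quotient_odd a c hc hac e i
      exact IsSimpleModule.congr E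
  let s : CompositionSeries (Submodule R D) :=
    { length := 2 * n
      toFun := fun m => globalStep a e m.val
      step := fun m => hcov m.val m.2 }
  refine ⟨s, ?_, ?_, ?_⟩
  · rw [eq_bot_iff]
    intro x hx
    have hx' : ∀ i, e x i ∈ localStep a 0 i := hx
    rw [Submodule.mem_bot, ← e.map_eq_zero_iff]
    funext i
    simpa [localStep] using hx' i
  · rw [eq_top_iff]
    intro x _ i
    have h1 : ¬ (2 * n ≤ 2 * i.val) := by omega
    have h2 : ¬ (2 * n = 2 * i.val + 1) := by omega
    change _ ∈ localStep a (2 * n) i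
    simp [localStep, h1, h2]
  · intro x y ⟨E⟩
    change (globalStep a e (x.val + 1) ⧸ (globalStep a e x.val).comap
      (globalStep a e (x.val + 1)).subtype) ≃ₗ[R] (globalStep a e (y.val + 1) ⧸
      (globalStep a e y.val).comap (globalStep a e (y.val + 1)).subtype) at E
    apply Fin.ext
    obtain ⟨x, hx⟩ := x
    obtain ⟨y, hy⟩ := y
    simp only at E ⊢
    obtain ⟨i, rfl | rfl⟩ := hcases x hx <;> obtain ⟨j, rfl | rfl⟩ := hcases y hy
    · obtain ⟨E1⟩ := quotient_even a ha e i
      obtain ⟨E2⟩ := quotient_even a ha e j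
      rw [hAA i j ⟨E1.symm.trans (E.trans E2)⟩]
    · obtain ⟨E1⟩ := quotient_even a ha e i
      obtain ⟨E2⟩ := quotient_odd a c hc hac e j
      exact ((hAC i j).false (E1.symm.trans (E.trans E2))).elim
    · obtain ⟨E1⟩ := quotient_odd a c hc hac e i
      obtain ⟨E2⟩ := quotient_even a ha e j
      exact ((hAC j i).false (E2.symm.trans (E.symm.trans E1))).elim
    · obtain ⟨E1⟩ := quotient_odd a c hc hac e i
      obtain ⟨E2⟩ := quotient_odd a c hc hac e j
      rw [hCC i j ⟨E1.symm.trans (E.trans E2)⟩]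

/-- By Schur, a simple submodule maps to each `C i` by zero or isomorphically. The latter would
split the extension, so the submodule lies in the product of the `A i`, which is semisimple of
length `n`. -/
lemma length_socle [∀ i, IsSimpleModule R (A i)] [∀ i, IsSimpleModule R (C i)]
    (a : ∀ i, A i →ₗ[R] M i) (ha : ∀ i, Function.Injective (a i))
    (c : ∀ i, M i →ₗ[R] C i) (hac : ∀ i, Function.Exact (a i) (c i))
    (hns : ∀ i, ¬ ∃ s : C i →ₗ[R] M i, ∀ x, c i (s x) = x) (e : D ≃ₗ[R] ∀ i, M i) :
    Module.length R (socle R D) = n := by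
  let ψ : (∀ i, A i) →ₗ[R] D := e.symm.toLinearMap.comp
    (LinearMap.pi fun i => (a i).comp (LinearMap.proj i))
  have hψ : ∀ x i, e (ψ x) i = a i (x i) := fun x i => by simp [ψ]
  have hψi : Function.Injective ψ := by
    intro x y h
    funext i
    apply ha i
    rw [← hψ, ← hψ, h]
  have hsoc : socle R D = LinearMap.range ψ := by
    apply le_antisymm
    · apply sSup_le
      intro N hN x hx
      have : IsSimpleModule R N := hN
      have hmem : ∀ i, c i (e x i) = 0 := by
        intro i
        let φ : N →ₗ[R] C i := (c i).comp ((LinearMap.proj i).comp (e.toLinearMap.comp N.subtype))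
        rcases φ.bijective_or_eq_zero with h | h
        · exfalso
          apply hns i
          let E := LinearEquiv.ofBijective φ h
          refine ⟨((LinearMap.proj i).comp (e.toLinearMap.comp N.subtype)).comp
            E.symm.toLinearMap, fun y => ?_⟩
          exact E.apply_symm_apply y
        · exact LinearMap.congr_fun h ⟨x, hx⟩
      choose y hy using fun i => (hac i _).1 (hmem i)
      refine ⟨y, e.injective ?_⟩
      funext i
      rw [hψ, hy]
    · rintro _ ⟨x, rfl⟩
      have hx : x = ∑ i, Pi.single i (x i) := (Finset.univ_sum_single x).symm
      rw [hx, map_sum]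
      refine Submodule.sum_mem _ fun i _ => ?_
      let φ : A i →ₗ[R] D := ψ.comp (LinearMap.single R A i)
      have hφ : Function.Injective φ := hψi.comp (Pi.single_injective i)
      have hsimp : IsSimpleModule R (LinearMap.range φ) :=
        IsSimpleModule.congr (LinearEquiv.ofInjective φ hφ).symm
      exact (le_sSup (a := LinearMap.range φ) (by exact hsimp)) ⟨x i, rfl⟩
  rw [hsoc, ← (LinearEquiv.ofInjective ψ hψi).length_eq, Module.length_pi_of_fintype]
  simp [Module.length_eq_one]

end DirectSumOfExtensions

/-! ### Passage between representations and modules over the group ring. -/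

section Rep

variable {G : Type u} [Group G] {k : Type v} [Field k] {n : ℕ}

/-- The group ring module of a direct sum of representations is the product of the modules. -/
lemma nonempty_directSum_asModule_equiv (E : Fin n → Rep.{v} k G) :
    Nonempty ((Rep.of (Representation.directSum fun i => (E i).ρ)).ρ.asModule ≃ₗ[k[G]]
      ∀ i, (E i).ρ.asModule) := by
  let D := Representation.directSum fun i => (E i).ρ
  let pr : ∀ i, D.IntertwiningMap (E i).ρ := fun i =>
    ⟨DirectSum.component k _ _ i, fun g => by
      refine LinearMap.ext fun x => ?_
      exact DFinsupp.mapRange_apply (fun i => (E i).ρ g) (fun i => map_zero _) x i⟩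
  let Φ : D.asModule →ₗ[k[G]] ∀ i, (E i).ρ.asModule :=
    LinearMap.pi fun i => Representation.IntertwiningMap.equivLinearMapAsModule D (E i).ρ (pr i)
  refine ⟨LinearEquiv.ofBijective Φ ?_⟩
  exact (DirectSum.linearEquivFunOnFintype k (Fin n) (fun i => (E i).V)).bijective

lemma nonempty_equiv_of_asModule {σ τ : Rep.{v} k G}
    (e : Nonempty (σ.ρ.asModule ≃ₗ[k[G]] τ.ρ.asModule)) : Nonempty (σ.ρ.Equiv τ.ρ) := by
  obtain ⟨e⟩ := e
  exact ⟨((Representation.IntertwiningMap.equivLinearMapAsModule σ.ρ τ.ρ).symm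
    e.toLinearMap).ofBijective e.bijective⟩

variable {σ E τ : Fin n → Rep.{v} k G}

lemma isMultiplicityFree_directSum (hσ : ∀ i, (σ i).ρ.IsIrreducible)
    (hτ : ∀ i, (τ i).ρ.IsIrreducible) (hE : ∀ i, IsNonsplitExtension (σ i) (E i) (τ i))
    (hσσ : ∀ i j, Nonempty ((σ i).ρ.Equiv (σ j).ρ) → i = j)
    (hττ : ∀ i j, Nonempty ((τ i).ρ.Equiv (τ j).ρ) → i = j)
    (hστ : ∀ i j, IsEmpty ((σ i).ρ.Equiv (τ j).ρ)) :
    IsMultiplicityFree (Rep.of (Representation.directSum fun i => (E i).ρ)) ∧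
      socleLength (Rep.of (Representation.directSum fun i => (E i).ρ)) = n := by
  choose a c ha hc hac hns using hE
  obtain ⟨e⟩ := nonempty_directSum_asModule_equiv E
  let a' i := Representation.IntertwiningMap.equivLinearMapAsModule (σ i).ρ (E i).ρ (a i)
  let c' i := Representation.IntertwiningMap.equivLinearMapAsModule (E i).ρ (τ i).ρ (c i)
  have : ∀ i, IsSimpleModule k[G] (σ i).ρ.asModule := fun i =>
    (Representation.irreducible_iff_isSimpleModule_asModule _).1 (hσ i)
  have : ∀ i, IsSimpleModule k[G] (τ i).ρ.asModule := fun i =>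
    (Representation.irreducible_iff_isSimpleModule_asModule _).1 (hτ i)
  constructor
  · exact exists_compositionSeries a' ha c' hc hac e
      (fun i j h => hσσ i j (nonempty_equiv_of_asModule h))
      (fun i j h => hττ i j (nonempty_equiv_of_asModule h))
      (fun i j => ⟨fun h => (nonempty_equiv_of_asModule ⟨h⟩).elim (hστ i j).false⟩)
  · refine length_socle a' ha c' hac (fun i => ?_) e
    rintro ⟨s, hs⟩
    exact hns i ⟨(Representation.IntertwiningMap.equivLinearMapAsModule _ _).symm s, hs⟩

end Rep

/-! ### Digit expansions -/

section Digits

variable (p : ℕ) {f : ℕ}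

/-- The number with base `p` digits `d`. -/
def digitVal (d : Fin f → ℕ) : ℕ := ∑ j, d j * p ^ j.val

lemma digitVal_add (d d' : Fin f → ℕ) : digitVal p (d + d') = digitVal p d + digitVal p d' := by
  simp [digitVal, add_mul, Finset.sum_add_distrib]

lemma digitVal_zero : digitVal p (0 : Fin f → ℕ) = 0 := by simp [digitVal]

variable {p}

lemma digitVal_eq_finFunctionFinEquiv {d : Fin f → ℕ} (hd : ∀ j, d j < p) :
    digitVal p d = (finFunctionFinEquiv (fun j => (⟨d j, hd j⟩ : Fin p))).val := by
  rw [finFunctionFinEquiv_apply]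
  rfl

lemma digitVal_lt {d : Fin f → ℕ} (hd : ∀ j, d j < p) : digitVal p d < p ^ f := by
  rw [digitVal_eq_finFunctionFinEquiv hd]
  exact Fin.is_lt _

lemma digitVal_inj {d d' : Fin f → ℕ} (hd : ∀ j, d j < p) (hd' : ∀ j, d' j < p)
    (h : digitVal p d = digitVal p d') : d = d' := by
  rw [digitVal_eq_finFunctionFinEquiv hd, digitVal_eq_finFunctionFinEquiv hd'] at h
  have := finFunctionFinEquiv.injective (Fin.ext h)
  funext j
  exact congrArg Fin.val (congrFun this j)

end Digits

/-! ### Recovering the coefficients of a polynomial from its values on a finite field. -/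

section Extraction

variable {F : Type u} [Field F] [Fintype F] {k : Type v} [Field k] [Algebra F k]
  {V : Type*} [AddCommGroup V] [Module k V]

/-- The coefficients of a polynomial of degree less than `|F|` lie in the span of its values. -/
lemma mem_of_forall_sum_pow_smul_mem {ι : Type*} (s : Finset ι) (n : ι → ℕ)
    (hn : ∀ i ∈ s, n i < Fintype.card F) (hinj : ∀ i ∈ s, ∀ j ∈ s, n i = n j → i = j)
    (x : ι → V) (N : Submodule k V) (h : ∀ t : F, ∑ i ∈ s, algebraMap F k t ^ n i • x i ∈ N) :
    ∀ i ∈ s, x i ∈ N := by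
  classical
  intro i hi
  rw [← Submodule.Quotient.mk_eq_zero, ← Module.forall_dual_apply_eq_zero_iff k]
  intro φ
  -- Testing against a functional on `V ⧸ N` gives a scalar polynomial of degree less than `|F|`
  -- that vanishes on all of `F`.
  let P : Polynomial k := ∑ i ∈ s, Polynomial.monomial (n i) (φ (N.mkQ (x i)))
  have hP : P = 0 := by
    refine Polynomial.eq_zero_of_natDegree_lt_card_of_eval_eq_zero P
      (algebraMap F k).injective (fun t => ?_) ?_
    · have := h t
      rw [← Submodule.Quotient.mk_eq_zero, ← Submodule.mkQ_apply, map_sum] at this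
      have := congrArg φ this
      rw [map_sum, map_zero] at this
      rw [← this, Polynomial.eval_finsetSum]
      refine Finset.sum_congr rfl fun i _ => ?_
      rw [Polynomial.eval_monomial, map_smul, map_smul, smul_eq_mul, mul_comm]
    · refine (Polynomial.natDegree_sum_le_of_forall_le s _ (n := Fintype.card F - 1)
        fun i hi => ?_).trans_lt (Nat.sub_lt Fintype.card_pos one_pos)
      exact (Polynomial.natDegree_monomial_le _).trans (Nat.le_sub_one_of_lt (hn i hi))
  have := congrArg (fun Q => Polynomial.coeff Q (n i)) hP
  simp only [P, Polynomial.finsetSum_coeff, Polynomial.coeff_monomial,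
    Polynomial.coeff_zero] at this
  rw [Finset.sum_eq_single_of_mem i hi (fun j hj hji => if_neg fun h => hji (hinj j hj i hi h)),
    if_pos rfl] at this
  exact this

end Extraction

/-! ### Representations with a basis indexed by a box -/

section Box

variable {p f : ℕ} {F : Type u} [Field F] [Fintype F] {k : Type v} [Field k] [Algebra F k]
  {V : Type*} [AddCommGroup V] [Module k V] {ρ : Representation k (GL (Fin 2) F) V}
  {s : Fin f → ℕ} {e : (Fin f → ℕ) → V} {c : (Fin f → ℕ) → (Fin f → ℕ) → k}

/-- Digits below `p` make the exponents `digitVal p j` distinct and less than `|F|`, so coefficients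
can be extracted. -/
lemma mem_of_forall_sum_Iic_mem (hF : Fintype.card F = p ^ f) (hs : ∀ j, s j < p)
    (x : (Fin f → ℕ) → V) (N : Submodule k V)
    (h : ∀ t : F, ∑ j ∈ Finset.Iic s, algebraMap F k t ^ digitVal p j • x j ∈ N) :
    ∀ j ≤ s, x j ∈ N := by
  intro j hj
  have hlt : ∀ n ∈ Finset.Iic s, ∀ j, n j < p := fun n hn j =>
    (Finset.mem_Iic.1 hn j).trans_lt (hs j)
  exact mem_of_forall_sum_pow_smul_mem (F := F) (Finset.Iic s) (digitVal p)
    (fun n hn => by rw [hF]; exact digitVal_lt (hlt n hn))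
    (fun n hn n' hn' h => digitVal_inj (hlt n hn) (hlt n' hn') h) x N h j (Finset.mem_Iic.2 hj)

/-- Take `i₀` minimal among the indices occurring in `x`. The coefficient of `t` to the power
`digitVal p (s - i₀)` in the translate of `x` only involves indices `i ≤ i₀`, hence only `i₀`, and
is a non-zero multiple of `e s`. -/
lemma top_mem_of_box (hF : Fintype.card F = p ^ f) (hs : ∀ j, s j < p)
    (hspan : Submodule.span k (e '' Set.Iic s) = ⊤)
    (hc : ∀ i j, i ≤ j → j ≤ s → c i j ≠ 0)
    (hu : ∀ t, ∀ i ≤ s, ρ (upperUnip t) (e i) =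
      ∑ j ∈ Finset.Icc i s, (c i j * algebraMap F k t ^ digitVal p (j - i)) • e j)
    {x : V} (hx : x ≠ 0) (N : Submodule k V) (hN : ∀ t, ρ (upperUnip t) x ∈ N) : e s ∈ N := by
  classical
  have hx' : x ∈ Submodule.span k (e '' (Finset.Iic s : Finset (Fin f → ℕ))) := by
    rw [Finset.coe_Iic, hspan]
    trivial
  rw [Submodule.mem_span_image_finset_iff_exists_fun] at hx'
  obtain ⟨a', ha'⟩ := hx'
  obtain ⟨a, ha⟩ : ∃ a : (Fin f → ℕ) → k, ∑ i ∈ Finset.Iic s, a i • e i = x := by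
    refine ⟨fun i => if h : i ∈ Finset.Iic s then a' ⟨i, h⟩ else 0, ?_⟩
    rw [← ha', ← Finset.sum_coe_sort]
    refine Finset.sum_congr rfl fun i _ => ?_
    simp only [i.2, dif_pos]
  -- The double sum is regrouped by the difference `n = j - i`, which is the exponent of `t`.
  have hexp : ∀ t, ρ (upperUnip t) x = ∑ n ∈ Finset.Iic s, algebraMap F k t ^ digitVal p n •
      ∑ i ∈ Finset.Iic s, if i + n ≤ s then (a i * c i (i + n)) • e (i + n) else 0 := by
    intro t
    rw [← ha, map_sum]
    simp_rw [Finset.smul_sum]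
    rw [Finset.sum_comm]
    refine Finset.sum_congr rfl fun i hi => ?_
    rw [map_smul, hu t i (Finset.mem_Iic.1 hi), Finset.smul_sum]
    simp_rw [smul_ite, smul_zero]
    rw [← Finset.sum_filter]
    refine Finset.sum_bij' (fun j _ => j - i) (fun n _ => i + n) ?_ ?_ ?_ ?_ ?_
    · intro j hj
      rw [Finset.mem_Icc] at hj
      rw [Finset.mem_filter, Finset.mem_Iic, add_tsub_cancel_of_le hj.1]
      exact ⟨tsub_le_self.trans hj.2, hj.2⟩
    · intro n hn
      rw [Finset.mem_filter] at hn
      rw [Finset.mem_Icc]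
      exact ⟨le_self_add, hn.2⟩
    · intro j hj
      exact add_tsub_cancel_of_le (Finset.mem_Icc.1 hj).1
    · intro n hn
      exact add_tsub_cancel_left i n
    · intro j hj
      rw [add_tsub_cancel_of_le (Finset.mem_Icc.1 hj).1, smul_smul, smul_smul]
      congr 1
      ring
  have hne : ((Finset.Iic s).filter fun i => a i ≠ 0).Nonempty := by
    rw [Finset.nonempty_iff_ne_empty]
    intro h0
    apply hx
    rw [← ha]
    refine Finset.sum_eq_zero fun i hi => ?_
    by_contra h1
    have : i ∈ (Finset.Iic s).filter fun i => a i ≠ 0 :=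
      Finset.mem_filter.2 ⟨hi, fun h2 => h1 (by rw [h2, zero_smul])⟩
    rw [h0] at this
    exact absurd this (Finset.notMem_empty _)
  obtain ⟨i₀, hi₀, hmin⟩ := Finset.exists_minimal hne
  rw [Finset.mem_filter, Finset.mem_Iic] at hi₀
  have hmem := mem_of_forall_sum_Iic_mem hF hs _ N
    (fun t => by rw [← hexp]; exact hN t) (s - i₀) tsub_le_self
  rw [Finset.sum_eq_single_of_mem i₀ (Finset.mem_Iic.2 hi₀.1)] at hmem
  · rw [add_tsub_cancel_of_le hi₀.1, if_pos le_rfl] at hmem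
    exact (N.smul_mem_iff (mul_ne_zero hi₀.2 (hc i₀ s hi₀.1 le_rfl))).1 hmem
  · intro i hi hne
    split_ifs with h
    · have hle : i ≤ i₀ := by
        intro j
        have h1 : i j + (s j - i₀ j) ≤ s j := h j
        have h2 : i₀ j ≤ s j := hi₀.1 j
        change i j ≤ i₀ j
        omega
      by_cases h0 : a i = 0
      · rw [h0, zero_mul, zero_smul]
      · exact absurd (le_antisymm hle (hmin (Finset.mem_filter.2 ⟨hi, h0⟩) hle)) hne
    · rfl

/-- A representation with a basis indexed by a box on which `U` acts triangularly with non-zero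
coefficients has a highest weight. -/
lemma isHW_of_box (hF : Fintype.card F = p ^ f) (hs : ∀ j, s j < p) (hs0 : s ≠ 0)
    (hli : LinearIndependent k (fun i : Set.Iic s => e i))
    (hspan : Submodule.span k (e '' Set.Iic s) = ⊤)
    (hc : ∀ i j, i ≤ j → j ≤ s → c i j ≠ 0) (hc1 : ∀ i, c i i = 1)
    (hu : ∀ t, ∀ i ≤ s, ρ (upperUnip t) (e i) =
      ∑ j ∈ Finset.Icc i s, (c i j * algebraMap F k t ^ digitVal p (j - i)) • e j)
    {ε : k} (hε : ε ≠ 0) (hw : ρ weyl (e s) = ε • e 0) {m n : ℤ}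
    (ht : ∀ a d : Fˣ, ρ (diag a d) (e s) = (algebraMap F k a ^ m * algebraMap F k d ^ n) • e s) :
    IsHW ρ m n := by
  classical
  have htop : ∀ {x : V}, x ≠ 0 → ∀ N : Submodule k V, (∀ t, ρ (upperUnip t) x ∈ N) → e s ∈ N :=
    fun hx N hN => top_mem_of_box hF hs hspan hc hu hx N hN
  have hes : e s ≠ 0 := hli.ne_zero ⟨s, Set.mem_Iic.2 le_rfl⟩
  have hzero : (0 : Fin f → ℕ) ≤ s := fun j => Nat.zero_le _
  have hu0 : ∀ t, ρ (upperUnip t) (e 0) =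
      ∑ j ∈ Finset.Iic s, algebraMap F k t ^ digitVal p j • c 0 j • e j := by
    intro t
    rw [hu t 0 hzero]
    have : Finset.Icc 0 s = Finset.Iic s := by
      ext x
      simp
    rw [this]
    refine Finset.sum_congr rfl fun j _ => ?_
    rw [smul_smul, mul_comm, tsub_zero]
  have hus : ∀ t, ρ (upperUnip t) (e s) = e s := by
    intro t
    rw [hu t s le_rfl, Finset.Icc_self, Finset.sum_singleton, tsub_self, hc1, digitVal_zero,
      pow_zero, one_mul, one_smul]
  have huniq : ∀ x, (∀ t, ρ (upperUnip t) x = x) → ∃ c : k, x = c • e s := by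
    intro x hx
    by_cases hx0 : x = 0
    · exact ⟨0, by rw [hx0, zero_smul]⟩
    · have := htop hx0 (Submodule.span k {x}) (fun t => by
        rw [hx]
        exact Submodule.mem_span_singleton_self x)
      obtain ⟨b, hb⟩ := Submodule.mem_span_singleton.1 this
      refine ⟨b⁻¹, ?_⟩
      rw [← hb, smul_smul, inv_mul_cancel₀, one_smul]
      rintro rfl
      exact hes (by rw [← hb, zero_smul])
  refine ⟨fun N hN => ?_, ⟨e s, hes, hus, ht, huniq⟩, ?_⟩
  -- A non-zero stable subspace contains `e s`, hence its Weyl translate `e 0`, and the translates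
  -- of `e 0` under `U` yield every `e j`.
  · by_cases h0 : N = ⊥
    · exact Or.inl h0
    · right
      obtain ⟨x, hxN, hx0⟩ := Submodule.exists_mem_ne_zero_of_ne_bot h0
      have h1 := htop hx0 N (fun t => hN _ x hxN)
      have h2 : e 0 ∈ N := by
        have := hN weyl _ h1
        rw [hw] at this
        exact (N.smul_mem_iff hε).1 this
      rw [eq_top_iff, ← hspan, Submodule.span_le]
      rintro _ ⟨j, hj, rfl⟩
      have h3 := mem_of_forall_sum_Iic_mem hF hs (fun j => c 0 j • e j) N (fun t => by
        rw [← hu0]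
        exact hN _ _ h2) j hj
      exact (N.smul_mem_iff (hc 0 j (fun _ => Nat.zero_le _) hj)).1 h3
  · let b : Module.Basis (Set.Iic s) k V := Module.Basis.mk hli (by
      rw [← hspan]
      exact Submodule.span_mono (by rintro _ ⟨j, hj, rfl⟩; exact ⟨⟨j, hj⟩, rfl⟩))
    have hb : ∀ j : Set.Iic s, b j = e j := fun j => Module.Basis.mk_apply _ _ j
    let l : Module.Dual k V := b.coord ⟨0, hzero⟩
    have hl : ∀ j ≤ s, l (e j) = if j = 0 then 1 else 0 := by
      intro j hj
      have := hb ⟨j, hj⟩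
      simp only at this
      rw [← this]
      simp only [l, Module.Basis.coord_apply, Module.Basis.repr_self, Finsupp.single_apply]
      exact if_congr Subtype.ext_iff rfl rfl
    refine ⟨l, fun h0 => ?_, fun t x => ?_, fun x hx => ?_, fun l' hl' => ?_⟩
    · have := hl 0 hzero
      rw [h0] at this
      simp at this
    · have : l.comp (ρ (upperUnip t)) = l := by
        refine b.ext fun i => ?_
        rw [hb, LinearMap.comp_apply, hu t i i.2, map_sum]
        simp only [map_smul]
        by_cases hi : i.val = 0
        · rw [hl i i.2, if_pos hi, Finset.sum_eq_single_of_mem 0, hl 0 hzero, if_pos rfl, hi,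
            hc1, tsub_self, digitVal_zero, pow_zero, one_mul, smul_eq_mul, one_mul]
          · rw [hi, Finset.mem_Icc]
            exact ⟨le_rfl, hzero⟩
          · intro j hj hj0
            rw [hl j (Finset.mem_Icc.1 hj).2, if_neg hj0, smul_zero]
        · rw [hl i i.2, if_neg hi]
          refine Finset.sum_eq_zero fun j hj => ?_
          rw [Finset.mem_Icc] at hj
          rw [hl j hj.2, if_neg, smul_zero]
          rintro rfl
          exact hi (le_antisymm hj.1 (fun _ => Nat.zero_le _))
      exact LinearMap.congr_fun this x
    · obtain ⟨a, rfl⟩ := huniq x hx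
      rw [map_smul, hl s le_rfl, if_neg hs0, smul_zero]
    · refine ⟨l' (e 0), b.ext fun i => ?_⟩
      rw [hb, LinearMap.smul_apply, hl i i.2]
      split_ifs with h0
      · rw [h0, smul_eq_mul, mul_one]
      · rw [smul_zero]
        -- Invariance of `l'` at `e 0` is an identity of polynomials in `t`; its non-constant
        -- coefficients `c 0 j * l' (e j)` must vanish.
        have h3 := mem_of_forall_sum_Iic_mem hF hs
          (fun j => c 0 j * l' (e j) - if j = 0 then l' (e 0) else 0) ⊥
          (fun t => by
            rw [Submodule.mem_bot]
            have h4 := hl' t (e 0)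
            rw [hu0, map_sum] at h4
            simp only [map_smul] at h4
            rw [Finset.sum_congr rfl fun j _ => smul_sub (_ : k) _ _, Finset.sum_sub_distrib,
              sub_eq_zero]
            refine Eq.trans h4 ?_
            rw [Finset.sum_eq_single_of_mem 0 (Finset.mem_Iic.2 hzero), if_pos rfl, digitVal_zero,
              pow_zero, one_smul]
            intro j _ hj
            rw [if_neg hj, smul_zero]) i i.2
        rw [Submodule.mem_bot, if_neg h0, sub_zero] at h3
        exact (mul_eq_zero.1 h3).resolve_left (hc 0 i (fun _ => Nat.zero_le _) i.2)

end Box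

/-! ### Monomials in tensor products of symmetric powers -/

section Monomials

variable (k : Type v) [Field k]

/-- The monomial `X₀ᵃ X₁ⁿ⁻ᵃ` of degree `n`, or zero if `n < a`. -/
def mon (n a : ℕ) : MvPolynomial.homogeneousSubmodule (Fin 2) k n :=
  if h : a ≤ n then ⟨MvPolynomial.X 0 ^ a * MvPolynomial.X 1 ^ (n - a), by
    rw [MvPolynomial.mem_homogeneousSubmodule]
    have := (MvPolynomial.isHomogeneous_X_pow (R := k) (0 : Fin 2) a).mul
      (MvPolynomial.isHomogeneous_X_pow (R := k) (1 : Fin 2) (n - a))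
    rwa [add_tsub_cancel_of_le h] at this⟩ else 0

lemma mon_val {n a : ℕ} (h : a ≤ n) :
    (mon k n a).val = MvPolynomial.X 0 ^ a * MvPolynomial.X 1 ^ (n - a) := by
  rw [mon, dif_pos h]

lemma mon_val_eq_monomial {n a : ℕ} (h : a ≤ n) : (mon k n a).val =
    MvPolynomial.monomial (Finsupp.single 0 a + Finsupp.single 1 (n - a)) 1 := by
  rw [mon_val k h, MvPolynomial.X_pow_eq_monomial, MvPolynomial.X_pow_eq_monomial,
    MvPolynomial.monomial_mul, one_mul]

lemma linearIndependent_mon (n : ℕ) :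
    LinearIndependent k (fun a : Fin (n + 1) => mon k n a.val) := by
  apply LinearIndependent.of_comp (Submodule.subtype _)
  have h := (MvPolynomial.basisMonomials (Fin 2) k).linearIndependent.comp
    (fun a : Fin (n + 1) => Finsupp.single 0 a.val + Finsupp.single 1 (n - a.val)) (by
      intro a b hab
      have := DFunLike.congr_fun hab 0
      simp at this
      exact Fin.ext this)
  convert h using 1
  funext a
  simp only [Function.comp_apply, Submodule.subtype_apply, MvPolynomial.coe_basisMonomials]
  rw [mon_val_eq_monomial k (by omega)]

lemma span_mon (n : ℕ) :
    Submodule.span k (Set.range fun a : Fin (n + 1) => mon k n a.val) = ⊤ := by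
  rw [eq_top_iff]
  rintro ⟨P, hP⟩ -
  have hP' := (MvPolynomial.mem_homogeneousSubmodule n P).1 hP
  have hsum : (⟨P, hP⟩ : MvPolynomial.homogeneousSubmodule (Fin 2) k n) =
      ∑ d ∈ P.support, P.coeff d • mon k n (d 0) := by
    apply Subtype.ext
    rw [Submodule.coe_sum]
    refine P.as_sum.trans ?_
    refine Finset.sum_congr rfl fun d hd => ?_
    have hdeg : d 0 + d 1 = n := by
      have := hP' (MvPolynomial.mem_support_iff.1 hd)
      rw [← this, Finsupp.weight_apply, Finsupp.sum_fintype _ _ (by simp)]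
      simp [Fin.sum_univ_two]
    rw [Submodule.coe_smul, mon_val_eq_monomial k (by omega), MvPolynomial.smul_monomial,
      smul_eq_mul, mul_one]
    have hd' : Finsupp.single 0 (d 0) + Finsupp.single 1 (n - d 0) = d := by
      ext i
      fin_cases i
      · simp
      · simp
        omega
    rw [hd']
  rw [hsum]
  refine Submodule.sum_mem _ fun d hd => Submodule.smul_mem _ _ (Submodule.subset_span ?_)
  have hdeg : d 0 + d 1 = n := by
    have := hP' (MvPolynomial.mem_support_iff.1 hd)
    rw [← this, Finsupp.weight_apply, Finsupp.sum_fintype _ _ (by simp)]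
    simp [Fin.sum_univ_two]
  exact ⟨⟨d 0, by omega⟩, rfl⟩

/-- The basis of monomials of `Symⁿ k²`. -/
def monBasis (n : ℕ) :
    Module.Basis (Fin (n + 1)) k (MvPolynomial.homogeneousSubmodule (Fin 2) k n) :=
  Module.Basis.mk (linearIndependent_mon k n) (span_mon k n).ge

lemma monBasis_apply (n : ℕ) (a : Fin (n + 1)) : monBasis k n a = mon k n a.val :=
  Module.Basis.mk_apply _ _ a

variable {f : ℕ}

/-- The tensor product of the monomials `mon (d j) (A j)`. -/
def tmon (d A : Fin f → ℕ) : ⨂[k] j, MvPolynomial.homogeneousSubmodule (Fin 2) k (d j) :=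
  PiTensorProduct.tprod k fun j => mon k (d j) (A j)

/-- The basis of monomials of a tensor product of symmetric powers. -/
def tmonBasis (d : Fin f → ℕ) : Module.Basis (∀ j, Fin (d j + 1)) k
    (⨂[k] j, MvPolynomial.homogeneousSubmodule (Fin 2) k (d j)) :=
  Basis.piTensorProduct fun j => monBasis k (d j)

lemma tmonBasis_apply (d : Fin f → ℕ) (a : ∀ j, Fin (d j + 1)) :
    tmonBasis k d a = tmon k d fun j => (a j).val := by
  rw [tmonBasis, Basis.piTensorProduct_apply]
  simp only [monBasis_apply]
  rfl

lemma span_tmon (d : Fin f → ℕ) : Submodule.span k (tmon k d '' Set.Iic d) = ⊤ := by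
  rw [eq_top_iff, ← (tmonBasis k d).span_eq, Submodule.span_le]
  rintro _ ⟨a, rfl⟩
  rw [tmonBasis_apply]
  exact Submodule.subset_span ⟨_, fun j => Nat.lt_succ_iff.1 (a j).2, rfl⟩

lemma linearIndependent_tmon (d : Fin f → ℕ) :
    LinearIndependent k (fun A : Set.Iic d => tmon k d A) := by
  have h := (tmonBasis k d).linearIndependent.comp
    (fun (A : Set.Iic d) (j : Fin f) => (⟨A.val j, Nat.lt_succ_iff.2 (A.2 j)⟩ : Fin (d j + 1))) (by
      intro A B hAB
      apply Subtype.ext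
      funext j
      exact congrArg Fin.val (congrFun hAB j))
  convert h using 1
  funext A
  rw [Function.comp_apply, tmonBasis_apply]

variable (p : ℕ) [Fact p.Prime] (F : Type u) [Field F] [CharP F p] [Algebra F k]

lemma frobEmb_val (j : ℕ) (g : GL (Fin 2) F) (a b : Fin 2) :
    (frobEmb k p F j g).val a b = algebraMap F k (g.val a b) ^ p ^ j := by
  simp [frobEmb, iterateFrobenius_def]

lemma symPow_val (n : ℕ) (g : GL (Fin 2) k) (P : MvPolynomial.homogeneousSubmodule (Fin 2) k n) :
    (symPow k n g P).val = symAlg k g.val P.val := rfl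

lemma symPow_upperUnip_mon {n a : ℕ} (ha : a ≤ n) (j : ℕ) (t : F) :
    symPow k n (frobEmb k p F j (upperUnip t)) (mon k n a) =
      ∑ b ∈ Finset.Icc a n, (((n - a).choose (b - a) : k) *
        algebraMap F k t ^ ((b - a) * p ^ j)) • mon k n b := by
  have hp := (Fact.out : p.Prime).ne_zero
  apply Subtype.ext
  rw [symPow_val, mon_val k ha, Submodule.coe_sum, map_mul, map_pow, map_pow]
  have h0 : symAlg k (frobEmb k p F j (upperUnip t)).val (MvPolynomial.X 0) =
      MvPolynomial.X 0 := by
    simp [symAlg, Fin.sum_univ_two, frobEmb_val, hp]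
  have h1 : symAlg k (frobEmb k p F j (upperUnip t)).val (MvPolynomial.X 1) =
      MvPolynomial.C (algebraMap F k t ^ p ^ j) * MvPolynomial.X 0 + MvPolynomial.X 1 := by
    simp [symAlg, Fin.sum_univ_two, frobEmb_val]
  rw [h0, h1, add_pow, Finset.mul_sum]
  refine Finset.sum_bij' (fun c _ => a + c) (fun b _ => b - a) ?_ ?_ ?_ ?_ ?_
  · intro c hc
    rw [Finset.mem_range] at hc
    rw [Finset.mem_Icc]
    omega
  · intro b hb
    rw [Finset.mem_Icc] at hb
    rw [Finset.mem_range]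
    omega
  · intro c _
    simp
  · intro b hb
    rw [Finset.mem_Icc] at hb
    omega
  · intro c hc
    rw [Finset.mem_range] at hc
    rw [Submodule.coe_smul, mon_val k (by omega), add_tsub_cancel_left, MvPolynomial.smul_eq_C_mul,
      show n - a - c = n - (a + c) by omega, mul_pow, pow_add, map_mul, mul_comm c, pow_mul]
    simp only [map_pow, map_natCast]
    ring

lemma symPow_weyl_mon {n a : ℕ} (ha : a ≤ n) (j : ℕ) :
    symPow k n (frobEmb k p F j weyl) (mon k n a) = mon k n (n - a) := by
  have hp := (Fact.out : p.Prime).ne_zero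
  apply Subtype.ext
  rw [symPow_val, mon_val k ha, mon_val k (Nat.sub_le _ _), map_mul, map_pow, map_pow]
  have h0 : symAlg k (frobEmb k p F j weyl).val (MvPolynomial.X 0) = MvPolynomial.X 1 := by
    simp [symAlg, Fin.sum_univ_two, frobEmb_val, hp]
  have h1 : symAlg k (frobEmb k p F j weyl).val (MvPolynomial.X 1) = MvPolynomial.X 0 := by
    simp [symAlg, Fin.sum_univ_two, frobEmb_val, hp]
  rw [h0, h1, mul_comm, Nat.sub_sub_self ha]

lemma symPow_diag_mon {n a : ℕ} (ha : a ≤ n) (j : ℕ) (x y : Fˣ) :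
    symPow k n (frobEmb k p F j (diag x y)) (mon k n a) =
      (algebraMap F k x ^ (a * p ^ j) * algebraMap F k y ^ ((n - a) * p ^ j)) • mon k n a := by
  have hp := (Fact.out : p.Prime).ne_zero
  apply Subtype.ext
  rw [symPow_val, Submodule.coe_smul, mon_val k ha, map_mul, map_pow, map_pow]
  have h0 : symAlg k (frobEmb k p F j (diag x y)).val (MvPolynomial.X 0) =
      MvPolynomial.C (algebraMap F k x ^ p ^ j) * MvPolynomial.X 0 := by
    simp [symAlg, Fin.sum_univ_two, frobEmb_val, hp]
  have h1 : symAlg k (frobEmb k p F j (diag x y)).val (MvPolynomial.X 1) =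
      MvPolynomial.C (algebraMap F k y ^ p ^ j) * MvPolynomial.X 1 := by
    simp [symAlg, Fin.sum_univ_two, frobEmb_val, hp]
  rw [h0, h1, MvPolynomial.smul_eq_C_mul, mul_pow, mul_pow, map_mul, mul_comm a, mul_comm (n - a),
    pow_mul, pow_mul]
  simp only [map_pow]
  ring

lemma symTensor_tprod (d : Fin f → ℕ) (g : GL (Fin 2) F)
    (P : ∀ j, MvPolynomial.homogeneousSubmodule (Fin 2) k (d j)) :
    symTensor k p F d g (PiTensorProduct.tprod k P) =
      PiTensorProduct.tprod k fun j => symPow k (d j) (frobEmb k p F j g) (P j) :=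
  PiTensorProduct.map_tprod _ _

lemma symTensor_upperUnip_tmon {d A : Fin f → ℕ} (hA : A ≤ d) (t : F) :
    symTensor k p F d (upperUnip t) (tmon k d A) =
      ∑ B ∈ Finset.Icc A d, ((∏ j, ((d j - A j).choose (B j - A j) : k)) *
        algebraMap F k t ^ digitVal p (B - A)) • tmon k d B := by
  rw [tmon, symTensor_tprod]
  simp_rw [fun j => symPow_upperUnip_mon k p F (hA j) j.val t]
  rw [MultilinearMap.map_sum_finset]
  refine Finset.sum_congr rfl fun B _ => ?_
  rw [MultilinearMap.map_smul_univ, Finset.prod_mul_distrib, Finset.prod_pow_eq_pow_sum]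
  rfl

lemma symTensor_weyl_tmon {d A : Fin f → ℕ} (hA : A ≤ d) :
    symTensor k p F d weyl (tmon k d A) = tmon k d (d - A) := by
  rw [tmon, symTensor_tprod]
  simp_rw [fun j => symPow_weyl_mon k p F (hA j) j.val]
  rfl

lemma symTensor_diag_tmon {d A : Fin f → ℕ} (hA : A ≤ d) (x y : Fˣ) :
    symTensor k p F d (diag x y) (tmon k d A) =
      (algebraMap F k x ^ digitVal p A * algebraMap F k y ^ digitVal p (d - A)) • tmon k d A := by
  rw [tmon, symTensor_tprod]
  simp_rw [fun j => symPow_diag_mon k p F (hA j) j.val x y]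
  rw [MultilinearMap.map_smul_univ, Finset.prod_mul_distrib, Finset.prod_pow_eq_pow_sum,
    Finset.prod_pow_eq_pow_sum]
  rfl

variable {k p F}

lemma choose_cast_ne_zero [CharP k p] {n : ℕ} (hn : n < p) {m : ℕ} (hm : m ≤ n) :
    (n.choose m : k) ≠ 0 := by
  rw [Ne, CharP.cast_eq_zero_iff k p]
  intro h
  have h1 : p ∣ n.factorial := by
    rw [← Nat.choose_mul_factorial_mul_factorial hm, mul_assoc]
    exact h.mul_right _
  exact absurd (((Fact.out : p.Prime).dvd_factorial).1 h1) (by omega)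

/-- A quotient of a tensor product of symmetric powers in which the non-zero monomials are those of
a symmetric box has a highest weight. -/
lemma isHW_of_tmon_quotient [Fintype F] (hF : Fintype.card F = p ^ f)
    {V : Type*} [AddCommGroup V] [Module k V] {ρ : Representation k (GL (Fin 2) F) V}
    {d lo hi : Fin f → ℕ} (hd : lo + hi = d) (hle : lo ≤ hi) (hne : lo ≠ hi)
    (hhi : ∀ j, hi j < p) (θ : (symTensor k p F d).IntertwiningMap ρ)
    (hθ : Function.Surjective θ)
    (hzero : ∀ A ≤ d, ¬ (lo ≤ A ∧ A ≤ hi) → θ (tmon k d A) = 0)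
    (hli : LinearIndependent k fun A : Set.Icc lo hi => θ (tmon k d A)) :
    IsHW ρ (digitVal p hi) (digitVal p lo) := by
  have : CharP k p := charP_of_injective_algebraMap (algebraMap F k).injective p
  have hθr : ∀ g x, θ (symTensor k p F d g x) = ρ g (θ x) :=
    fun g x => θ.isIntertwining _ _ g x
  have hhid : hi ≤ d := by rw [← hd]; exact le_add_self
  have hsub : ∀ i, i ≤ hi - lo → lo + i ≤ hi := by
    intro i hi' j
    have h1 : i j ≤ hi j - lo j := hi' j
    have h2 : lo j ≤ hi j := hle j
    change lo j + i j ≤ hi j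
    omega
  -- The box is translated to start at `0`. Since `lo + hi = d`, the binomials `(d - A choose B -
  -- A)` have top `hi - i < p`, so they are non-zero in `k`, and the Weyl element `A ↦ d - A`
  -- exchanges `lo` and `hi`.
  refine isHW_of_box (s := hi - lo) (e := fun i => θ (tmon k d (lo + i)))
    (c := fun i i' => ∏ j, ((hi j - i j).choose (i' j - i j) : k)) hF ?_ ?_ ?_ ?_ ?_ ?_ ?_
    (ε := 1) one_ne_zero ?_ ?_
  · intro j
    exact (Nat.sub_le _ _).trans_lt (hhi j)
  · intro h
    exact hne (le_antisymm hle (tsub_eq_zero_iff_le.1 h))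
  · have h := hli.comp (fun i : Set.Iic (hi - lo) =>
      (⟨lo + i.val, le_self_add, hsub i i.2⟩ : Set.Icc lo hi)) (by
        intro i i' h
        have := congrArg Subtype.val h
        exact Subtype.ext (add_left_cancel this))
    exact h
  · rw [eq_top_iff]
    intro y _
    obtain ⟨x, rfl⟩ := hθ y
    have hx : x ∈ Submodule.span k (tmon k d '' Set.Iic d) := by
      rw [span_tmon]
      trivial
    have hx' : θ x ∈ (Submodule.span k (tmon k d '' Set.Iic d)).map θ.toLinearMap := ⟨x, hx, rfl⟩
    rw [Submodule.map_span] at hx'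
    refine Submodule.span_le.2 ?_ hx'
    rintro _ ⟨_, ⟨A, hA, rfl⟩, rfl⟩
    change θ (tmon k d A) ∈ _
    by_cases h : lo ≤ A ∧ A ≤ hi
    · refine Submodule.subset_span ⟨A - lo, tsub_le_tsub_right h.2 lo, ?_⟩
      simp only [add_tsub_cancel_of_le h.1]
    · rw [hzero A hA h]
      exact zero_mem _
  · intro i i' hii' hi'
    refine Finset.prod_ne_zero_iff.2 fun j _ => choose_cast_ne_zero (p := p) ?_ ?_
    · exact (Nat.sub_le _ _).trans_lt (hhi j)
    · have h1 : i' j ≤ hi j - lo j := hi' j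
      have h2 : i j ≤ i' j := hii' j
      omega
  · intro i
    simp
  · intro t i hi'
    have hA : lo + i ≤ d := (hsub i hi').trans hhid
    rw [← hθr, symTensor_upperUnip_tmon k p F hA, map_sum]
    have hsubset : Finset.Icc (lo + i) hi ⊆ Finset.Icc (lo + i) d :=
      Finset.Icc_subset_Icc le_rfl hhid
    rw [← Finset.sum_subset hsubset]
    · refine Finset.sum_bij' (fun B _ => B - lo) (fun i' _ => lo + i') ?_ ?_ ?_ ?_ ?_
      · intro B hB
        rw [Finset.mem_Icc] at hB ⊢
        exact ⟨le_tsub_of_add_le_left hB.1, tsub_le_tsub_right hB.2 lo⟩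
      · intro i' hi'
        rw [Finset.mem_Icc] at hi' ⊢
        exact ⟨add_le_add_right hi'.1 lo, hsub i' hi'.2⟩
      · intro B hB
        rw [Finset.mem_Icc] at hB
        exact add_tsub_cancel_of_le (le_self_add.trans hB.1)
      · intro i' _
        exact add_tsub_cancel_left lo i'
      · intro B hB
        rw [Finset.mem_Icc] at hB
        have hlB : lo ≤ B := le_self_add.trans hB.1
        rw [map_smul, add_tsub_cancel_of_le hlB, tsub_add_eq_tsub_tsub]
        congr 2
        refine Finset.prod_congr rfl fun j _ => ?_
        have h1 : d j = lo j + hi j := by rw [← hd]; rfl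
        congr 2
        · change d j - (lo j + i j) = hi j - i j
          omega
        · change B j - (lo j + i j) = B j - lo j - i j
          omega
    · intro B hB hB'
      rw [Finset.mem_Icc] at hB hB'
      rw [map_smul, hzero B hB.2, smul_zero]
      rintro ⟨-, h⟩
      exact hB' ⟨hB.1, h⟩
  · simp only [add_tsub_cancel_of_le hle, add_zero, one_smul]
    rw [← hθr, symTensor_weyl_tmon k p F hhid]
    congr 2
    rw [← hd, add_tsub_cancel_right]
  · intro a b
    simp only [add_tsub_cancel_of_le hle]
    have hlo : d - hi = lo := by rw [← hd, add_tsub_cancel_right]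
    rw [← hθr, symTensor_diag_tmon k p F hhid, map_smul, hlo, zpow_natCast, zpow_natCast]

variable (k p F) in
lemma isHW_weight [Fintype F] (hF : Fintype.card F = p ^ f) {r : Fin f → ℕ}
    (hr : ∀ j, r j < p) (hr0 : r ≠ 0) (m : ℤ) :
    IsHW (weight k p F r m).ρ (digitVal p r + m) m := by
  have h : IsHW (V := ⨂[k] j, MvPolynomial.homogeneousSubmodule (Fin 2) k (r j))
      (symTensor k p F r) (digitVal p r) (digitVal p (0 : Fin f → ℕ)) := by
    refine isHW_of_tmon_quotient hF (lo := 0) (hi := r) (zero_add r) (fun _ => Nat.zero_le _)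
      hr0.symm hr (.id _) Function.surjective_id ?_ ?_
    · intro A hA h
      exact absurd ⟨fun _ => Nat.zero_le _, hA⟩ h
    · exact (linearIndependent_tmon k r).comp (fun A : Set.Icc 0 r => ⟨A.val, A.2.2⟩) (by
        intro A B h
        have := congrArg Subtype.val h
        exact Subtype.ext this)
  have := h.twist_det m
  rw [digitVal_zero, Nat.cast_zero, zero_add] at this
  exact this

variable (k p F) in
lemma finrank_weight (r : Fin f → ℕ) (m : ℤ) :
    Module.finrank k (weight k p F r m) = ∏ j, (r j + 1) := by
  refine (Module.finrank_eq_card_basis (tmonBasis k r)).trans ?_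
  rw [Fintype.card_pi]
  simp

end Monomials

/-! ### Monomial functions on `F²` -/

section Functions

variable (k : Type v) [Field k] (p : ℕ) (F : Type u) [Field F] {f : ℕ}

/-- The representation of `GL₂(F)` on functions on row vectors by right translation. -/
def funRep : Representation k (GL (Fin 2) F) ((Fin 2 → F) → k) where
  toFun g := LinearMap.funLeft k k fun w => Matrix.vecMul w g.val
  map_one' := by
    ext φ w
    simp
  map_mul' g h := by
    refine LinearMap.ext fun φ => funext fun w => ?_
    change φ (Matrix.vecMul w (g * h).val) = φ (Matrix.vecMul (Matrix.vecMul w g.val) h.val)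
    rw [Units.val_mul, Matrix.vecMul_vecMul]

lemma funRep_apply (g : GL (Fin 2) F) (φ : (Fin 2 → F) → k) (w : Fin 2 → F) :
    funRep k F g φ w = φ (Matrix.vecMul w g.val) := rfl

variable [Algebra F k]

/-- The function `w ↦ w₀ᵃ w₁ᵇ`. -/
def monFun (a b : ℕ) : (Fin 2 → F) → k :=
  fun w => algebraMap F k (w 0) ^ a * algebraMap F k (w 1) ^ b

/-- Evaluation of polynomials at the `pʲ`-th powers of the coordinates. -/
def evalPow (j n : ℕ) : MvPolynomial.homogeneousSubmodule (Fin 2) k n →ₗ[k] ((Fin 2 → F) → k) :=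
  (LinearMap.pi fun w =>
    (MvPolynomial.aeval fun i => algebraMap F k (w i) ^ p ^ j).toLinearMap).comp
    (Submodule.subtype _)

lemma evalPow_apply (j n : ℕ) (P : MvPolynomial.homogeneousSubmodule (Fin 2) k n) (w : Fin 2 → F) :
    evalPow k p F j n P w = MvPolynomial.aeval (fun i => algebraMap F k (w i) ^ p ^ j) P.val := rfl

/-- The map sending a pure tensor of polynomials `P_j` to `w ↦ ∏_j P_j(Φʲ w)`. -/
def prodEval (d : Fin f → ℕ) :
    (⨂[k] j, MvPolynomial.homogeneousSubmodule (Fin 2) k (d j)) →ₗ[k] ((Fin 2 → F) → k) :=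
  PiTensorProduct.lift ((MultilinearMap.mkPiAlgebra k (Fin f) ((Fin 2 → F) → k)).compLinearMap
    fun j => evalPow k p F j.val (d j))

lemma prodEval_tprod (d : Fin f → ℕ)
    (P : ∀ j, MvPolynomial.homogeneousSubmodule (Fin 2) k (d j)) :
    prodEval k p F d (PiTensorProduct.tprod k P) =
      ∏ j : Fin f, evalPow k p F j.val (d j) (P j) := by
  rw [prodEval, PiTensorProduct.lift.tprod]
  rfl

lemma prodEval_tmon {d A : Fin f → ℕ} (hA : A ≤ d) :
    prodEval k p F d (tmon k d A) = monFun k F (digitVal p A) (digitVal p (d - A)) := by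
  rw [tmon, prodEval_tprod]
  funext w
  rw [Finset.prod_apply, monFun, digitVal, digitVal, ← Finset.prod_pow_eq_pow_sum,
    ← Finset.prod_pow_eq_pow_sum, ← Finset.prod_mul_distrib]
  refine Finset.prod_congr rfl fun j _ => ?_
  rw [evalPow_apply, mon_val k (hA j), map_mul, map_pow, map_pow, MvPolynomial.aeval_X,
    MvPolynomial.aeval_X, ← pow_mul, ← pow_mul, mul_comm (p ^ _), mul_comm (p ^ _)]
  rfl

/-- Coefficient extraction is applied to one variable at a time. -/
lemma linearIndependent_monFun [Fintype F] : LinearIndependent k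
    fun x : Fin (Fintype.card F) × Fin (Fintype.card F) => monFun k F x.1.val x.2.val := by
  rw [Fintype.linearIndependent_iff]
  rintro g hg ⟨a, b⟩
  rw [Fintype.sum_prod_type] at hg
  have h1 : ∀ a, (fun y : F => ∑ b, g (a, b) * algebraMap F k y ^ b.val) ∈
      (⊥ : Submodule k (F → k)) := by
    intro a
    refine mem_of_forall_sum_pow_smul_mem (F := F) (k := k) (V := F → k) Finset.univ
      (fun a : Fin (Fintype.card F) => a.val) (fun a _ => a.2) (fun a _ b _ h => Fin.ext h)
      (fun a y => ∑ b, g (a, b) * algebraMap F k y ^ b.val) ⊥ (fun t => ?_) a (Finset.mem_univ a)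
    rw [Submodule.mem_bot]
    funext y
    have := congrFun hg ![t, y]
    simp only [Finset.sum_apply, Pi.smul_apply, monFun, smul_eq_mul, Pi.zero_apply,
      Matrix.cons_val_zero, Matrix.cons_val_one] at this ⊢
    rw [← this]
    refine Finset.sum_congr rfl fun a _ => ?_
    rw [Finset.mul_sum]
    refine Finset.sum_congr rfl fun b _ => ?_
    ring
  have h2 : g (a, b) ∈ (⊥ : Submodule k k) := by
    refine mem_of_forall_sum_pow_smul_mem (F := F) Finset.univ
      (fun b : Fin (Fintype.card F) => b.val) (fun b _ => b.2) (fun a _ b _ h => Fin.ext h)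
      (fun b => g (a, b)) ⊥ (fun t => ?_) b (Finset.mem_univ b)
    have := congrFun ((Submodule.mem_bot k).1 (h1 a)) t
    rw [Submodule.mem_bot]
    simp only [Pi.zero_apply] at this
    rw [← this]
    refine Finset.sum_congr rfl fun b _ => ?_
    rw [smul_eq_mul, mul_comm]
  exact (Submodule.mem_bot k).1 h2

/-- The functions on `F²` given by tensors of polynomials of degrees `d`. -/
def evalSub (d : Fin f → ℕ) : Submodule k ((Fin 2 → F) → k) := LinearMap.range (prodEval k p F d)

lemma evalSub_eq_span (d : Fin f → ℕ) : evalSub k p F d =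
    Submodule.span k ((fun A => monFun k F (digitVal p A) (digitVal p (d - A))) '' Set.Iic d) := by
  rw [evalSub, LinearMap.range_eq_map, ← span_tmon, Submodule.map_span, ← Set.image_comp]
  congr 1
  exact Set.image_congr fun A hA => prodEval_tmon k p F hA

/-- This form is symmetric in the two exponents and free of subtraction, as suits carrying digits.
-/
lemma evalSub_eq_span_pairs (d : Fin f → ℕ) : evalSub k p F d =
    Submodule.span k {φ | ∃ A B : Fin f → ℕ, A + B = d ∧
      φ = monFun k F (digitVal p A) (digitVal p B)} := by
  rw [evalSub_eq_span]
  congr 1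
  ext φ
  constructor
  · rintro ⟨A, hA, rfl⟩
    exact ⟨A, d - A, add_tsub_cancel_of_le hA, rfl⟩
  · rintro ⟨A, B, rfl, rfl⟩
    refine ⟨A, Set.mem_Iic.2 le_self_add, ?_⟩
    simp only [add_tsub_cancel_left]

variable [Fact p.Prime] [CharP F p]

/-- Additivity of the Frobenius: the `pʲ`-th powers of the coordinates of `w g` are obtained
linearly, through `Φʲ g`, from those of `w`. -/
lemma evalPow_symPow (j n : ℕ) (g : GL (Fin 2) F)
    (P : MvPolynomial.homogeneousSubmodule (Fin 2) k n) :
    evalPow k p F j n (symPow k n (frobEmb k p F j g) P) = funRep k F g (evalPow k p F j n P) := by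
  funext w
  rw [funRep_apply, evalPow_apply, evalPow_apply, symPow_val]
  have : (MvPolynomial.aeval fun i => algebraMap F k (w i) ^ p ^ j).comp
      (symAlg k (frobEmb k p F j g).val) =
      MvPolynomial.aeval fun i => algebraMap F k (Matrix.vecMul w g.val i) ^ p ^ j := by
    apply MvPolynomial.algHom_ext
    intro i
    have : CharP k p := charP_of_injective_algebraMap (algebraMap F k).injective p
    simp only [symAlg, AlgHom.comp_apply, MvPolynomial.aeval_X, map_mul, frobEmb_val,
      Matrix.vecMul, dotProduct, MvPolynomial.algHom_C, Fin.sum_univ_two, map_add,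
      add_pow_char_pow, mul_pow, Algebra.algebraMap_self, RingHom.id_apply]
    ring
  exact AlgHom.congr_fun this P.val

/-- `prodEval` as an intertwining map. -/
def prodEvalMap (d : Fin f → ℕ) : (symTensor k p F d).IntertwiningMap (funRep k F) where
  toLinearMap := prodEval k p F d
  isIntertwining' g := by
    apply PiTensorProduct.ext
    apply MultilinearMap.ext
    intro P
    simp only [LinearMap.compMultilinearMap_apply, LinearMap.comp_apply]
    rw [symTensor_tprod, prodEval_tprod, prodEval_tprod]
    funext w
    rw [funRep_apply, Finset.prod_apply, Finset.prod_apply]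
    refine Finset.prod_congr rfl fun j _ => ?_
    rw [evalPow_symPow, funRep_apply]

lemma funRep_mem_evalSub (d : Fin f → ℕ) (g : GL (Fin 2) F) :
    evalSub k p F d ≤ (evalSub k p F d).comap (funRep k F g) := by
  rintro _ ⟨x, rfl⟩
  exact ⟨symTensor k p F d g x, LinearMap.congr_fun ((prodEvalMap k p F d).isIntertwining' g) x⟩

end Functions

/-! ### Change of universe, twists and transposes. -/

section Shrink

variable {k : Type v} [Field k] {G : Type*} [Group G] {V W : Type*} [AddCommGroup V] [Module k V]
  [AddCommGroup W] [Module k W]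

/-- A finite-dimensional representation is isomorphic to one in the universe of the field. -/
lemma exists_rep_equiv [FiniteDimensional k V] (ρ : Representation k G V) :
    ∃ E : Rep.{v} k G, FiniteDimensional k E ∧ Nonempty (ρ.Equiv E.ρ) := by
  let e := (Module.finBasis k V).equivFun
  let ρ' : Representation k G (Fin (Module.finrank k V) → k) :=
    { toFun := fun g => e.conj (ρ g)
      map_one' := by simp [Module.End.one_eq_id]
      map_mul' := fun g h => by
        refine LinearMap.ext fun x => ?_
        simp [LinearEquiv.conj_apply_apply] }
  refine ⟨Rep.of ρ', inferInstanceAs (FiniteDimensional k (Fin (Module.finrank k V) → k)),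
    ⟨Representation.Equiv.mk e fun g => ?_⟩⟩
  refine LinearMap.ext fun x => ?_
  change e (ρ g x) = e.conj (ρ g) (e x)
  rw [LinearEquiv.conj_apply_apply, LinearEquiv.symm_apply_apply]

/-- Twisting an intertwining map by a character. -/
def twistMap {ρ : Representation k G V} {σ : Representation k G W} (φ : ρ.IntertwiningMap σ)
    (χ : G →* kˣ) : (twist ρ χ).IntertwiningMap (twist σ χ) where
  toLinearMap := φ.toLinearMap
  isIntertwining' g := by
    refine LinearMap.ext fun x => ?_
    change φ (twist ρ χ g x) = twist σ χ g (φ x)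
    rw [twist_apply, twist_apply, map_smul, φ.isIntertwining]

/-- The transpose of an intertwining map. -/
def dualMap {ρ : Representation k G V} {σ : Representation k G W} (φ : ρ.IntertwiningMap σ) :
    σ.dual.IntertwiningMap ρ.dual where
  toLinearMap := φ.toLinearMap.dualMap
  isIntertwining' g := by
    refine LinearMap.ext fun l => LinearMap.ext fun x => ?_
    change l (σ g⁻¹ (φ x)) = l (φ (ρ g⁻¹ x))
    rw [φ.isIntertwining]

lemma span_orbit_twist {ρ : Representation k G V} (χ : G →* kˣ) {v : V}
    (h : Submodule.span k (Set.range fun g => ρ g v) = ⊤) :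
    Submodule.span k (Set.range fun g => twist ρ χ g v) = ⊤ := by
  rw [eq_top_iff, ← h, Submodule.span_le]
  rintro _ ⟨g, rfl⟩
  have := Submodule.smul_mem (Submodule.span k (Set.range fun g => twist ρ χ g v))
    (((χ g)⁻¹ : kˣ) : k) (Submodule.subset_span ⟨g, rfl⟩)
  simp only [twist_apply] at this ⊢
  rwa [smul_smul, Units.inv_mul, one_smul] at this

end Shrink

/-! ### Construction of the extensions -/

section Step

/-! ### Carrying between neighbouring digits. -/

section Carry

variable {k : Type v} [Field k] {p : ℕ} {F : Type u} [Field F] [Algebra F k] {f : ℕ}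

lemma digitVal_single (p : ℕ) (j : Fin f) (a : ℕ) : digitVal p (Pi.single j a) = a * p ^ j.val := by
  rw [digitVal, Finset.sum_eq_single_of_mem j (Finset.mem_univ j)]
  · simp
  · intro i _ hi
    simp [hi]

/-- The hypothesis `hj` is stated for powers in `F`, so that it also covers the carry from the last
digit to digit `0`. -/
lemma pow_digitVal_carry {j₀ j₁ : Fin f} (hj : ∀ x : F, x ^ p ^ j₁.val = x ^ (p * p ^ j₀.val))
    (A : Fin f → ℕ) (x : F) : algebraMap F k x ^ digitVal p (A + Pi.single j₀ p) =
      algebraMap F k x ^ digitVal p (A + Pi.single j₁ 1) := by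
  rw [digitVal_add, digitVal_add, digitVal_single, digitVal_single, pow_add, pow_add, one_mul,
    ← map_pow, ← map_pow, ← map_pow, hj]

variable {j₀ j₁ : Fin f} {y dh : Fin f → ℕ}

/-- The functions of degrees `y` are functions of degrees `dh`, if `dh` arises from `y` by
borrowing. -/
lemma evalSub_le_of_carry (hj : ∀ x : F, x ^ p ^ j₁.val = x ^ (p * p ^ j₀.val))
    (hdh : dh + Pi.single j₁ 1 = y + Pi.single j₀ p) (hy1 : 1 ≤ y j₁) :
    evalSub k p F y ≤ evalSub k p F dh := by
  rw [evalSub_eq_span_pairs, evalSub_eq_span_pairs, Submodule.span_le]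
  rintro _ ⟨A, B, hAB, rfl⟩
  have hsub : ∀ A : Fin f → ℕ, 1 ≤ A j₁ → ∃ A' : Fin f → ℕ, A = A' + Pi.single j₁ 1 := by
    intro A hA
    refine ⟨A - Pi.single j₁ 1, (tsub_add_cancel_of_le fun j => ?_).symm⟩
    by_cases h : j = j₁
    · subst h
      simpa using hA
    · simp [h]
  -- One of the two exponents has a unit at `j₁`, which is exchanged for `p` units at `j₀`.
  have h1 : 1 ≤ A j₁ ∨ 1 ≤ B j₁ := by
    have : A j₁ + B j₁ = y j₁ := congrFun hAB j₁
    omega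
  apply Submodule.subset_span
  rcases h1 with h | h
  · obtain ⟨A', rfl⟩ := hsub A h
    refine ⟨A' + Pi.single j₀ p, B, ?_, ?_⟩
    · apply add_right_cancel (b := Pi.single j₁ 1)
      rw [hdh, ← hAB]
      abel
    · funext w
      rw [monFun, monFun, pow_digitVal_carry hj]
  · obtain ⟨B', rfl⟩ := hsub B h
    refine ⟨A, B' + Pi.single j₀ p, ?_, ?_⟩
    · apply add_right_cancel (b := Pi.single j₁ 1)
      rw [hdh, ← hAB]
      abel
    · funext w
      rw [monFun, monFun, pow_digitVal_carry hj]

/-- The reverse exchange: a monomial dies in the quotient as soon as one of its digits at `j₀`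
reaches `p`. -/
lemma monFun_mem_evalSub_of_carry (hj : ∀ x : F, x ^ p ^ j₁.val = x ^ (p * p ^ j₀.val))
    (hdh : dh + Pi.single j₁ 1 = y + Pi.single j₀ p) {A B : Fin f → ℕ} (hAB : A + B = dh)
    (h : p ≤ A j₀ ∨ p ≤ B j₀) :
    monFun k F (digitVal p A) (digitVal p B) ∈ evalSub k p F y := by
  rw [evalSub_eq_span_pairs]
  apply Submodule.subset_span
  have hsub : ∀ A : Fin f → ℕ, p ≤ A j₀ → ∃ A' : Fin f → ℕ, A = A' + Pi.single j₀ p := by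
    intro A hA
    refine ⟨A - Pi.single j₀ p, (tsub_add_cancel_of_le fun j => ?_).symm⟩
    by_cases h : j = j₀
    · subst h
      simpa using hA
    · simp [h]
  rcases h with h | h
  · obtain ⟨A', rfl⟩ := hsub A h
    refine ⟨A' + Pi.single j₁ 1, B, ?_, ?_⟩
    · apply add_right_cancel (b := Pi.single j₀ p)
      rw [← hdh, ← hAB]
      abel
    · funext w
      rw [monFun, monFun, pow_digitVal_carry hj]
  · obtain ⟨B', rfl⟩ := hsub B h
    refine ⟨A, B' + Pi.single j₁ 1, ?_, ?_⟩
    · apply add_right_cancel (b := Pi.single j₀ p)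
      rw [← hdh, ← hAB]
      abel
    · funext w
      rw [monFun, monFun, pow_digitVal_carry hj]

end Carry

variable {k : Type v} [Field k] {p : ℕ} [Fact p.Prime] {F : Type u} [Field F]
  [CharP F p] [Algebra F k] {f : ℕ}

variable {y : Fin f → ℕ}

variable (k p F) in
/-- The representation on functions of degrees `d`. -/
def evalRep (d : Fin f → ℕ) : Representation k (GL (Fin 2) F) (evalSub k p F d) :=
  (funRep k F).subrepresentation _ (funRep_mem_evalSub k p F d)

variable (k p F) in
/-- The surjection of the tensor product of symmetric powers on its functions. -/
def toEvalRep (d : Fin f → ℕ) : (symTensor k p F d).IntertwiningMap (evalRep k p F d) where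
  toLinearMap := (prodEval k p F d).rangeRestrict
  isIntertwining' g := by
    refine LinearMap.ext fun x => Subtype.ext ?_
    exact LinearMap.congr_fun ((prodEvalMap k p F d).isIntertwining' g) x

/-- With digits below `p`, distinct monomials are independent as functions, so nothing is lost from
the tensor product. -/
lemma isHW_evalRep [Fintype F] (hF : Fintype.card F = p ^ f) (hy : ∀ j, y j < p) (hy0 : y ≠ 0) :
    IsHW (evalRep k p F y) (digitVal p y) 0 := by
  have h : IsHW (evalRep k p F y) (digitVal p y) (digitVal p (0 : Fin f → ℕ)) := by
    refine isHW_of_tmon_quotient hF (lo := 0) (hi := y) (zero_add y) (fun _ => Nat.zero_le _)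
      hy0.symm hy (toEvalRep k p F y) (prodEval k p F y).surjective_rangeRestrict ?_ ?_
    · intro A hA h
      exact absurd ⟨fun _ => Nat.zero_le _, hA⟩ h
    · apply LinearIndependent.of_comp (Submodule.subtype _)
      have h := (linearIndependent_monFun k F).comp (fun A : Set.Icc 0 y =>
        ((⟨digitVal p A.val, by
            rw [hF]
            exact digitVal_lt fun j => (A.2.2 j).trans_lt (hy j)⟩,
          ⟨digitVal p (y - A.val), by
            rw [hF]
            exact digitVal_lt fun j => (Nat.sub_le _ _).trans_lt (hy j)⟩) :
          Fin (Fintype.card F) × Fin (Fintype.card F))) (by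
        intro A B hAB
        have := congrArg (fun x => x.1.val) hAB
        exact Subtype.ext (digitVal_inj (fun j => (A.2.2 j).trans_lt (hy j))
          (fun j => (B.2.2 j).trans_lt (hy j)) this))
      convert h using 1
      funext A
      exact prodEval_tmon k p F A.2.2
  rwa [digitVal_zero, Nat.cast_zero] at h

end Step

/-! ### Values of the functions at points of the plane. -/

section Points

variable {k : Type v} [Field k] {p : ℕ} {F : Type u} [Field F]

lemma vecMul_transitive (w : Fin 2 → F) (hw : w ≠ 0) :
    ∃ g : GL (Fin 2) F, Matrix.vecMul ![0, 1] g.val = w := by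
  by_cases h0 : w 0 = 0
  · have h1 : w 1 ≠ 0 := by
      intro h1
      apply hw
      funext i
      fin_cases i
      · exact h0
      · exact h1
    refine ⟨Matrix.GeneralLinearGroup.mkOfDetNeZero !![1, 0; w 0, w 1] (by simpa using h1), ?_⟩
    funext i
    fin_cases i <;> simp [Matrix.GeneralLinearGroup.mkOfDetNeZero, Matrix.vecMul]
  · refine ⟨Matrix.GeneralLinearGroup.mkOfDetNeZero !![0, 1; w 0, w 1] (by simpa using h0), ?_⟩
    funext i
    fin_cases i <;> simp [Matrix.GeneralLinearGroup.mkOfDetNeZero, Matrix.vecMul]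

variable [Algebra F k] {f : ℕ} {dh : Fin f → ℕ}

lemma evalSub_apply_smul (φ : (Fin 2 → F) → k) (hφ : φ ∈ evalSub k p F dh) (c : F)
    (w : Fin 2 → F) : φ (c • w) = algebraMap F k c ^ digitVal p dh * φ w := by
  rw [evalSub_eq_span_pairs] at hφ
  induction hφ using Submodule.span_induction with
  | mem φ h =>
    obtain ⟨A, B, rfl, rfl⟩ := h
    simp only [monFun, Pi.smul_apply, smul_eq_mul, map_mul, mul_pow, digitVal_add, pow_add]
    ring
  | zero => simp
  | add φ ψ _ _ h1 h2 => rw [Pi.add_apply, Pi.add_apply, h1, h2, mul_add]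
  | smul c φ _ h => rw [Pi.smul_apply, Pi.smul_apply, h, smul_eq_mul, smul_eq_mul, mul_left_comm]

lemma evalSub_apply_zero [Fact p.Prime] (hd : dh ≠ 0) (φ : (Fin 2 → F) → k)
    (hφ : φ ∈ evalSub k p F dh) :
    φ 0 = 0 := by
  have hp := (Fact.out : p.Prime).pos
  have hpos : ∀ A : Fin f → ℕ, A ≠ 0 → digitVal p A ≠ 0 := by
    intro A hA h
    apply hA
    funext j
    rw [digitVal, Finset.sum_eq_zero_iff] at h
    exact (mul_eq_zero.1 (h j (Finset.mem_univ j))).resolve_right (pow_pos hp _).ne'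
  rw [evalSub_eq_span_pairs] at hφ
  induction hφ using Submodule.span_induction with
  | mem φ h =>
    obtain ⟨A, B, hAB, rfl⟩ := h
    by_cases hA : A = 0
    · have hB : B ≠ 0 := by
        rintro rfl
        exact hd (by rw [← hAB, hA, add_zero])
      simp [monFun, hpos B hB]
    · simp [monFun, hpos A hA]
  | zero => rfl
  | add φ ψ _ _ h1 h2 => rw [Pi.add_apply, h1, h2, add_zero]
  | smul c φ _ h => rw [Pi.smul_apply, h, smul_zero]

end Points

/-! ### The extension as the dual of a space of functions. -/

section Borrow

variable {k : Type v} [Field k] {p : ℕ} [Fact p.Prime] {F : Type u} [Field F]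
  [CharP F p] [Algebra F k] {f : ℕ} {j₀ j₁ : Fin f} {y dh lo hi : Fin f → ℕ}

lemma evalRep_comap_stable (y dh : Fin f → ℕ) (g : GL (Fin 2) F) :
    (evalSub k p F y).comap (evalSub k p F dh).subtype ≤
      ((evalSub k p F y).comap (evalSub k p F dh).subtype).comap (evalRep k p F dh g) :=
  fun _ hx => funRep_mem_evalSub k p F y g hx

variable (k p F) in
/-- The quotient of the functions of degrees `dh` by those of degrees `y`. -/
def evalQuot (dh y : Fin f → ℕ) : Representation k (GL (Fin 2) F)
    (evalSub k p F dh ⧸ (evalSub k p F y).comap (evalSub k p F dh).subtype) :=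
  (evalRep k p F dh).quotient _ (evalRep_comap_stable y dh)

variable (k p F) in
/-- The projection to the quotient. -/
def toEvalQuot (dh y : Fin f → ℕ) :
    (evalRep k p F dh).IntertwiningMap (evalQuot k p F dh y) where
  toLinearMap := Submodule.mkQ _
  isIntertwining' _ := rfl

variable (k p F) in
/-- Evaluation at the row vector `(0, 1)`. -/
def evalPoint (d : Fin f → ℕ) : Module.Dual k (evalSub k p F d) :=
  (LinearMap.proj ![0, 1]).comp (Submodule.subtype _)

lemma dual_evalPoint_apply (d : Fin f → ℕ) (g : GL (Fin 2) F) (φ : evalSub k p F d) :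
    (evalRep k p F d).dual g (evalPoint k p F d) φ =
      φ.val (Matrix.vecMul ![0, 1] (g⁻¹ : GL (Fin 2) F).val) := rfl

variable [Fintype F]

/-- Away from `j₀` the box imposes no condition, since `lo` vanishes there. At `j₀`, a monomial
outside the box has a digit at least `p` and carries into `evalSub y`. The monomials inside stay
independent modulo `evalSub y`. -/
lemma isHW_evalQuot (hF : Fintype.card F = p ^ f)
    (hj : ∀ x : F, x ^ p ^ j₁.val = x ^ (p * p ^ j₀.val))
    (hdh : dh + Pi.single j₁ 1 = y + Pi.single j₀ p) (hy : ∀ j, y j < p)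
    (hsum : lo + hi = dh) (hlo : ∀ j, j ≠ j₀ → lo j = 0) (hhi : hi j₀ = p - 1)
    (hle : lo ≤ hi) (hne : lo ≠ hi) (hdy : dh ≠ y) :
    IsHW (evalQuot k p F dh y) (digitVal p hi) (digitVal p lo) := by
  have hp := (Fact.out : p.Prime).two_le
  have hhi' : ∀ j, hi j < p := by
    intro j
    by_cases h : j = j₀
    · rw [h, hhi]
      omega
    · have h1 : lo j + hi j = dh j := congrFun hsum j
      have h2 := congrFun hdh j
      simp only [Pi.add_apply, Pi.single_eq_of_ne h] at h2
      have := hy j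
      omega
  have hlohi : ∀ A : Fin f → ℕ, lo ≤ A → ∀ j, (dh - A) j < p := by
    intro A hA j
    have h1 : lo j + hi j = dh j := congrFun hsum j
    have h2 : lo j ≤ A j := hA j
    have h3 := hhi' j
    change dh j - A j < p
    omega
  have hdhi : hi ≤ dh := by rw [← hsum]; exact le_add_self
  let q : Submodule k (evalSub k p F dh) := (evalSub k p F y).comap (evalSub k p F dh).subtype
  refine isHW_of_tmon_quotient hF hsum hle hne hhi'
    ((toEvalQuot k p F dh y).comp (toEvalRep k p F dh)) ?_ ?_ ?_
  · exact (Submodule.mkQ_surjective _).comp (prodEval k p F dh).surjective_rangeRestrict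
  · intro A hA h
    change Submodule.Quotient.mk (toEvalRep k p F dh (tmon k dh A)) = 0
    rw [Submodule.Quotient.mk_eq_zero]
    change prodEval k p F dh (tmon k dh A) ∈ evalSub k p F y
    rw [prodEval_tmon k p F hA]
    refine monFun_mem_evalSub_of_carry hj hdh (add_tsub_cancel_of_le hA) ?_
    have h1 : lo j₀ + hi j₀ = dh j₀ := congrFun hsum j₀
    have h2 : A j₀ ≤ dh j₀ := hA j₀
    by_contra hcon
    rw [not_or] at hcon
    have h3 : ¬ p ≤ dh j₀ - A j₀ := hcon.2
    apply h
    constructor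
    · intro j
      by_cases hjj : j = j₀
      · rw [hjj]
        change lo j₀ ≤ A j₀
        omega
      · rw [hlo j hjj]
        exact Nat.zero_le _
    · intro j
      by_cases hjj : j = j₀
      · rw [hjj]
        change A j₀ ≤ hi j₀
        omega
      · have h4 : lo j + hi j = dh j := congrFun hsum j
        have h5 : A j ≤ dh j := hA j
        rw [hlo j hjj] at h4
        change A j ≤ hi j
        omega
  · have hpair : ∀ a b : Fin f → ℕ, (∀ j, a j < p) → (∀ j, b j < p) →
        digitVal p a < Fintype.card F ∧ digitVal p b < Fintype.card F := by
      intro a b ha hb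
      rw [hF]
      exact ⟨digitVal_lt ha, digitVal_lt hb⟩
    -- The box monomials and those spanning `evalSub y` are treated together: their exponent pairs
    -- have digits below `p`, and the two kinds differ since their digit sums are `dh` and `y`.
    let ι : Type := Set.Icc lo hi ⊕ Set.Iic y
    let pr : ι → (Fin f → ℕ) × (Fin f → ℕ) :=
      Sum.elim (fun A => (A.val, dh - A.val)) (fun A => (A.val, y - A.val))
    have hprlt : ∀ x, (∀ j, (pr x).1 j < p) ∧ ∀ j, (pr x).2 j < p := by
      rintro (A | A)
      · exact ⟨fun j => (A.2.2 j).trans_lt (hhi' j), hlohi A.val A.2.1⟩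
      · exact ⟨fun j => (A.2 j).trans_lt (hy j), fun j => (Nat.sub_le _ _).trans_lt (hy j)⟩
    have hprsum : ∀ x, (pr x).1 + (pr x).2 = Sum.elim (fun _ => dh) (fun _ => y) x := by
      rintro (A | A)
      · exact add_tsub_cancel_of_le (A.2.2.trans hdhi)
      · exact add_tsub_cancel_of_le A.2
    have hprinj : Function.Injective pr := by
      intro x x' h
      have hs := hprsum x
      rw [h, hprsum x'] at hs
      rcases x with A | A <;> rcases x' with B | B
      · rw [Subtype.ext (congrArg Prod.fst h : A.val = B.val)]
      · exact absurd hs.symm hdy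
      · exact absurd hs hdy
      · rw [Subtype.ext (congrArg Prod.fst h : A.val = B.val)]
    have hall : LinearIndependent k fun x : ι =>
        monFun k F (digitVal p (pr x).1) (digitVal p (pr x).2) := by
      refine (linearIndependent_monFun k F).comp (fun x : ι =>
        ((⟨digitVal p (pr x).1, (hpair _ _ (hprlt x).1 (hprlt x).2).1⟩,
          ⟨digitVal p (pr x).2, (hpair _ _ (hprlt x).1 (hprlt x).2).2⟩) :
          Fin (Fintype.card F) × Fin (Fintype.card F))) ?_
      intro x x' h
      apply hprinj
      have h1 := congrArg (fun z => z.1.val) h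
      have h2 := congrArg (fun z => z.2.val) h
      exact Prod.ext (digitVal_inj (hprlt x).1 (hprlt x').1 h1)
        (digitVal_inj (hprlt x).2 (hprlt x').2 h2)
    have hsplit := linearIndependent_sum.1 hall
    have hS : LinearIndependent k fun A : Set.Icc lo hi => toEvalRep k p F dh (tmon k dh A) := by
      apply LinearIndependent.of_comp (Submodule.subtype _)
      have heq : ((fun x : ι => monFun k F (digitVal p (pr x).1) (digitVal p (pr x).2)) ∘
          Sum.inl) = (Submodule.subtype _) ∘
            fun A : Set.Icc lo hi => toEvalRep k p F dh (tmon k dh A) :=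
        funext fun A => (prodEval_tmon k p F (A.2.2.trans hdhi)).symm
      rw [← heq]
      exact hsplit.1
    refine hS.map (f := Submodule.mkQ q) ?_
    rw [Submodule.ker_mkQ, Submodule.disjoint_def]
    intro x hx hxq
    have hx1 : x.val ∈ Submodule.span k (Set.range ((fun x : ι =>
        monFun k F (digitVal p (pr x).1) (digitVal p (pr x).2)) ∘ Sum.inl)) := by
      have : x.val ∈ (Submodule.span k (Set.range fun A : Set.Icc lo hi =>
          toEvalRep k p F dh (tmon k dh A))).map (Submodule.subtype _) := ⟨x, hx, rfl⟩
      rw [Submodule.map_span, ← Set.range_comp] at this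
      convert this using 3
      funext A
      exact (prodEval_tmon k p F (A.2.2.trans hdhi)).symm
    have hx2 : x.val ∈ Submodule.span k (Set.range ((fun x : ι =>
        monFun k F (digitVal p (pr x).1) (digitVal p (pr x).2)) ∘ Sum.inr)) := by
      have : x.val ∈ evalSub k p F y := hxq
      rw [evalSub_eq_span] at this
      convert this using 2
      ext φ
      constructor
      · rintro ⟨A, rfl⟩
        exact ⟨A.val, A.2, rfl⟩
      · rintro ⟨A, hA, rfl⟩
        exact ⟨⟨A, hA⟩, rfl⟩
    exact Subtype.ext (Submodule.disjoint_def.1 hsplit.2.2 x.val hx1 hx2)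

/-- The translates are the evaluations at all non-zero vectors. A function killed by them is zero,
as it also vanishes at the origin. -/
lemma span_orbit_evalPoint (hd : dh ≠ 0) : Submodule.span k
    (Set.range fun g => (evalRep k p F dh).dual g (evalPoint k p F dh)) = ⊤ := by
  rw [← Subspace.dualCoannihilator_dualAnnihilator_eq (W := Submodule.span k _)]
  have : (Submodule.span k (Set.range fun g =>
      (evalRep k p F dh).dual g (evalPoint k p F dh))).dualCoannihilator = ⊥ := by
    rw [eq_bot_iff]
    intro φ hφ
    rw [Submodule.mem_dualCoannihilator] at hφ
    rw [Submodule.mem_bot]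
    apply Subtype.ext
    funext w
    by_cases hw : w = 0
    · rw [hw]
      exact evalSub_apply_zero hd φ.val φ.2
    · obtain ⟨g, rfl⟩ := vecMul_transitive w hw
      have := hφ _ (Submodule.subset_span ⟨g⁻¹, rfl⟩)
      rwa [dual_evalPoint_apply, inv_inv] at this
  rw [this, Submodule.dualAnnihilator_bot]

/-- The non-split extensions of weights, constructed as duals of spaces of functions on `F²`. -/
lemma exists_extension (hF : Fintype.card F = p ^ f)
    (hj : ∀ x : F, x ^ p ^ j₁.val = x ^ (p * p ^ j₀.val))
    (hdh : dh + Pi.single j₁ 1 = y + Pi.single j₀ p) (hy : ∀ j, y j < p) (hy1 : 1 ≤ y j₁)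
    (hsum : lo + hi = dh) (hlo : ∀ j, j ≠ j₀ → lo j = 0) (hhi : hi j₀ = p - 1)
    (hle : lo ≤ hi) (hne : lo ≠ hi) (hdy : dh ≠ y) (M : ℤ) {σ τ : Rep.{v} k (GL (Fin 2) F)}
    {a b c : ℤ} (ha : a = M - digitVal p lo) (hb : b = M - digitVal p hi)
    (hc : c = M - digitVal p y)
    (hσ : IsHW σ.ρ a b) (hτ : IsHW τ.ρ M c)
    (hχ : torusChar (F := F) k a b ≠ torusChar k M c) :
    ∃ E : Rep.{v} k (GL (Fin 2) F), FiniteDimensional k E ∧ IsNonsplitExtension σ E τ ∧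
      Nonempty ((unipInvariants E).Equiv
        ((charRep (torusChar k a b)).prod (charRep (torusChar k M c)))) := by
  have hp := (Fact.out : p.Prime).two_le
  have hy0 : y ≠ 0 := by
    rintro rfl
    exact absurd hy1 (by simp)
  have hd0 : dh ≠ 0 := by
    intro h
    have h1 : lo j₀ + hi j₀ = dh j₀ := congrFun hsum j₀
    rw [h, hhi] at h1
    simp only [Pi.zero_apply] at h1
    omega
  have hsub : evalSub k p F y ≤ evalSub k p F dh := evalSub_le_of_carry hj hdh hy1
  let χ := detChar k F ^ M
  let inc : (evalRep k p F y).IntertwiningMap (evalRep k p F dh) :=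
    ⟨Submodule.inclusion hsub, fun g => rfl⟩
  let K := twist (evalQuot k p F dh y).dual χ
  let T := twist (evalRep k p F y).dual χ
  let E₀ := twist (evalRep k p F dh).dual χ
  have hK : IsHW K a b := by
    have := (isHW_evalQuot (k := k) hF hj hdh hy hsum hlo hhi hle hne hdy).dual.twist_det M
    rw [ha, hb, sub_eq_neg_add, sub_eq_neg_add]
    exact this
  have hT : IsHW T M c := by
    have := (isHW_evalRep (k := k) hF hy hy0).dual.twist_det M
    rw [neg_zero, zero_add] at this
    rw [hc, sub_eq_neg_add]
    exact this
  obtain ⟨E, hE, ⟨e⟩⟩ := exists_rep_equiv E₀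
  obtain ⟨eσ⟩ := hσ.nonempty_equiv hK
  obtain ⟨eτ⟩ := hT.nonempty_equiv hτ
  -- Dualising turns the quotient of functions into the subrepresentation and the subspace `evalSub
  -- y` into the quotient.
  let i₀ : K.IntertwiningMap E₀ := twistMap (dualMap (toEvalQuot k p F dh y)) χ
  let q₀ : E₀.IntertwiningMap T := twistMap (dualMap inc) χ
  have hi₀ : Function.Injective i₀ :=
    LinearMap.dualMap_injective_of_surjective (Submodule.mkQ_surjective _)
  have hq₀ : Function.Surjective q₀ :=
    LinearMap.dualMap_surjective_of_injective (Submodule.inclusion_injective hsub)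
  have hiq₀ : Function.Exact i₀ q₀ := by
    intro l
    constructor
    · intro hl
      have hker : (evalSub k p F y).comap (evalSub k p F dh).subtype ≤ LinearMap.ker l := by
        intro x hx
        exact LinearMap.congr_fun (hl : l.comp (Submodule.inclusion hsub) = 0) ⟨x.val, hx⟩
      exact ⟨Submodule.liftQ _ l hker, Submodule.liftQ_mkQ _ l hker⟩
    · rintro ⟨l, rfl⟩
      refine LinearMap.ext fun x => ?_
      change l (Submodule.Quotient.mk (Submodule.inclusion hsub x)) = 0
      have : (Submodule.Quotient.mk (Submodule.inclusion hsub x) : evalSub k p F dh ⧸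
          (evalSub k p F y).comap (evalSub k p F dh).subtype) = 0 := by
        rw [Submodule.Quotient.mk_eq_zero]
        exact x.2
      rw [this, map_zero]
  have hvu : ∀ t, E₀ (upperUnip t) (evalPoint k p F dh) = evalPoint k p F dh := by
    intro t
    have h1 : (χ (upperUnip t) : kˣ) = 1 := by
      have : (detChar k F) (upperUnip t) = 1 := by
        ext
        simp [detChar, Matrix.det_fin_two]
      simp [χ, this]
    rw [twist_apply, h1, Units.val_one, one_smul]
    refine LinearMap.ext fun φ => ?_
    rw [dual_evalPoint_apply, upperUnip_inv]
    have : Matrix.vecMul ![0, 1] (upperUnip (-t)).val = ![0, 1] := by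
      funext i
      fin_cases i <;> simp [Matrix.vecMul]
    rw [this]
    rfl
  have hvt : ∀ x z : Fˣ, E₀ (diag x z) (evalPoint k p F dh) =
      (algebraMap F k x ^ M * algebraMap F k z ^ c) • evalPoint k p F dh := by
    intro x z
    have h1 : ((χ (diag x z) : kˣ) : k) = algebraMap F k x ^ M * algebraMap F k z ^ M := by
      have : ((detChar k F (diag x z) : kˣ) : k) = algebraMap F k x * algebraMap F k z := by
        simp [detChar, Matrix.det_fin_two]
      simp [χ, this, mul_zpow]
    have hz : algebraMap F k z ≠ 0 := by simp
    -- The scalar matrix acts through the degree `dh`; carrying shows that this is the character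
    -- expected from `y`.
    have h2 : algebraMap F k z ^ digitVal p dh = algebraMap F k z ^ digitVal p y := by
      have h3 : algebraMap F k z ^ digitVal p (dh + Pi.single j₁ 1) =
          algebraMap F k z ^ digitVal p (y + Pi.single j₀ p) := by rw [hdh]
      rw [pow_digitVal_carry hj, digitVal_add, digitVal_add, pow_add, pow_add] at h3
      exact mul_right_cancel₀ (pow_ne_zero _ hz) h3
    have h4 : (evalRep k p F dh).dual (diag x z) (evalPoint k p F dh) =
        (algebraMap F k z ^ digitVal p y)⁻¹ • evalPoint k p F dh := by
      refine LinearMap.ext fun φ => ?_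
      rw [dual_evalPoint_apply, diag_inv]
      have : Matrix.vecMul ![0, 1] (diag x⁻¹ z⁻¹).val = ((z⁻¹ : Fˣ) : F) • ![0, 1] := by
        funext i
        fin_cases i <;> simp [Matrix.vecMul]
      rw [this, evalSub_apply_smul _ φ.2, ← h2, LinearMap.smul_apply, smul_eq_mul]
      simp [evalPoint]
    rw [twist_apply, h1, h4, smul_smul, hc, zpow_sub₀ hz, zpow_natCast, div_eq_mul_inv, mul_assoc]
  have hgen := span_orbit_twist (ρ := (evalRep k p F dh).dual) χ (span_orbit_evalPoint (k := k) hd0)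
  refine ⟨E, hE, ?_⟩
  refine extension_of_generator hσ hτ hχ (e.toIntertwiningMap.comp (i₀.comp eσ.toIntertwiningMap))
    (eτ.toIntertwiningMap.comp (q₀.comp e.symm.toIntertwiningMap)) ?_ ?_ ?_
    (e (evalPoint k p F dh)) ?_ ?_ ?_
  · exact e.toLinearEquiv.injective.comp (hi₀.comp eσ.toLinearEquiv.injective)
  · exact eτ.toLinearEquiv.surjective.comp (hq₀.comp e.symm.toLinearEquiv.surjective)
  · intro x
    change eτ (q₀ (e.symm x)) = 0 ↔ ∃ s, e (i₀ (eσ s)) = x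
    constructor
    · intro h
      have h1 : q₀ (e.symm x) = 0 := eτ.toLinearEquiv.map_eq_zero_iff.1 h
      obtain ⟨s, hs⟩ := (hiq₀ _).1 h1
      refine ⟨eσ.symm s, ?_⟩
      rw [eσ.apply_symm_apply, hs, e.apply_symm_apply]
    · rintro ⟨s, rfl⟩
      rw [e.symm_apply_apply, (hiq₀ _).2 ⟨_, rfl⟩, map_zero]
  · intro t
    rw [← equiv_apply_rho, hvu]
  · intro x z
    rw [← equiv_apply_rho, hvt, map_smul]
  · rw [eq_top_iff]
    intro x _
    have hx : e.symm x ∈ Submodule.span k (Set.range fun g => E₀ g (evalPoint k p F dh)) := by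
      rw [hgen]
      trivial
    have hx' : e (e.symm x) ∈ (Submodule.span k
        (Set.range fun g => E₀ g (evalPoint k p F dh))).map e.toLinearMap := ⟨_, hx, rfl⟩
    rw [e.apply_symm_apply, Submodule.map_span] at hx'
    refine Submodule.span_mono ?_ hx'
    rintro _ ⟨_, ⟨g, rfl⟩, rfl⟩
    exact ⟨g, (equiv_apply_rho e g _).symm⟩

end Borrow

/-! ### Exponents of characters modulo `q - 1` -/

section Exponents

variable {F : Type u} [Field F] [Fintype F] {k : Type v} [Field k] [Algebra F k]

lemma algebraMap_zpow_eq_of_dvd {m m' : ℤ} (h : (Fintype.card F : ℤ) - 1 ∣ m - m') (a : Fˣ) :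
    algebraMap F k a ^ m = algebraMap F k a ^ m' := by
  obtain ⟨c, hc⟩ := h
  have h1 : algebraMap F k a ^ ((Fintype.card F : ℤ) - 1) = 1 := by
    have h2 := FiniteField.pow_card_sub_one_eq_one (a : F) a.ne_zero
    have h3 : (Fintype.card F : ℤ) - 1 = ((Fintype.card F - 1 : ℕ) : ℤ) := by
      rw [Nat.cast_sub Fintype.card_pos, Nat.cast_one]
    rw [h3, zpow_natCast, ← map_pow, h2, map_one]
  have h0 : algebraMap F k a ≠ 0 := by simp
  rw [eq_add_of_sub_eq hc, zpow_add₀ h0, zpow_mul, h1, one_zpow, one_mul]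

variable (F k) in
lemma exists_unit_dvd_of_zpow_eq : ∃ a : Fˣ, ∀ m m' : ℤ,
    algebraMap F k a ^ m = algebraMap F k a ^ m' → (Fintype.card F : ℤ) - 1 ∣ m - m' := by
  classical
  obtain ⟨a, ha⟩ := IsCyclic.exists_generator (α := Fˣ)
  refine ⟨a, fun m m' h => ?_⟩
  have h1 : (orderOf a : ℤ) = (Fintype.card F : ℤ) - 1 := by
    rw [orderOf_eq_card_of_forall_mem_zpowers ha, Nat.card_eq_fintype_card, Fintype.card_units,
      Nat.cast_sub Fintype.card_pos, Nat.cast_one]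
  rw [← h1, orderOf_dvd_iff_zpow_eq_one, zpow_sub, mul_inv_eq_one]
  apply Units.ext
  rw [← map_zpow₀, ← map_zpow₀] at h
  simpa using (algebraMap F k).injective h

lemma torusChar_eq_of_dvd {m n m' n' : ℤ} (hm : (Fintype.card F : ℤ) - 1 ∣ m - m')
    (hn : (Fintype.card F : ℤ) - 1 ∣ n - n') :
    torusChar (F := F) k m n = torusChar k m' n' := by
  ext b
  obtain ⟨a, d, t, -, h0, h1⟩ := exists_borel_eq b.val b.2
  rw [torusChar_apply, torusChar_apply, h0, h1, algebraMap_zpow_eq_of_dvd hm,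
    algebraMap_zpow_eq_of_dvd hn]

lemma IsHW.of_dvd {V : Type*} [AddCommGroup V] [Module k V]
    {ρ : Representation k (GL (Fin 2) F) V} {m n m' n' : ℤ} (h : IsHW ρ m n)
    (hm : (Fintype.card F : ℤ) - 1 ∣ m - m') (hn : (Fintype.card F : ℤ) - 1 ∣ n - n') :
    IsHW ρ m' n' where
  irr := h.irr
  vec := by
    obtain ⟨v, hv, hvu, hvt, hu⟩ := h.vec
    refine ⟨v, hv, hvu, fun a d => ?_, hu⟩
    rw [hvt, algebraMap_zpow_eq_of_dvd hm, algebraMap_zpow_eq_of_dvd hn]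
  cov := h.cov

lemma dvd_of_forall_zpow_eq {m n m' n' : ℤ}
    (h : ∀ a d : Fˣ, algebraMap F k a ^ m * algebraMap F k d ^ n =
      algebraMap F k a ^ m' * algebraMap F k d ^ n') :
    (Fintype.card F : ℤ) - 1 ∣ m - m' ∧ (Fintype.card F : ℤ) - 1 ∣ n - n' := by
  obtain ⟨a, ha⟩ := exists_unit_dvd_of_zpow_eq F k
  exact ⟨ha _ _ (by simpa using h a 1), ha _ _ (by simpa using h 1 a)⟩

lemma dvd_of_torusChar_eq {m n m' n' : ℤ}
    (h : torusChar (F := F) k m n = torusChar k m' n') :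
    (Fintype.card F : ℤ) - 1 ∣ m - m' ∧ (Fintype.card F : ℤ) - 1 ∣ n - n' := by
  refine dvd_of_forall_zpow_eq (F := F) (k := k) fun a d => ?_
  have := congrArg (fun χ => ((χ (⟨diag a d, by change (diag a d).val 1 0 = 0; simp⟩ : borel F) :
    kˣ) : k)) h
  simpa [torusChar_apply] using this

end Exponents

/-! ### Generic tuples of digits -/

section Generic

variable {p : ℕ} {f : ℕ}

lemma digitVal_add_compl {x y : Fin f → ℕ} (h : ∀ j, x j + y j = p - 1) (hp : 1 ≤ p) :
    (digitVal p x : ℤ) + digitVal p y = p ^ f - 1 := by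
  have h1 : digitVal p x + digitVal p y = ∑ j : Fin f, (p - 1) * p ^ j.val := by
    rw [← digitVal_add]
    exact Finset.sum_congr rfl fun j _ => by rw [← h j]; rfl
  rw [← Nat.cast_add, h1, ← Finset.mul_sum, Fin.sum_univ_eq_sum_range (fun i => p ^ i)]
  push_cast [Nat.cast_sub hp]
  exact mul_geom_sum _ _

/-- All entries are at most `p - 1`, and not all of them are `0` or `p - 1`. -/
def IsGenericTuple (p : ℕ) (x : Fin f → ℕ) : Prop :=
  (∀ j, x j < p) ∧ ∃ j, 1 ≤ x j ∧ x j + 2 ≤ p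

variable {x x' : Fin f → ℕ}

lemma IsGenericTuple.compl (hx : IsGenericTuple p x) :
    IsGenericTuple p fun j => p - 1 - x j := by
  obtain ⟨h, j, h1, h2⟩ := hx
  refine ⟨fun j => ?_, j, ?_, ?_⟩ <;> dsimp only <;> omega

lemma IsGenericTuple.ne_zero (hx : IsGenericTuple p x) : x ≠ 0 := by
  rintro rfl
  obtain ⟨-, j, h1, -⟩ := hx
  simp at h1

lemma IsGenericTuple.digitVal_pos (hx : IsGenericTuple p x) : 0 < digitVal p x := by
  obtain ⟨h, j, h1, h2⟩ := hx
  refine lt_of_lt_of_le ?_ (Finset.single_le_sum (f := fun j : Fin f => x j * p ^ j.val)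
    (fun _ _ => Nat.zero_le _) (Finset.mem_univ j))
  have : 0 < p := by omega
  positivity

lemma IsGenericTuple.digitVal_lt (hx : IsGenericTuple p x) :
    (digitVal p x : ℤ) < p ^ f - 1 := by
  have h := digitVal_add_compl (p := p) (x := x) (y := fun j => p - 1 - x j)
    (fun j => by have := hx.1 j; omega) (by obtain ⟨-, j, -, h⟩ := hx; omega)
  have h1 := hx.compl.digitVal_pos
  omega

lemma IsGenericTuple.not_dvd (hx : IsGenericTuple p x) :
    ¬ ((p : ℤ) ^ f - 1 ∣ digitVal p x) := by
  intro h
  have h1 := hx.digitVal_pos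
  exact absurd (Int.le_of_dvd (by exact_mod_cast h1) h) (not_le.2 hx.digitVal_lt)

/-- Generic values lie strictly between `0` and `p ^ f - 1`, so a congruence between them is an
equality. -/
lemma IsGenericTuple.eq_of_dvd (hx : IsGenericTuple p x) (hx' : IsGenericTuple p x')
    (h : (p : ℤ) ^ f - 1 ∣ digitVal p x - digitVal p x') : x = x' := by
  have h1 := hx.digitVal_lt
  have h2 := hx'.digitVal_lt
  have h3 := Int.eq_zero_of_abs_lt_dvd h (by rw [abs_lt]; constructor <;> omega)
  exact digitVal_inj hx.1 hx'.1 (by omega)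

variable [Fact p.Prime] {F : Type u} [Field F] [Fintype F] [CharP F p] {k : Type v} [Field k]
  [Algebra F k]

/-- The dimension `∏ (x j + 1)` lies strictly between `1` and `p ^ f`, the dimensions of the
excluded weights. -/
lemma IsGenericTuple.isGenericWeight (hF : Fintype.card F = p ^ f) (hx : IsGenericTuple p x)
    (m : ℤ) : IsGenericWeight p f (weight k p F x m) := by
  refine ⟨(isHW_weight k p F hF hx.1 hx.ne_zero m).isIrreducible, fun n => ⟨⟨fun e => ?_⟩,
    ⟨fun e => ?_⟩⟩⟩
  · have h := e.toLinearEquiv.finrank_eq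
    rw [finrank_weight, finrank_weight] at h
    obtain ⟨hlt, j, h1, h2⟩ := hx
    refine absurd h (ne_of_gt (Finset.prod_lt_prod (fun i _ => by omega) (fun i _ => by omega)
      ⟨j, Finset.mem_univ _, by omega⟩))
  · have h := e.toLinearEquiv.finrank_eq
    rw [finrank_weight, finrank_weight] at h
    obtain ⟨hlt, j, h1, h2⟩ := hx
    refine absurd h (ne_of_lt (Finset.prod_lt_prod (fun i _ => by omega)
      (fun i _ => by have := hlt i; omega) ⟨j, Finset.mem_univ _, by omega⟩))

lemma weight_eq_of_equiv (hF : Fintype.card F = p ^ f) (hx : IsGenericTuple p x)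
    (hx' : IsGenericTuple p x') {m m' : ℤ}
    (e : Nonempty ((weight k p F x m).ρ.Equiv (weight k p F x' m').ρ)) :
    x = x' ∧ (p : ℤ) ^ f - 1 ∣ m - m' := by
  have h := dvd_of_forall_zpow_eq (F := F) (k := k)
    ((isHW_weight k p F hF hx.1 hx.ne_zero m).char_eq
      (isHW_weight k p F hF hx'.1 hx'.ne_zero m') e)
  rw [hF, Nat.cast_pow] at h
  refine ⟨hx.eq_of_dvd hx' ?_, h.2⟩
  have := dvd_sub h.1 h.2
  rwa [show (digitVal p x + m - (digitVal p x' + m') - (m - m') : ℤ) =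
    digitVal p x - digitVal p x' by ring] at this

end Generic

/-! ### Cyclic modules on generic tuples -/

section Assembly

variable {p : ℕ} {f : ℕ}

/-- The numerical condition for the existence of the extension of the weight
`x^[s] ⊗ det^(m + val x)` by the weight `s ⊗ detⁿ`: the tuple `s` and the exponent `n` are obtained
from the complement of `x` by borrowing at position `j₁` and carrying to position `j₀`. -/
def IsStep (p : ℕ) (x : Fin f → ℕ) (m : ℤ) (s : Fin f → ℕ) (n : ℤ) : Prop :=
  ∃ (j₀ j₁ : Fin f) (lo hi : Fin f → ℕ),
    (j₁.val = j₀.val + 1 ∨ j₁.val = 0 ∧ j₀.val + 1 = f) ∧ x j₁ + 2 ≤ p ∧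
    (lo + hi + Pi.single j₁ 1 = (fun j => p - 1 - x j) + Pi.single j₀ p) ∧
    (∀ j, j ≠ j₀ → lo j = 0) ∧ hi j₀ = p - 1 ∧ lo + s = hi ∧
    (p : ℤ) ^ f - 1 ∣ n - (m - digitVal p hi)

variable [Fact p.Prime] {F : Type u} [Field F] [Fintype F] [CharP F p] {k : Type v} [Field k]
  [Algebra F k]

/-- The general construction is used with `y = p - 1 - x` and twist `det^m`. Its exponents agree
with those of the two weights modulo `p ^ f - 1`, because the values of `x` and of its complement
add up to `p ^ f - 1`. -/
lemma IsStep.exists_extension {x s : Fin f → ℕ} {m n : ℤ} (h : IsStep p x m s n)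
    (hF : Fintype.card F = p ^ f) (hx : IsGenericTuple p x) (hs : IsGenericTuple p s)
    (hne : IsEmpty ((weight k p F s n).ρ.Equiv
      (weight k p F (fun j => p - 1 - x j) (m + digitVal p x)).ρ)) :
    ∃ E : Rep.{v} k (GL (Fin 2) F), FiniteDimensional k E ∧
      IsNonsplitExtension (weight k p F s n) E
        (weight k p F (fun j => p - 1 - x j) (m + digitVal p x)) ∧
      Nonempty ((unipInvariants E).Equiv ((charRep (torusChar k (digitVal p s + n) n)).prod
        (charRep (torusChar k m (digitVal p x + m))))) := by
  obtain ⟨j₀, j₁, lo, hi, hj, hj₁, hsum, hlo, hhi, hlos, hn⟩ := h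
  have hp := (Fact.out : p.Prime).two_le
  have hcard : (Fintype.card F : ℤ) - 1 = (p : ℤ) ^ f - 1 := by rw [hF, Nat.cast_pow]
  have hcompl := digitVal_add_compl (p := p) (x := x) (y := fun j => p - 1 - x j)
    (fun j => by have := hx.1 j; omega) (by omega)
  have hval : digitVal p lo + digitVal p s = digitVal p hi := by rw [← digitVal_add, hlos]
  have hσ := isHW_weight k p F hF hs.1 hs.ne_zero n
  have hτ := isHW_weight k p F hF hx.compl.1 hx.compl.ne_zero (m + digitVal p x)
  have d1 : (Fintype.card F : ℤ) - 1 ∣ digitVal p s + n - (m - digitVal p lo) := by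
    rw [hcard]
    convert hn using 1
    omega
  have d2 : (Fintype.card F : ℤ) - 1 ∣ n - (m - digitVal p hi) := by rwa [hcard]
  have d3 : (Fintype.card F : ℤ) - 1 ∣
      digitVal p (fun j => p - 1 - x j) + (m + digitVal p x) - m := by
    rw [hcard]
    exact ⟨1, by linear_combination hcompl⟩
  have d4 : (Fintype.card F : ℤ) - 1 ∣
      m + digitVal p x - (m - digitVal p fun j => p - 1 - x j) := by
    rw [hcard]
    exact ⟨1, by linear_combination hcompl⟩
  have hσ' := hσ.of_dvd d1 d2
  have hτ' := hτ.of_dvd d3 d4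
  have hfrob : ∀ z : F, z ^ p ^ j₁.val = z ^ (p * p ^ j₀.val) := by
    intro z
    rcases hj with hj | ⟨hj, hj'⟩
    · rw [hj, pow_succ']
    · rw [hj, pow_zero, pow_one, ← pow_succ', hj', ← hF, FiniteField.pow_card]
  -- Equal characters would make the two weights isomorphic, against `hne`.
  have hχ : torusChar (F := F) k (m - digitVal p lo) (m - digitVal p hi) ≠
      torusChar k m (m - digitVal p fun j => p - 1 - x j) := by
    intro h
    obtain ⟨h1, h2⟩ := dvd_of_torusChar_eq h
    exact not_isEmpty_iff.2 ((hσ'.of_dvd h1 h2).nonempty_equiv hτ') hne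
  obtain ⟨E, hE, hext, hU⟩ := CyclicModule.exists_extension (k := k) (y := fun j => p - 1 - x j)
    hF hfrob hsum (fun j => by omega)
    (by omega) rfl hlo hhi (hlos ▸ le_self_add) (fun h => hs.ne_zero (by simpa [h] using hlos))
    (fun h => by
      have := congrFun hsum j₁
      rw [h] at this
      simp only [Pi.add_apply, Pi.single_eq_same, Pi.single_apply] at this
      split_ifs at this <;> omega)
    m rfl rfl rfl hσ' hτ' hχ
  refine ⟨E, hE, hext, ?_⟩
  rw [torusChar_eq_of_dvd (k := k) (F := F) (m := digitVal p s + n) d1 d2,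
    torusChar_eq_of_dvd (k := k) (F := F) (m := m) (n := digitVal p x + m) (m' := m)
      (by simp) (by rw [add_comm]; exact d4)]
  exact hU

variable (k) in
-- The weight `(x ⊗ det^m)^[s]` is the complement of `x` twisted by `det^(m + val x)`: the
-- complement has value `-val x` modulo `p ^ f - 1`, so the two torus exponents are exchanged. The
-- last two hypotheses separate all constituents.
lemma exists_isCyclicModuleOn (hF : Fintype.card F = p ^ f) {n : ℕ} (x : Fin n → Fin f → ℕ)
    (m : Fin n → ℤ) (hx : ∀ i, IsGenericTuple p (x i))
    (hstep : ∀ i, IsStep p (x ((finRotate n).symm i)) (m ((finRotate n).symm i)) (x i) (m i))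
    (hσσ : ∀ i i', x i = x i' → (p : ℤ) ^ f - 1 ∣ m i - m i' → i = i')
    (hστ : ∀ i i', (∀ j, x i j + x i' j = p - 1) →
      ¬ ((p : ℤ) ^ f - 1 ∣ m i - (m i' + digitVal p (x i')))) :
    ∃ D : Rep.{v} k (GL (Fin 2) F),
      IsCyclicModuleOn p f (fun i => weight k p F (x i) (m i)) D ∧ IsMultiplicityFree D ∧
        socleLength D = n := by
  let σ i := weight k p F (x i) (m i)
  let τ i := weight k p F (fun j => p - 1 - x i j) (m i + digitVal p (x i))
  have hσ i : IsHW (σ i).ρ (digitVal p (x i) + m i) (m i) :=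
    isHW_weight k p F hF (hx i).1 (hx i).ne_zero _
  have hcompl i := digitVal_add_compl (p := p) (x := x i) (y := fun j => p - 1 - x i j)
    (fun j => by have := (hx i).1 j; omega) (Fact.out : p.Prime).one_le
  have hτ i : IsHW (τ i).ρ (m i) (digitVal p (x i) + m i) := by
    refine (isHW_weight k p F hF (hx i).compl.1 (hx i).compl.ne_zero _).of_dvd ?_ ?_
    · rw [hF, Nat.cast_pow]
      exact ⟨1, by linear_combination hcompl i⟩
    · simp [add_comm]
  have hne i i' : IsEmpty ((σ i).ρ.Equiv (τ i').ρ) := by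
    refine ⟨fun e => ?_⟩
    obtain ⟨h1, h2⟩ := weight_eq_of_equiv hF (hx i) (hx i').compl ⟨e⟩
    refine hστ i i' (fun j => ?_) h2
    have := (hx i').1 j
    rw [h1]
    dsimp only
    omega
  have hσσ' i i' (e : Nonempty ((σ i).ρ.Equiv (σ i').ρ)) : i = i' := by
    obtain ⟨h1, h2⟩ := weight_eq_of_equiv hF (hx i) (hx i') e
    exact hσσ i i' h1 h2
  have hττ i i' (e : Nonempty ((τ i).ρ.Equiv (τ i').ρ)) : i = i' := by
    obtain ⟨h1, h2⟩ := weight_eq_of_equiv hF (hx i).compl (hx i').compl e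
    have h3 : x i = x i' := by
      funext j
      have h4 := congrFun h1 j
      have := (hx i).1 j
      have := (hx i').1 j
      omega
    refine hσσ i i' h3 ?_
    rw [h3] at h2
    simpa using h2
  choose E hE hext hU using fun i => (hstep i).exists_extension (k := k) hF (hx _) (hx i) (hne i _)
  obtain ⟨hmf, hsoc⟩ := isMultiplicityFree_directSum (E := E) (σ := σ)
    (τ := fun i => τ ((finRotate n).symm i)) (fun i => (hσ i).isIrreducible)
    (fun i => (hτ _).isIrreducible) hext hσσ'
    (fun i j e => (finRotate n).symm.injective (hττ _ _ e)) (fun i j => hne i _)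
  refine ⟨_, ⟨?_, fun i => (hx i).isGenericWeight hF _, hσσ',
    fun i => torusChar k (digitVal p (x i) + m i) (m i), τ, E, fun i => (hσ i).hasChar,
    fun i => ⟨(hx i).compl.isGenericWeight hF _, ?_⟩, hext, fun i => ?_, ⟨.refl _⟩⟩, hmf, hsoc⟩
  · have : ∀ i, FiniteDimensional k (E i).V := hE
    exact Module.Finite.instDFinsupp fun i => (E i).V
  · rw [conjChar_torusChar]
    exact (hτ i).hasChar
  · rw [conjChar_torusChar]
    exact hU i

end Assembly

/-! ### The combinatorics of the explicit cycle -/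

section Combinatorics

variable (p f : ℕ)

/-- The entry of `μ⁽ⁱ⁾`, raised by one where the next step would apply `μ₁`. In these coordinates
every step is either the identity or the reflection `x ↦ p - 1 - x`. -/
def muLift (i : ℕ) (j : Fin f) (x : ℤ) : ℤ :=
  muIter p f i j x + if (i + j) % f = 1 then 1 else 0

variable {p f}

lemma succ_mod_eq (hf : 1 < f) (a : ℕ) :
    (a + 1) % f = if a % f + 1 = f then 0 else a % f + 1 := by
  rw [Nat.add_mod, Nat.mod_eq_of_lt hf]
  have := Nat.mod_lt a (by omega : f > 0)
  split_ifs with h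
  · rw [h, Nat.mod_self]
  · exact Nat.mod_eq_of_lt (by omega)

/-- The map `μ₀` lowers by one, but its position comes next to `μ₁`, so the raise restores the
value. Conversely `μ₁` acts on the raised entry as the reflection, and the raise is then dropped. -/
lemma muLift_succ (hf : 1 < f) (i : ℕ) (j : Fin f) (x : ℤ) :
    muLift p f (i + 1) j x =
      if (i + j) % f ≠ 0 then p - 1 - muLift p f i j x else muLift p f i j x := by
  simp only [muLift, muIter, muShift]
  rw [show i + 1 + j.val = i + j.val + 1 by omega, succ_mod_eq hf]
  generalize (i + j.val) % f = c
  match c with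
  | 0 => simp [mu, hf.ne]
  | 1 =>
    simp only [mu]
    split_ifs <;> first | contradiction | omega
  | c + 2 =>
    simp only [mu]
    split_ifs <;> first | contradiction | omega

lemma card_filter_Ico_succ (P : ℕ → Prop) [DecidablePred P] (a n : ℕ) :
    ((Finset.Ico a (a + (n + 1))).filter P).card =
      ((Finset.Ico a (a + n)).filter P).card + if P (a + n) then 1 else 0 := by
  rw [← add_assoc, ← Finset.insert_Ico_right_eq_Ico_add_one (by omega), Finset.filter_insert]
  split_ifs
  · rw [Finset.card_insert_of_notMem (by simp)]
  · rfl

lemma muLift_add (hf : 1 < f) (i n : ℕ) (j : Fin f) (x : ℤ) :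
    muLift p f (i + n) j x =
      if Odd (((Finset.Ico (i + j) (i + j + n)).filter fun a => a % f ≠ 0).card)
        then p - 1 - muLift p f i j x else muLift p f i j x := by
  induction n with
  | zero => simp
  | succ n ih =>
    rw [← add_assoc, muLift_succ hf, ih, card_filter_Ico_succ,
      show i + n + j.val = i + j.val + n by omega]
    by_cases h : (i + j.val + n) % f ≠ 0
    · rw [if_pos h, if_pos h]
      simp only [Nat.odd_add_one]
      split_ifs <;> first | contradiction | ring
    · rw [if_neg h, if_neg h, add_zero]

lemma card_filter_mod_ne_zero (hf : 1 < f) (c : ℕ) :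
    ((Finset.Ico c (c + f)).filter fun a => a % f ≠ 0).card = f - 1 := by
  rw [Nat.filter_Ico_card_eq_of_periodic c f (fun a => a % f ≠ 0) (fun a => by simp),
    Nat.count_eq_card_filter_range]
  have : (Finset.range f).filter (fun a => a % f ≠ 0) = (Finset.range f).erase 0 := by
    ext a
    simp only [Finset.mem_filter, Finset.mem_range, Finset.mem_erase]
    constructor
    · rintro ⟨h1, h2⟩
      rw [Nat.mod_eq_of_lt h1] at h2
      exact ⟨h2, h1⟩
    · rintro ⟨h1, h2⟩
      rw [Nat.mod_eq_of_lt h2]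
      exact ⟨h2, h1⟩
  rw [this, Finset.card_erase_of_mem (by simp; omega), Finset.card_range]

/-- Over `f` consecutive steps an entry meets `μ₀` once and is reflected `f - 1` times; the
reflection is an involution. -/
lemma muLift_add_self (hf : 1 < f) (i : ℕ) (j : Fin f) (x : ℤ) :
    muLift p f (i + f) j x =
      if Odd f then muLift p f i j x else p - 1 - muLift p f i j x := by
  rw [muLift_add hf, card_filter_mod_ne_zero hf]
  have : Odd (f - 1) ↔ ¬ Odd f := by
    rw [Nat.odd_sub' (by omega)]
    simp
  simp only [this]
  split_ifs <;> first | contradiction | rfl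

lemma muIter_eq (i : ℕ) (j : Fin f) (x : ℤ) :
    muIter p f i j x = muLift p f i j x - if (i + j) % f = 1 then 1 else 0 := by
  rw [muLift]
  ring

lemma muIter_add_cycleLength (hf : 1 < f) (i : ℕ) (j : Fin f) (x : ℤ) :
    muIter p f (i + cycleLength f) j x = muIter p f i j x := by
  have hmod : ∀ i, (i + f + j.val) % f = (i + j.val) % f := fun i => by
    rw [add_right_comm, Nat.add_mod_right]
  rw [cycleLength]
  by_cases h : Odd f
  · rw [if_pos h, muIter_eq, muIter_eq, muLift_add_self hf, if_pos h, hmod]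
  · rw [if_neg h, two_mul, ← add_assoc, muIter_eq, muIter_eq, muLift_add_self hf,
      muLift_add_self hf, if_neg h, if_neg h, hmod, hmod]
    ring

lemma exists_add_mod_eq (hf : 1 < f) (i : ℕ) {c : ℕ} (hc : c < f) :
    ∃ j : Fin f, (i + j) % f = c := by
  refine ⟨⟨(c + (f - i % f)) % f, Nat.mod_lt _ (by omega)⟩, ?_⟩
  have h := Nat.mod_lt i (by omega : f > 0)
  have h' := Nat.div_add_mod i f
  rw [Nat.add_mod_mod, show i + (c + (f - i % f)) = c + f * (i / f + 1) by rw [mul_add]; omega,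
    Nat.add_mul_mod_self_left, Nat.mod_eq_of_lt hc]

lemma eq_of_add_mod_eq {i : ℕ} {j l : Fin f} (h : (i + j) % f = (i + l) % f) : j = l := by
  have h1 : i + j.val ≡ i + l.val [MOD f] := h
  have h2 := Nat.ModEq.add_left_cancel' i h1
  exact Fin.ext (Nat.ModEq.eq_of_lt_of_lt h2 j.2 l.2)

/-- The number with base `p` digits `x`, for digits that may be negative. -/
def intDigitVal (p : ℕ) (x : Fin f → ℤ) : ℤ := ∑ j, (p : ℤ) ^ j.val * x j

lemma digitVal_cast (x : Fin f → ℕ) : (digitVal p x : ℤ) = intDigitVal p fun j => (x j : ℤ) := by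
  simp [digitVal, intDigitVal, mul_comm]

/-- The generic entry contributes `2x - (p - 1)`; the contribution is one larger at `j₁` and is
corrected by `p - 2x` at `j₀`, where it equals `1`. -/
lemma sum_mul_sub_muShift {i : ℕ} {j₀ j₁ : Fin f} (h₀ : (i + j₀) % f = 0)
    (h₁ : (i + j₁) % f = 1) (x : Fin f → ℤ) :
    ∑ j : Fin f, (p : ℤ) ^ j.val * (x j - muShift p f i j (x j)) =
      2 * intDigitVal p x - (p ^ f - 1) + p ^ j₁.val + p ^ j₀.val * (p - 2 * x j₀) := by
  have key : ∀ j : Fin f, (p : ℤ) ^ j.val * (x j - muShift p f i j (x j)) =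
      2 * ((p : ℤ) ^ j.val * x j) - (p - 1) * p ^ j.val + (if j = j₁ then (p : ℤ) ^ j.val else 0) +
        if j = j₀ then (p : ℤ) ^ j.val * (p - 2 * x j) else 0 := by
    intro j
    have e0 : j = j₀ ↔ (i + j.val) % f = 0 :=
      ⟨fun h => h ▸ h₀, fun h => eq_of_add_mod_eq (h.trans h₀.symm)⟩
    have e1 : j = j₁ ↔ (i + j.val) % f = 1 :=
      ⟨fun h => h ▸ h₁, fun h => eq_of_add_mod_eq (h.trans h₁.symm)⟩
    simp only [e0, e1, muShift]
    generalize (i + j.val) % f = c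
    match c with
    | 0 => simp [mu]; ring
    | 1 => simp [mu]; ring
    | c + 2 => simp [mu]; ring
  rw [Finset.sum_congr rfl fun j _ => key j, Finset.sum_add_distrib, Finset.sum_add_distrib,
    Finset.sum_sub_distrib, ← Finset.mul_sum, ← Finset.mul_sum, Finset.sum_ite_eq',
    Finset.sum_ite_eq', if_pos (Finset.mem_univ _), if_pos (Finset.mem_univ _),
    Fin.sum_univ_eq_sum_range (fun a => (p : ℤ) ^ a), mul_geom_sum]
  rfl

/-- Among the `μ_c` only `μ₀` has slope `1`. Thus `ε = 0` exactly when the carry from `j₀` wraps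
around. -/
lemma muShift_last_iff (hf : 1 < f) {i : ℕ} {j₀ : Fin f} (h₀ : (i + j₀) % f = 0) :
    (∀ j : Fin f, j.val + 1 = f →
      (muShift p f i j = fun y => y) ∨ (muShift p f i j = fun y => y - 1)) ↔ j₀.val + 1 = f := by
  constructor
  · intro h
    have h1 := h ⟨f - 1, by omega⟩ (by simp; omega)
    by_contra hne
    have h2 : (i + (f - 1)) % f ≠ 0 := by
      intro h2
      have := congrArg Fin.val
        (eq_of_add_mod_eq (j := ⟨f - 1, by omega⟩) (l := j₀) (h2.trans h₀.symm))
      simp at this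
      omega
    simp only [muShift] at h1
    revert h1 h2
    generalize (i + (f - 1)) % f = c
    intro h1 h2
    match c with
    | 0 => exact h2 rfl
    | 1 =>
      rcases h1 with h1 | h1
      · have a := congrFun h1 0
        have b := congrFun h1 1
        simp only [mu] at a b
        omega
      · have a := congrFun h1 0
        have b := congrFun h1 1
        simp only [mu] at a b
        omega
    | c + 2 =>
      rcases h1 with h1 | h1
      · have a := congrFun h1 0
        have b := congrFun h1 1
        simp only [mu] at a b
        omega
      · have a := congrFun h1 0
        have b := congrFun h1 1
        simp only [mu] at a b
        omega
  · intro h j hj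
    obtain rfl : j = j₀ := Fin.ext (by omega)
    right
    funext y
    rw [muShift, h₀]
    rfl

/-- The power `p ^ j₁` is `p * p ^ j₀`, less `p ^ f - 1` if the carry wraps; the term `ε` makes the
halved number visibly even in both cases. The first formula serves for a single step, the second for
telescoping. -/
lemma expo_muShift (hf : 1 < f) {i : ℕ} {j₀ : Fin f} (h₀ : (i + j₀) % f = 0) (x : Fin f → ℤ) :
    expo p f (muShift p f i) x = intDigitVal p x + p ^ j₀.val * (p - x j₀) -
        (if j₀.val + 1 = f then (p : ℤ) ^ f - 1 else 0) ∧
      2 * expo p f (muShift p f i) x = (if j₀.val + 1 = f then 0 else (p : ℤ) ^ f - 1) +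
        intDigitVal p x - intDigitVal p fun j => muShift p f i j (x j) := by
  let j₁ : Fin f := ⟨(j₀.val + 1) % f, Nat.mod_lt _ (by omega)⟩
  have h₁ : (i + j₁) % f = 1 := by
    change (i + (j₀.val + 1) % f) % f = 1
    rw [Nat.add_mod_mod, ← add_assoc, succ_mod_eq hf, h₀, if_neg (by omega)]
  have hpow : (p : ℤ) ^ j₁.val =
      p * p ^ j₀.val - if j₀.val + 1 = f then (p : ℤ) ^ f - 1 else 0 := by
    change (p : ℤ) ^ ((j₀.val + 1) % f) = _
    rw [← pow_succ']
    split_ifs with h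
    · rw [h, Nat.mod_self]
      ring
    · rw [Nat.mod_eq_of_lt (by omega), sub_zero]
  have hs := sum_mul_sub_muShift (p := p) h₀ h₁ x
  have hV : ∑ j : Fin f, (p : ℤ) ^ j.val * (x j - muShift p f i j (x j)) =
      intDigitVal p x - intDigitVal p fun j => muShift p f i j (x j) := by
    simp only [intDigitVal, mul_sub, Finset.sum_sub_distrib]
  have he : expo p f (muShift p f i) x = intDigitVal p x + p ^ j₀.val * (p - x j₀) -
      (if j₀.val + 1 = f then (p : ℤ) ^ f - 1 else 0) := by
    simp only [expo, muShift_last_iff hf h₀]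
    rw [hs, hpow]
    apply Int.ediv_eq_of_eq_mul_right two_ne_zero
    split_ifs <;> ring
  refine ⟨he, ?_⟩
  rw [add_sub_assoc, ← hV, hs, hpow, he]
  split_ifs <;> ring

lemma expoSum_succ (i : ℕ) (r : Fin f → ℤ) : expoSum p f (i + 1) r =
    expoSum p f i r + expo p f (muShift p f i) fun j => muIter p f i j (r j) :=
  Finset.sum_range_succ _ _

/-- The digit values telescope, and `p ^ f - 1` is collected at each step where `μ₀` is not applied
to the last entry. -/
lemma two_mul_expoSum_add (hf : 1 < f) (i n : ℕ) (r : Fin f → ℤ) :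
    2 * expoSum p f (i + n) r = 2 * expoSum p f i r +
      ((p : ℤ) ^ f - 1) *
        ((Finset.Ico (i + (f - 1)) (i + (f - 1) + n)).filter fun a => a % f ≠ 0).card +
      intDigitVal p (fun j => muIter p f i j (r j)) -
      intDigitVal p (fun j => muIter p f (i + n) j (r j)) := by
  induction n with
  | zero => simp
  | succ n ih =>
    obtain ⟨j₀, h₀⟩ := exists_add_mod_eq hf (i + n) (c := 0) (by omega)
    have hlast : (i + (f - 1) + n) % f ≠ 0 ↔ ¬ j₀.val + 1 = f := by
      rw [not_iff_not]
      constructor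
      · intro h
        have := congrArg Fin.val (eq_of_add_mod_eq (i := i + n) (j := ⟨f - 1, by omega⟩) (l := j₀)
          (by rw [h₀, ← h]; congr 1; simp; omega))
        simp at this
        omega
      · intro h
        rw [← h₀]
        congr 1
        omega
    have h2 := (expo_muShift (p := p) hf h₀ fun j => muIter p f (i + n) j (r j)).2
    rw [← add_assoc, expoSum_succ, mul_add, ih, h2, card_filter_Ico_succ]
    simp only [hlast, muIter]
    split_ifs <;> push_cast <;> ring

lemma two_mul_expoSum_add_self (hf : 1 < f) (i : ℕ) (r : Fin f → ℤ) :
    2 * expoSum p f (i + f) r = 2 * expoSum p f i r + ((p : ℤ) ^ f - 1) * (f - 1) +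
      intDigitVal p (fun j => muIter p f i j (r j)) -
      intDigitVal p (fun j => muIter p f (i + f) j (r j)) := by
  rw [two_mul_expoSum_add hf, card_filter_mod_ne_zero hf, Nat.cast_sub hf.le, Nat.cast_one]

/-- The tuple has returned, so the digit values cancel. What remains is `p ^ f - 1` times `(f - 1) /
2` for odd `f`, and times `f - 1` for even `f`. -/
lemma dvd_expoSum_cycleLength (hf : 1 < f) (r : Fin f → ℤ) :
    (p : ℤ) ^ f - 1 ∣ expoSum p f (cycleLength f) r := by
  have hx : (fun j => muIter p f (0 + cycleLength f) j (r j)) =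
      fun j => muIter p f 0 j (r j) :=
    funext fun j => muIter_add_cycleLength hf 0 j _
  have h0 : expoSum p f 0 r = 0 := rfl
  rw [zero_add] at hx
  by_cases h : Odd f
  · have h1 := two_mul_expoSum_add_self (p := p) hf 0 r
    rw [cycleLength, if_pos h] at hx ⊢
    rw [zero_add, hx, h0] at h1
    obtain ⟨c, hc⟩ := h
    refine ⟨c, ?_⟩
    have hc' : (f : ℤ) - 1 = 2 * c := by omega
    rw [hc'] at h1
    linarith
  · have h1 := two_mul_expoSum_add_self (p := p) hf 0 r
    have h2 := two_mul_expoSum_add_self (p := p) hf f r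
    rw [cycleLength, if_neg h, two_mul] at hx ⊢
    rw [zero_add, h0] at h1
    rw [hx, h1] at h2
    exact ⟨f - 1, by linarith⟩

end Combinatorics

/-! ### The explicit cyclic modules -/

section Cycle

variable {p f : ℕ} {r : Fin f → ℕ}

/-- The interval from `1` to `p - 2` is stable under the reflection; the bound `r j ≤ p - 3` leaves
room for the initial raise. -/
lemma muLift_mem (hf : 1 < f) (hr : ∀ j, 1 ≤ r j ∧ r j ≤ p - 3) (i : ℕ) (j : Fin f) :
    1 ≤ muLift p f i j (r j) ∧ muLift p f i j (r j) + 2 ≤ p := by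
  induction i with
  | zero =>
    have := hr j
    simp only [muLift, muIter]
    split_ifs <;> omega
  | succ i ih =>
    rw [muLift_succ hf]
    split_ifs <;> omega

lemma even_muLift_sub (hf : 1 < f) (hp : Odd p) (i : ℕ) (j : Fin f) (x : ℤ) :
    Even (muLift p f i j x - muLift p f 0 j x) := by
  obtain ⟨c, hc⟩ := hp
  induction i with
  | zero => simp
  | succ i ih =>
    rw [muLift_succ hf]
    obtain ⟨d, hd⟩ := ih
    split_ifs
    · exact ⟨c - muLift p f i j x + d, by omega⟩
    · exact ⟨d, hd⟩

variable (p r) in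
/-- The tuple `μ⁽ⁱ⁾(𝐫)`. -/
def cycleTuple (i : ℕ) (j : Fin f) : ℕ := (muIter p f i j (r j)).toNat

lemma cast_cycleTuple (hf : 1 < f) (hr : ∀ j, 1 ≤ r j ∧ r j ≤ p - 3) (i : ℕ) (j : Fin f) :
    (cycleTuple p r i j : ℤ) = muIter p f i j (r j) := by
  have := muLift_mem hf hr i j
  apply Int.toNat_of_nonneg
  rw [muIter_eq]
  split_ifs <;> omega

lemma cycleTuple_eq (hf : 1 < f) (hr : ∀ j, 1 ≤ r j ∧ r j ≤ p - 3) (i : ℕ) (j : Fin f) :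
    (cycleTuple p r i j : ℤ) =
      muLift p f i j (r j) - if (i + j) % f = 1 then 1 else 0 := by
  rw [cast_cycleTuple hf hr, muIter_eq]

lemma isGenericTuple_cycleTuple (hf : 1 < f) (hr : ∀ j, 1 ≤ r j ∧ r j ≤ p - 3) (i : ℕ) :
    IsGenericTuple p (cycleTuple p r i) := by
  constructor
  · intro j
    have h1 := muLift_mem hf hr i j
    have h2 := cycleTuple_eq hf hr i j
    split_ifs at h2 <;> omega
  · obtain ⟨j, hj⟩ := exists_add_mod_eq hf i (c := 0) (by omega)
    have h1 := muLift_mem hf hr i j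
    have h2 := cycleTuple_eq hf hr i j
    rw [hj, if_neg zero_ne_one] at h2
    exact ⟨j, by omega, by omega⟩

lemma cycleTuple_add_cycleLength (hf : 1 < f) (i : ℕ) :
    cycleTuple p r (i + cycleLength f) = cycleTuple p r i := by
  funext j
  rw [cycleTuple, muIter_add_cycleLength hf, cycleTuple]

lemma intDigitVal_muIter (hf : 1 < f) (hr : ∀ j, 1 ≤ r j ∧ r j ≤ p - 3) (i : ℕ) :
    intDigitVal p (fun j => muIter p f i j (r j)) = digitVal p (cycleTuple p r i) := by
  rw [digitVal_cast]
  congr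
  funext j
  rw [cast_cycleTuple hf hr]

lemma isStep_cycleTuple (hf : 1 < f) (hr : ∀ j, 1 ≤ r j ∧ r j ≤ p - 3) (m : ℤ) (i : ℕ) :
    IsStep p (cycleTuple p r i) (expoSum p f i (fun j => r j) + m)
      (cycleTuple p r (i + 1)) (expoSum p f (i + 1) (fun j => r j) + m) := by
  obtain ⟨j₀, h₀⟩ := exists_add_mod_eq hf i (c := 0) (by omega)
  let j₁ : Fin f := ⟨(j₀.val + 1) % f, Nat.mod_lt _ (by omega)⟩
  have h₁ : (i + j₁) % f = 1 := by
    change (i + (j₀.val + 1) % f) % f = 1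
    rw [Nat.add_mod_mod, ← add_assoc, succ_mod_eq hf, h₀, if_neg (by omega)]
  have hx := (isGenericTuple_cycleTuple hf hr i).1
  have hentry : ∀ j, (cycleTuple p r (i + 1) j : ℤ) = mu p ((i + j.val) % f) (cycleTuple p r i j) :=
    fun j => by
      rw [cast_cycleTuple hf hr, cast_cycleTuple hf hr]
      rfl
  have hx₀ : 1 ≤ cycleTuple p r i j₀ := by
    have := hentry j₀
    rw [h₀] at this
    simp only [mu] at this
    omega
  have hx₁ : cycleTuple p r i j₁ + 2 ≤ p := by
    have := hentry j₁
    rw [h₁] at this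
    simp only [mu] at this
    omega
  -- At `j₀` the digit `p - 1 - x` plus the carried `p` splits as `(p - x) + (p - 1)`, whose
  -- difference is `x - 1`.
  refine ⟨j₀, j₁, Pi.single j₀ (p - cycleTuple p r i j₀),
    Pi.single j₀ (p - cycleTuple p r i j₀) + cycleTuple p r (i + 1), ?_, hx₁, ?_, ?_, ?_, rfl, ?_⟩
  · have := j₀.2
    by_cases h : j₀.val + 1 = f
    · exact Or.inr ⟨by simp [j₁, h], h⟩
    · exact Or.inl (Nat.mod_eq_of_lt (by omega))
  · funext j
    have h := hentry j
    have hj := hx j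
    have e0 : j = j₀ ↔ (i + j.val) % f = 0 :=
      ⟨fun h => h ▸ h₀, fun h => eq_of_add_mod_eq (h.trans h₀.symm)⟩
    have e1 : j = j₁ ↔ (i + j.val) % f = 1 :=
      ⟨fun h => h ▸ h₁, fun h => eq_of_add_mod_eq (h.trans h₁.symm)⟩
    simp only [Pi.add_apply, Pi.single_apply, e1]
    by_cases hj₀ : j = j₀
    · subst hj₀
      rw [h₀] at h ⊢
      simp only [mu] at h
      simp
      omega
    · have hc := mt e0.2 hj₀
      simp only [hj₀, if_false]
      revert h hc
      generalize (i + j.val) % f = c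
      intro h hc
      match c with
      | 0 => exact absurd rfl hc
      | 1 =>
        simp only [mu] at h
        simp
        omega
      | c + 2 =>
        simp only [mu] at h
        simp
        omega
  · intro j hj
    rw [Pi.single_eq_of_ne hj]
  · have h := hentry j₀
    have hj := hx j₀
    rw [h₀] at h
    simp only [mu] at h
    simp only [Pi.add_apply, Pi.single_eq_same]
    omega
  · obtain ⟨h1, h2⟩ := expo_muShift (p := p) hf h₀ fun j => muIter p f i j (r j)
    have h3 := intDigitVal_muIter hf hr i
    have h4 : intDigitVal p (fun j => muShift p f i j (muIter p f i j (r j))) =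
      digitVal p (cycleTuple p r (i + 1)) := intDigitVal_muIter hf hr (i + 1)
    have h5 : (digitVal p (Pi.single j₀ (p - cycleTuple p r i j₀) : Fin f → ℕ) : ℤ) =
        p ^ j₀.val * (p - muIter p f i j₀ (r j₀)) := by
      rw [digitVal_single, ← cast_cycleTuple hf hr, Nat.cast_mul, Nat.cast_sub (hx j₀).le]
      push_cast
      ring
    rw [h3] at h1 h2
    rw [h4] at h2
    rw [expoSum_succ, digitVal_add, Nat.cast_add, h5]
    -- Subtracting the closed form of the exponent from its doubled form leaves exactly `p ^ f - 1`,
    -- whether or not the carry wraps.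
    refine ⟨1, ?_⟩
    split_ifs at h1 h2 <;> linarith

lemma IsStep.of_dvd {x s : Fin f → ℕ} {m m' n : ℤ} (h : IsStep p x m s n)
    (hm : (p : ℤ) ^ f - 1 ∣ m - m') : IsStep p x m' s n := by
  obtain ⟨j₀, j₁, lo, hi, h1, h2, h3, h4, h5, h6, h7⟩ := h
  refine ⟨j₀, j₁, lo, hi, h1, h2, h3, h4, h5, h6, ?_⟩
  have := dvd_add h7 hm
  rwa [show n - (m - digitVal p hi) + (m - m') = n - (m' - digitVal p hi) by ring] at this

/-- Lifted entries keep their parity along the cycle, and the true entry differs from the lifted one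
only at residue `1`. Matching parities therefore put residue `1` at the same position for `a` and
`b`. -/
lemma mod_eq_of_even_cycleTuple_add (hf : 1 < f) (hp : Odd p)
    (hr : ∀ j, 1 ≤ r j ∧ r j ≤ p - 3) {a b : ℕ}
    (h : ∀ j, Even (cycleTuple p r a j + cycleTuple p r b j)) : a % f = b % f := by
  obtain ⟨j, hj⟩ := exists_add_mod_eq hf a hf
  have h1 := cycleTuple_eq hf hr a j
  have h2 := cycleTuple_eq hf hr b j
  obtain ⟨c, hc⟩ := even_muLift_sub hf hp a j (r j)
  obtain ⟨d, hd⟩ := even_muLift_sub hf hp b j (r j)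
  obtain ⟨e, he⟩ := h j
  rw [if_pos hj] at h1
  have hj' : (b + j.val) % f = 1 := by
    by_contra hne
    rw [if_neg hne] at h2
    omega
  have h3 : a + j.val ≡ b + j.val [MOD f] := hj.trans hj'.symm
  exact Nat.ModEq.add_right_cancel' j.val h3

lemma eq_or_of_mod_eq {a b : ℕ} (ha : a < cycleLength f) (hb : b < cycleLength f)
    (h : (a + 1) % f = (b + 1) % f) : a = b ∨ ¬ Odd f ∧ (b = a + f ∨ a = b + f) := by
  have h1 : a ≡ b [MOD f] := Nat.ModEq.add_right_cancel' 1 h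
  rw [cycleLength] at ha hb
  by_cases hf : Odd f
  · rw [if_pos hf] at ha hb
    exact Or.inl (Nat.ModEq.eq_of_lt_of_lt h1 ha hb)
  · rw [if_neg hf] at ha hb
    have ha' := Nat.div_add_mod a f
    have hb' := Nat.div_add_mod b f
    have ha2 : a / f < 2 := Nat.div_lt_of_lt_mul (by omega)
    have hb2 : b / f < 2 := Nat.div_lt_of_lt_mul (by omega)
    rw [Nat.ModEq] at h1
    suffices a = b ∨ b = a + f ∨ a = b + f from this.imp_right fun h => ⟨hf, h⟩
    generalize a / f = A at *
    generalize b / f = B at *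
    interval_cases A <;> interval_cases B <;> omega

/-- If the tuples agree, twice the difference of exponents is `(p ^ f - 1) * (f - 1)`, and `f - 1`
is odd. -/
lemma not_dvd_expoSum_add_self (hf : 1 < f) (hp : 1 < p) (hodd : ¬ Odd f)
    (hr : ∀ j, 1 ≤ r j ∧ r j ≤ p - 3) {a : ℕ}
    (h : cycleTuple p r (a + f) = cycleTuple p r a) :
    ¬ ((p : ℤ) ^ f - 1 ∣ expoSum p f (a + f) (fun j => r j) - expoSum p f a (fun j => r j)) := by
  rintro ⟨c, hc⟩
  have h1 := two_mul_expoSum_add_self (p := p) hf a (fun j => (r j : ℤ))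
  rw [intDigitVal_muIter hf hr, intDigitVal_muIter hf hr, h] at h1
  have hq : (p : ℤ) ^ f - 1 ≠ 0 := by
    have : (1 : ℤ) < (p : ℤ) ^ f := one_lt_pow₀ (by exact_mod_cast hp) (by omega)
    omega
  have h2 : ((p : ℤ) ^ f - 1) * (2 * c) = ((p : ℤ) ^ f - 1) * (f - 1) := by linarith
  have h3 := mul_left_cancel₀ hq h2
  rw [Nat.not_odd_iff_even] at hodd
  obtain ⟨d, hd⟩ := hodd
  omega

/-- At residue `1` the two lifted entries are reflections of each other and each is lowered by one,
so the sum is `p - 3`. -/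
lemma cycleTuple_add_self_add_ne (hf : 1 < f) (hodd : ¬ Odd f)
    (hr : ∀ j, 1 ≤ r j ∧ r j ≤ p - 3) (a : ℕ) :
    ¬ ∀ j, cycleTuple p r (a + f) j + cycleTuple p r a j = p - 1 := by
  intro h
  obtain ⟨j, hj⟩ := exists_add_mod_eq hf a hf
  have h0 := h j
  have h1 := cycleTuple_eq hf hr a j
  have h2 := cycleTuple_eq hf hr (a + f) j
  have h3 := hr j
  rw [muLift_add_self hf, if_neg hodd, add_right_comm, Nat.add_mod_right, if_pos hj] at h2
  rw [if_pos hj] at h1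
  omega

variable [Fact p.Prime] {F : Type u} [Field F] [Fintype F] [CharP F p] (k : Type v) [Field k]
  [Algebra F k]

lemma finRotate_symm_val {n : ℕ} (i : Fin n) :
    ((finRotate n).symm i).val + 1 = i.val ∨
      i.val = 0 ∧ ((finRotate n).symm i).val + 1 = n := by
  obtain ⟨i, rfl⟩ := (finRotate n).surjective i
  rw [Equiv.symm_apply_apply]
  obtain _ | n := n
  · exact i.elim0
  · rw [coe_finRotate]
    split_ifs with h
    · right
      simp [h]
    · left
      rfl

lemma exists_isCyclicModuleOn_cycleWeight (hp : 3 < p) (hF : Fintype.card F = p ^ f) (hf : 1 < f)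
    (hr : ∀ j, 1 ≤ r j ∧ r j ≤ p - 3) (m : ℤ) :
    ∃ D : Rep.{v} k (GL (Fin 2) F),
      IsCyclicModuleOn p f (fun i : Fin (cycleLength f) => cycleWeight p f k F r m (i.val + 1)) D ∧
        IsMultiplicityFree D ∧ socleLength D = cycleLength f := by
  have hodd : Odd p := (Fact.out : p.Prime).odd_of_ne_two (by omega)
  refine exists_isCyclicModuleOn k hF (fun i => cycleTuple p r (i.val + 1))
    (fun i => expoSum p f (i.val + 1) (fun j => r j) + m)
    (fun i => isGenericTuple_cycleTuple hf hr _) (fun i => ?_) (fun i i' hx hm => ?_)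
    (fun i i' hx hm => ?_)
  · have hstep := isStep_cycleTuple hf hr m i.val
    -- Only the predecessor of the first index wraps: it carries the tuple of step `cycleLength f`,
    -- which equals that of step `0`, with exponent congruent modulo `p ^ f - 1`.
    rcases finRotate_symm_val i with h | ⟨h, h'⟩
    · rw [h]
      exact hstep
    · rw [h']
      rw [h] at hstep ⊢
      have h1 := cycleTuple_add_cycleLength (p := p) (r := r) hf 0
      rw [zero_add] at h1
      rw [h1]
      refine hstep.of_dvd ?_
      rw [add_sub_add_right_eq_sub]
      exact dvd_sub (by simp [expoSum]) (dvd_expoSum_cycleLength hf _)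
  · have hmod := mod_eq_of_even_cycleTuple_add hf hodd hr (a := i.val + 1) (b := i'.val + 1)
      (fun j => by rw [show cycleTuple p r (i.val + 1) j = _ from congrFun hx j]; exact ⟨_, rfl⟩)
    rw [add_sub_add_right_eq_sub] at hm
    rcases eq_or_of_mod_eq i.2 i'.2 hmod with h | ⟨hfo, h | h⟩
    · exact Fin.ext h
    · rw [h, add_right_comm] at hx hm
      exact absurd ((dvd_sub_comm).1 hm)
        (not_dvd_expoSum_add_self hf (by omega) hfo hr hx.symm)
    · rw [h, add_right_comm] at hx hm
      exact absurd hm (not_dvd_expoSum_add_self hf (by omega) hfo hr hx)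
  · obtain ⟨c, hc⟩ := hodd
    have hmod := mod_eq_of_even_cycleTuple_add hf ⟨c, hc⟩ hr
      (fun j => by rw [hx j]; exact ⟨c, by omega⟩)
    -- Complementary tuples have even entry sums `p - 1`, so the steps agree modulo `f`. At equal
    -- steps the exponents differ by the value of a generic tuple; `f` steps apart the entries
    -- cannot be complementary.
    rcases eq_or_of_mod_eq i.2 i'.2 hmod with h | ⟨hfo, h | h⟩
    · rw [h, sub_add_cancel_left, dvd_neg] at hm
      exact (isGenericTuple_cycleTuple hf hr _).not_dvd hm
    · refine cycleTuple_add_self_add_ne hf hfo hr (i.val + 1) fun j => ?_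
      rw [← hx j, h, add_right_comm, add_comm]
    · refine cycleTuple_add_self_add_ne hf hfo hr (i'.val + 1) fun j => ?_
      rw [← hx j, h, add_right_comm]

/-- With one digit, carry and borrow occur at the same place. For `x = 1` the complement is `p - 2`,
and `p - 2 + (p - 1) = lo + hi` with `lo = p - 2`, `hi = p - 1` leads back to `1`. The two
constituents differ since `1 ≠ p - 2` for `p > 3`. -/
lemma exists_isCyclicModule_prime (hp : 3 < p) (hF : Fintype.card F = p ^ 1) :
    ∃ D : Rep.{v} k (GL (Fin 2) F), IsCyclicModule p 1 D ∧ IsMultiplicityFree D := by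
  have h1 : 1 < p := by omega
  have h2 : 1 + 2 ≤ p := by omega
  obtain ⟨D, hD, hmf, -⟩ := exists_isCyclicModuleOn k hF (n := 1) (fun _ _ => 1) (fun _ => 0)
    (fun _ => ⟨fun _ => h1, 0, le_rfl, h2⟩)
    (fun _ => ⟨0, 0, fun _ => p - 2, fun _ => p - 1, Or.inr ⟨rfl, rfl⟩, h2, by
      funext j
      simp only [Pi.add_apply, Subsingleton.elim j 0, Pi.single_eq_same]
      omega, fun j hj => absurd (Subsingleton.elim j 0) hj, rfl, by
      funext j
      simp only [Pi.add_apply]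
      omega, ⟨1, by simp [digitVal, Nat.cast_sub (by omega : 1 ≤ p)]⟩⟩)
    (fun i i' _ _ => Subsingleton.elim i i') (fun i i' h => absurd (h 0) (by omega))
  exact ⟨D, ⟨1, _, one_ne_zero, hD⟩, hmf⟩

end Cycle

end CyclicModule

end

theorem theorem1p3 {p f : ℕ} [Fact p.Prime] (hp : 3 < p) (hf : 1 ≤ f)
    (F : Type*) [Field F] [Fintype F] [CharP F p] (hF : Fintype.card F = p ^ f)
    (k : Type*) [Field k] [Algebra F k] [IsAlgClosure F k] :
    (∃ D : Rep k (GL (Fin 2) F),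
      CyclicModule.IsCyclicModule p f D ∧ CyclicModule.IsMultiplicityFree D) ∧
    (1 < f → ∀ r : Fin f → ℕ, (∀ j, 1 ≤ r j ∧ r j ≤ p - 3) → ∀ m : ℤ,
      ∃ D : Rep k (GL (Fin 2) F),
        CyclicModule.IsCyclicModuleOn p f
          (fun i : Fin (CyclicModule.cycleLength f) =>
            CyclicModule.cycleWeight p f k F r m (i.val + 1)) D ∧
        CyclicModule.IsMultiplicityFree D ∧
        CyclicModule.socleLength D = CyclicModule.cycleLength f) := by
  refine ⟨?_, fun hf' r hr m =>
    CyclicModule.exists_isCyclicModuleOn_cycleWeight k hp hF hf' hr m⟩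
  obtain rfl | hf' := hf.eq_or_lt
  · exact CyclicModule.exists_isCyclicModule_prime k hp hF
  -- The tuple with all entries `1` is admissible because `p > 3`.
  · obtain ⟨D, hD, hmf, -⟩ := CyclicModule.exists_isCyclicModuleOn_cycleWeight k hp hF hf'
      (r := fun _ => 1) (fun _ => ⟨le_rfl, by omega⟩) 0
    refine ⟨D, ⟨_, _, ?_, hD⟩, hmf⟩
    rw [CyclicModule.cycleLength]
    split_ifs <;> omega
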